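/- **Setting.** Let $(\Omega,\mathcal F,\mathsf P)$ be a probability space, $T\ge1$, and let $d,s,\mu$ be vectors of $r$ positive integers. For a step vector $\nu\in\mathbb Z^r$ whose entries are all positive or all negative, the generalized multiple (GM) increment of a sequence $x$ is $$\chi_{\nu,s}x(m)=\prod_{i=1}^r(1-B^{\nu_is_i})^{d_i}x(m)=\sum_{l_1\le d_1,\dots,l_r\le d_r}(-1)^{l_1+\dots+l_r}\prod_i\binom{d_i}{l_i}\;x\Big(m-\sum_i\nu_is_il_i\Big).$$ Put $\chi_\nu(e^{-i\lambda})=\prod_j(1-e^{-i\lambda\nu_js_j})^{d_j}$, $\chi_\nu(e^{i\lambda})=\overline{\chi_\nu(e^{-i\lambda})}$, $\beta(\lambda)=\prod_j\prod_{k=-[s_j/2]}^{[s_j/2]}(i\lambda-2\pi ik/s_j)^{d_j}$ and $n=\sum_i\mu_is_id_i$. Let $e(k)$ and $d_\mu(k)$ be the coefficients of $\prod_i(1-x^{\mu_is_i})^{d_i}$ and of $\prod_i\big(\sum_{j\ge0}x^{\mu_is_ij}\big)^{d_i}$, with $e(k)=0$ for $k<0$. All densities are taken with respect to $d\lambda/2\pi$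 on $[-\pi,\pi)$. Let $\vartheta(m)$, $m\in\mathbb Z$, be a complex random sequence whose increments $\chi_{\nu,Ts}\vartheta$ are square integrable, have mean $0$, and have covariances $\mathsf E\,\chi_{\nu_1,Ts}\vartheta(m)\overline{\chi_{\nu_2,Ts}\vartheta(k)}$ unchanged when $m,k$ are replaced by $m+T,k+T$, for all $\nu_1,\nu_2$ (periodically stationary GM increments with period $T$). Let $\eta(m)$ be a square integrable sequence with mean $0$. Put $\xi_p(m)=\vartheta(mT+p-1)$, $\eta_p(m)=\eta(mT+p-1)$ for $1\le p\le T$, $\vec\xi=(\xi_p)$, $\vec\eta=(\eta_p)$, $\vec\zeta=\vec\xi+\vec\eta$. Assume that $f,g$ are integrable, almost everywhere nonnegative definite $T\times T$ matrix functions which are the spectral densities of $\chi_{\nu,s}\vec\xi$ and $\vec\eta$: for all $\nu_1,\nu_2,p,q,m,k$ $$\mathsf E\,\chi_{\nu_1,s}\xi_p(m)\overline{\chi_{\nu_2,s}\xi_q(k)}=\frac1{2\pi}\int_{-\pi}^{\pi}e^{i\lambda(m-k)}\frac{\chi_{\nu_1}(e^{-i\lambda})\chi_{\nu_2}(e^{i\lambda})}{|\beta(\lambda)|^2}f_{pq}(\lambda)\,d\lambda,\qquad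 \mathsf E\,\eta_p(m)\overline{\eta_q(k)}=\frac1{2\pi}\int_{-\pi}^{\pi}e^{i\lambda(m-k)}g_{pq}(\lambda)\,d\lambda,$$ that the increments $\chi_{\nu,s}\vec\xi$ are uncorrelated with $\vec\eta$, and, with $w=f+|\beta|^2g$, that $w$ is invertible almost everywhere and the minimality condition $$\int_{-\pi}^{\pi}\operatorname{Tr}\Big[\frac{|\beta(\lambda)|^2}{|\chi_\mu(e^{-i\lambda})|^2}\,w(\lambda)^{-1}\Big]d\lambda<\infty$$ holds. **Functional and estimates.** Let $M\ge0$, $a(0),\dots,a(M)\in\mathbb C$, $A_M\vartheta=\sum_{k=0}^Ma(k)\vartheta(k)$ and $N=[M/T]$. For $0\le m\le N$ put $a_p(m)=a(mT+p-1)$ if $mT+p-1\le M$ and $a_p(m)=0$ otherwise, and $\vec a(m)=(a_p(m))_{p=1}^T$. Let $\vec b(k)=\sum_{m=k}^Nd_\mu(m-k)\vec a(m)$ for $0\le k\le N$, $\vec v(k)=\sum_{l=0}^{\min(N,k+n)}e(l-k)\vec b(l)$ for $-n\le k\le-1$, and $V_N\vec\zeta=\sum_{k=-n}^{-1}\vec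 v(k)^\top\vec\zeta(k)$. The sequence $\vec\zeta$ is observed at block times $m\in\mathbb Z\setminus\{0,\dots,N\}$, that is, $\vartheta+\eta$ is observed on $\mathbb Z\setminus\{0,\dots,(N+1)T-1\}$. A linear estimate of $A_M\vartheta$ is a random variable $y-V_N\vec\zeta$ with $y$ in the closed linear span in $L_2(\mathsf P)$ of the observed increments $\chi_{\mu,s}\zeta_p(k)$, $1\le p\le T$, $k\le-1$ or $k\ge N+n+1$. It is optimal if its mean-square error is least among all linear estimates. **Theorem.** One has $A_M\vartheta=\sum_{m=0}^N\vec a(m)^\top\vec\xi(m)$. For $0\le j,k\le N+n$ (and $0\le j,k\le N$ for $Q$) the $T\times T$ matrices $$P_{j,k}=\frac1{2\pi}\int_{-\pi}^{\pi}e^{i\lambda(k-j)}\Big[\frac{|\beta|^2}{|\chi_\mu(e^{-i\lambda})|^2}w^{-1}\Big]^{\top}d\lambda,\quad T_{j,k}=\frac1{2\pi}\int_{-\pi}^{\pi}e^{i\lambda(k-j)}\Big[\frac{|\beta|^2}{\chi_\mu(e^{-i\lambda})}g\,w^{-1}\Big]^{\top}d\lambda,\quad Q_{j,k}=\frac1{2\pi}\int_{-\pi}^{\pi}e^{i\lambda(k-j)}\big[f\,w^{-1}g\big]^{\top}d\lambda$$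 are well defined (the integrands are integrable), and the block matrix $\mathbf P=(P_{j,k})$ is invertible. Let $\mathbf T=(T_{j,k})$, $\mathbf Q=(Q_{j,k})$, let $\mathbf a$ be the stacked vector of $\vec a(0),\dots,\vec a(N)$, let $[\mathbf a]_+$ and $[\mathbf b]_+$ be the stacked vectors of $\vec a(0),\dots,\vec a(N)$ and $\vec b(0),\dots,\vec b(N)$ followed by $nT$ zeros, and let $$\mathbf R=[\mathbf b]_+-\mathbf T[\mathbf a]_+,\qquad \mathbf c=\mathbf P^{-1}\mathbf R=(\vec c(0),\dots,\vec c(N+n)).$$ If the entries of $|\beta|^2|\chi_\mu|^{-2}g\,w^{-1}$ are integrable, then also $\mathbf T[\mathbf a]_+=(-1)^{d_1+\dots+d_r}\mathbf T'\mathbf a_\mu$, where $\mathbf T'$ is $\mathbf T$ with $|\chi_\mu(e^{-i\lambda})|^2$ in place of $\chi_\mu(e^{-i\lambda})$ and $\mathbf a_\mu$ stacks the vectors $\sum_{l=0}^Ne(l-m+n)\vec a(l)$, $0\le m\le N+n$. Put $A(\lambda)=\sum_{k=0}^N\vec a(k)e^{ik\lambda}$, $B(\lambda)=\sum_{k=0}^N\vec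 b(k)e^{ik\lambda}$, $C(\lambda)=\sum_{k=0}^{N+n}\vec c(k)e^{ik\lambda}$. There is a process $Z=(Z_p)_{p=1}^T$ on $[-\pi,\pi)$ with square integrable values and centred uncorrelated increments, with spectral density $w$ (that is, $\mathsf E(Z_p(\lambda_2)-Z_p(\lambda_1))\overline{(Z_q(\lambda_2)-Z_q(\lambda_1))}=\frac1{2\pi}\int_{\lambda_1}^{\lambda_2}w_{pq}\,d\lambda$), such that $\chi_{\nu,s}\zeta_p(k)=\int e^{ik\lambda}\frac{\chi_\nu(e^{-i\lambda})}{\beta(\lambda)}\,dZ_p(\lambda)$ for all $\nu,p,k$. An optimal linear estimate of $A_M\vartheta$ exists, and for every such $Z$ a random variable $\widehat A$ is an optimal linear estimate if and only if $$\widehat A=\int_{-\pi}^{\pi}h(\lambda)^\top dZ(\lambda)-V_N\vec\zeta\quad\text{almost surely},$$ with the spectral characteristic $$h^\top=B^\top\frac{\chi_\mu(e^{-i\lambda})}{\beta}-A^\top g\,\overline{\beta}\,w^{-1}-C^\top\frac{\overline{\beta}}{\chi_\mu(e^{i\lambda})}\,w^{-1}.$$ The error $A_M\vartheta-\widehat A$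 is square integrable, and, with $\langle x,y\rangle=\sum_ix_i\overline{y_i}$, $$\mathsf E|A_M\vartheta-\widehat A|^2=\langle\mathbf R,\mathbf P^{-1}\mathbf R\rangle+\langle\mathbf Q\mathbf a,\mathbf a\rangle$$ $$=\frac1{2\pi}\int_{-\pi}^{\pi}\frac{|\beta|^2}{|\chi_\mu|^2}\,u^\top w^{-1}f\,w^{-1}\overline u\,d\lambda+\frac1{2\pi}\int_{-\pi}^{\pi}\frac1{|\chi_\mu|^2}\,z^\top w^{-1}g\,w^{-1}\overline z\,d\lambda,$$ where $u^\top=\chi_\mu(e^{i\lambda})A^\top g+C^\top$, $z^\top=\chi_\mu(e^{i\lambda})A^\top f-|\beta|^2C^\top$, and both integrands are integrable. -/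

import Mathlib

open MeasureTheory
open scoped ComplexConjugate Matrix ComplexOrder

noncomputable section

namespace GMInterp

/-! ## Generalized multiple increments -/

/-- Admissible step vectors: all steps positive, or all steps negative. -/
def AdmissibleStep {r : ℕ} (ν : Fin r → ℤ) : Prop :=
  (∀ i, 0 < ν i) ∨ (∀ i, ν i < 0)

/-- The GM increment
`(1 - B_{ν₁}^{s₁})^{d₁} ⋯ (1 - B_{ν_r}^{s_r})^{d_r} x(m)`, written out as
`∑_{l₁ ≤ d₁} ⋯ ∑_{l_r ≤ d_r} (-1)^{∑ l} ∏ (dᵢ choose lᵢ) x(m - ∑ νᵢ sᵢ lᵢ)`. -/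
def gmIncrement {Ω : Type*} {r : ℕ} (d s : Fin r → ℕ) (ν : Fin r → ℤ)
    (x : ℤ → Ω → ℂ) (m : ℤ) : Ω → ℂ := fun ω =>
  ∑ l ∈ Fintype.piFinset (fun i => Finset.range (d i + 1)),
    (-1 : ℂ) ^ (∑ i, l i) * (∏ i, ((d i).choose (l i) : ℂ)) *
      x (m - ∑ i, ν i * (s i : ℤ) * (l i : ℤ)) ω

/-- `x` is a random sequence whose GM increments with seasonal vector `T s` are periodically
stationary: `T` is a period of the means and of the covariances of the increments, for all
steps.  (`T` need not be the least period.) -/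
structure HasPeriodicallyStationaryGMIncrements {Ω : Type*} [MeasurableSpace Ω]
    (P : Measure Ω) (T : ℕ) {r : ℕ} (d s : Fin r → ℕ) (x : ℤ → Ω → ℂ) : Prop where
  aemeasurable : ∀ m, AEMeasurable (x m) P
  memLp : ∀ ν, AdmissibleStep ν → ∀ m, MemLp (gmIncrement d (fun i => T * s i) ν x m) 2 P
  mean : ∀ ν, AdmissibleStep ν → ∀ m,
    ∫ ω, gmIncrement d (fun i => T * s i) ν x (m + T) ω ∂P =
      ∫ ω, gmIncrement d (fun i => T * s i) ν x m ω ∂P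
  cov : ∀ ν₁ ν₂, AdmissibleStep ν₁ → AdmissibleStep ν₂ → ∀ m k,
    ∫ ω, gmIncrement d (fun i => T * s i) ν₁ x (m + T) ω *
        conj (gmIncrement d (fun i => T * s i) ν₂ x (k + T) ω) ∂P =
      ∫ ω, gmIncrement d (fun i => T * s i) ν₁ x m ω *
        conj (gmIncrement d (fun i => T * s i) ν₂ x k ω) ∂P

/-- Blocking of a scalar sequence into a `T`-dimensional one.  The component index is counted
from `0`, so that `block T x p m = x (m T + p)`. -/
def block {Ω : Type*} (T : ℕ) (x : ℤ → Ω → ℂ) (p : Fin T) (m : ℤ) : Ω → ℂ :=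
  x (m * (T : ℤ) + ((p : ℕ) : ℤ))

/-! ## Spectral densities -/

/-- Normalised Lebesgue measure `dλ / 2π` on `[-π, π)`.  All spectral densities are taken with
respect to it. -/
def freqMeasure : Measure ℝ :=
  (ENNReal.ofReal (2 * Real.pi))⁻¹ • volume.restrict (Set.Ico (-Real.pi) Real.pi)

/-- The exponential `e^{i k λ}`. -/
def expo (k : ℤ) (x : ℝ) : ℂ := Complex.exp (Complex.I * (k : ℂ) * (x : ℂ))

/-- `χ_ν(e^{-iλ}) = ∏_j (1 - e^{-iλ ν_j s_j})^{d_j}`. -/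
def chi {r : ℕ} (d s : Fin r → ℕ) (ν : Fin r → ℤ) (x : ℝ) : ℂ :=
  ∏ j, (1 - expo (-(ν j * (s j : ℤ))) x) ^ d j

/-- `β(iλ) = ∏_j ∏_{k = -[s_j/2]}^{[s_j/2]} (iλ - 2π i k / s_j)^{d_j}`. -/
def beta {r : ℕ} (d s : Fin r → ℕ) (x : ℝ) : ℂ :=
  ∏ j, ∏ k ∈ Finset.Icc (-((s j / 2 : ℕ) : ℤ)) ((s j / 2 : ℕ) : ℤ),
    (Complex.I * (x : ℂ) - 2 * (Real.pi : ℂ) * Complex.I * (k : ℂ) / (s j : ℂ)) ^ d j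

/-- A `T × T` matrix-valued density: integrable and nonnegative definite almost everywhere. -/
structure IsMatrixDensity {T : ℕ} (f : ℝ → Matrix (Fin T) (Fin T) ℂ) : Prop where
  integrable : ∀ p q, Integrable (fun x => f x p q) freqMeasure
  posSemidef : ∀ᵐ x ∂freqMeasure, (f x).PosSemidef

/-- The vector sequence `ξ` has (wide sense) stationary GM increments with spectral density `f`:
for all steps `ν₁, ν₂`,
`E χ_{ν₁}ξ_p(m) conj(χ_{ν₂}ξ_q(k))
  = (1/2π) ∫ e^{iλ(m-k)} χ_{ν₁}(e^{-iλ}) χ_{ν₂}(e^{iλ}) |β(iλ)|⁻² f_{pq}(λ) dλ`. -/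
structure IsGMSpectralDensity {Ω : Type*} [MeasurableSpace Ω] (P : Measure Ω) {T r : ℕ}
    (d s : Fin r → ℕ) (ξ : Fin T → ℤ → Ω → ℂ) (f : ℝ → Matrix (Fin T) (Fin T) ℂ) : Prop where
  density : IsMatrixDensity f
  memLp : ∀ ν, AdmissibleStep ν → ∀ p m, MemLp (gmIncrement d s ν (ξ p) m) 2 P
  structural : ∀ ν₁ ν₂, AdmissibleStep ν₁ → AdmissibleStep ν₂ → ∀ p q m k,
    ∫ ω, gmIncrement d s ν₁ (ξ p) m ω * conj (gmIncrement d s ν₂ (ξ q) k ω) ∂P =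
      ∫ x, expo (m - k) x * chi d s ν₁ x * conj (chi d s ν₂ x) /
        ((‖beta d s x‖ ^ 2 : ℝ) : ℂ) * f x p q ∂freqMeasure

/-- The vector sequence `η` is (wide sense) stationary with spectral density `g`. -/
structure IsStationarySpectralDensity {Ω : Type*} [MeasurableSpace Ω] (P : Measure Ω) {T : ℕ}
    (η : Fin T → ℤ → Ω → ℂ) (g : ℝ → Matrix (Fin T) (Fin T) ℂ) : Prop where
  density : IsMatrixDensity g
  memLp : ∀ p m, MemLp (η p m) 2 P
  cov : ∀ p q m k,
    ∫ ω, η p m ω * conj (η q k ω) ∂P = ∫ x, expo (m - k) x * g x p q ∂freqMeasure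

/-- The spectral density `f + |β|² g` of the increments of `ζ = ξ + η`. -/
def obsDensity {T r : ℕ} (d s : Fin r → ℕ) (f g : ℝ → Matrix (Fin T) (Fin T) ℂ) (x : ℝ) :
    Matrix (Fin T) (Fin T) ℂ :=
  f x + ((‖beta d s x‖ ^ 2 : ℝ) : ℂ) • g x

/-- `|β|² |χ_μ|⁻² (f + |β|² g)⁻¹`. -/
def kernelP {T r : ℕ} (d s : Fin r → ℕ) (μ : Fin r → ℤ)
    (f g : ℝ → Matrix (Fin T) (Fin T) ℂ) (x : ℝ) : Matrix (Fin T) (Fin T) ℂ :=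
  ((‖beta d s x‖ ^ 2 / ‖chi d s μ x‖ ^ 2 : ℝ) : ℂ) • (obsDensity d s f g x)⁻¹

/-- `|β|² χ_μ(e^{-iλ})⁻¹ g (f + |β|² g)⁻¹`. -/
def kernelT {T r : ℕ} (d s : Fin r → ℕ) (μ : Fin r → ℤ)
    (f g : ℝ → Matrix (Fin T) (Fin T) ℂ) (x : ℝ) : Matrix (Fin T) (Fin T) ℂ :=
  (((‖beta d s x‖ ^ 2 : ℝ) : ℂ) / chi d s μ x) • (g x * (obsDensity d s f g x)⁻¹)

/-- `|β|² |χ_μ|⁻² g (f + |β|² g)⁻¹`. -/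
def kernelT' {T r : ℕ} (d s : Fin r → ℕ) (μ : Fin r → ℤ)
    (f g : ℝ → Matrix (Fin T) (Fin T) ℂ) (x : ℝ) : Matrix (Fin T) (Fin T) ℂ :=
  ((‖beta d s x‖ ^ 2 / ‖chi d s μ x‖ ^ 2 : ℝ) : ℂ) • (g x * (obsDensity d s f g x)⁻¹)

/-- `f (f + |β|² g)⁻¹ g`. -/
def kernelQ {T r : ℕ} (d s : Fin r → ℕ)
    (f g : ℝ → Matrix (Fin T) (Fin T) ℂ) (x : ℝ) : Matrix (Fin T) (Fin T) ℂ :=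
  f x * (obsDensity d s f g x)⁻¹ * g x

/-- The minimality condition `∫ Tr[|β|² |χ_μ|⁻² (f + |β|² g)⁻¹] dλ < ∞`, which includes that the
inverse exists almost everywhere. -/
structure MinimalityCondition {T r : ℕ} (d s : Fin r → ℕ) (μ : Fin r → ℤ)
    (f g : ℝ → Matrix (Fin T) (Fin T) ℂ) : Prop where
  isUnit_det : ∀ᵐ x ∂freqMeasure, IsUnit (obsDensity d s f g x).det
  integrable_trace : Integrable (fun x => (kernelP d s μ f g x).trace) freqMeasure

/-- The block matrix with `(j, k)` block `(1/2π) ∫ e^{iλ(k-j)} K(λ)ᵀ dλ`, `0 ≤ j, k < L`.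
The transpose makes it act on columns in the way the Fourier coefficients of `K` act on rows. -/
def fourierBlockMatrix {T : ℕ} (L : ℕ) (K : ℝ → Matrix (Fin T) (Fin T) ℂ) :
    Matrix (Fin L × Fin T) (Fin L × Fin T) ℂ :=
  Matrix.of fun jp kq =>
    ∫ x, expo (((kq.1 : ℕ) : ℤ) - ((jp.1 : ℕ) : ℤ)) x * K x kq.2 jp.2 ∂freqMeasure

/-! ## Coefficients -/

/-- `n(γ) = ∑ μᵢ sᵢ dᵢ`. -/
def gmDegree {r : ℕ} (d s μ : Fin r → ℕ) : ℕ := ∑ i, μ i * s i * d i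

/-- The coefficients `e(k)` of `∏ (1 - x^{μᵢ sᵢ})^{dᵢ}`, extended by `0` to negative `k`. -/
def eCoeff {r : ℕ} (d s μ : Fin r → ℕ) (k : ℤ) : ℂ :=
  if 0 ≤ k then
    (∏ i, (1 - (Polynomial.X : Polynomial ℂ) ^ (μ i * s i)) ^ d i).coeff k.toNat
  else 0

/-- The coefficients `d_μ(k)` of the power series `∏ (∑_j x^{μᵢ sᵢ j})^{dᵢ}`. -/
def dCoeff {r : ℕ} (d s μ : Fin r → ℕ) (k : ℕ) : ℂ :=
  PowerSeries.coeff k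
    (∏ i, (PowerSeries.mk (fun n => if μ i * s i ∣ n then (1 : ℂ) else 0)) ^ d i)

/-- The vector coefficients `a_p(m) = a(m T + p)` if `m T + p ≤ M`, and `0` otherwise. -/
def blockCoeff (T M : ℕ) (a : ℕ → ℂ) (m : ℕ) (p : Fin T) : ℂ :=
  if m * T + (p : ℕ) ≤ M then a (m * T + (p : ℕ)) else 0

/-- `b(k) = ∑_{m=k}^N d_μ(m-k) a(m)`. -/
def bCoeff {T r : ℕ} (d s μ : Fin r → ℕ) (N : ℕ) (α : ℕ → Fin T → ℂ) (k : ℕ) (p : Fin T) : ℂ :=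
  ∑ m ∈ Finset.Icc k N, dCoeff d s μ (m - k) * α m p

/-- `v(k) = ∑_{l=0}^N e(l-k) b(l)`, `k = -1, …, -n(γ)`; the terms with `l > k + n(γ)` vanish. -/
def vCoeff {T r : ℕ} (d s μ : Fin r → ℕ) (N : ℕ) (α : ℕ → Fin T → ℂ) (k : ℤ) (p : Fin T) : ℂ :=
  ∑ l ∈ Finset.range (N + 1), eCoeff d s μ ((l : ℤ) - k) * bCoeff d s μ N α l p

/-- The functional `V_N ζ = ∑_{k=-n(γ)}^{-1} v(k)ᵀ ζ(k)` of the initial values. -/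
def initialPart {Ω : Type*} {T r : ℕ} (d s μ : Fin r → ℕ) (N : ℕ) (α : ℕ → Fin T → ℂ)
    (ζ : Fin T → ℤ → Ω → ℂ) : Ω → ℂ := fun ω =>
  ∑ k ∈ Finset.Icc (-(gmDegree d s μ : ℤ)) (-1), ∑ p, vCoeff d s μ N α k p * ζ p k ω

/-- Stacks `x(0), …, x(N)` into one vector and adds zeros up to `L` blocks. -/
def stack {T : ℕ} (N L : ℕ) (x : ℕ → Fin T → ℂ) : Fin L × Fin T → ℂ :=
  fun kp => if (kp.1 : ℕ) ≤ N then x kp.1 kp.2 else 0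

/-- The vectors `a_μ(m) = ∑_{l=0}^N e(l - m + n(γ)) a(l)`, `0 ≤ m ≤ N + n(γ)`. -/
def aShift {T r : ℕ} (d s μ : Fin r → ℕ) (N : ℕ) (α : ℕ → Fin T → ℂ) (m : ℕ) (p : Fin T) : ℂ :=
  ∑ l ∈ Finset.range (N + 1),
    eCoeff d s μ ((l : ℤ) - (m : ℤ) + (gmDegree d s μ : ℤ)) * α l p

/-- The step vector with its entries read as integers. -/
def intStep {r : ℕ} (μ : Fin r → ℕ) : Fin r → ℤ := fun i => (μ i : ℤ)

/-- The matrix `P_N` of size `(N + n(γ) + 1) T`. -/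
def matP {T r : ℕ} (d s μ : Fin r → ℕ) (f g : ℝ → Matrix (Fin T) (Fin T) ℂ) (N : ℕ) :
    Matrix (Fin (N + gmDegree d s μ + 1) × Fin T) (Fin (N + gmDegree d s μ + 1) × Fin T) ℂ :=
  fourierBlockMatrix _ (kernelP d s (intStep μ) f g)

/-- The matrix `T_N` of size `(N + n(γ) + 1) T`. -/
def matT {T r : ℕ} (d s μ : Fin r → ℕ) (f g : ℝ → Matrix (Fin T) (Fin T) ℂ) (N : ℕ) :
    Matrix (Fin (N + gmDegree d s μ + 1) × Fin T) (Fin (N + gmDegree d s μ + 1) × Fin T) ℂ :=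
  fourierBlockMatrix _ (kernelT d s (intStep μ) f g)

/-- The variant of `T_N` with `|χ_μ|²` in place of `χ_μ(e^{-iλ})`. -/
def matT' {T r : ℕ} (d s μ : Fin r → ℕ) (f g : ℝ → Matrix (Fin T) (Fin T) ℂ) (N : ℕ) :
    Matrix (Fin (N + gmDegree d s μ + 1) × Fin T) (Fin (N + gmDegree d s μ + 1) × Fin T) ℂ :=
  fourierBlockMatrix _ (kernelT' d s (intStep μ) f g)

/-- The matrix `Q_N` of size `(N + 1) T`. -/
def matQ {T r : ℕ} (d s : Fin r → ℕ) (f g : ℝ → Matrix (Fin T) (Fin T) ℂ) (N : ℕ) :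
    Matrix (Fin (N + 1) × Fin T) (Fin (N + 1) × Fin T) ℂ :=
  fourierBlockMatrix _ (kernelQ d s f g)

/-- The right-hand side `[D_N a]₊ - T_N [a]₊` of the system for the coefficients `c`. -/
def rhs {T r : ℕ} (d s μ : Fin r → ℕ) (f g : ℝ → Matrix (Fin T) (Fin T) ℂ) (N : ℕ)
    (α : ℕ → Fin T → ℂ) : Fin (N + gmDegree d s μ + 1) × Fin T → ℂ :=
  stack N _ (bCoeff d s μ N α) - matT d s μ f g N *ᵥ stack N _ α

/-- `c = P_N⁻¹ ([D_N a]₊ - T_N [a]₊)`. -/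
def cCoeff {T r : ℕ} (d s μ : Fin r → ℕ) (f g : ℝ → Matrix (Fin T) (Fin T) ℂ) (N : ℕ)
    (α : ℕ → Fin T → ℂ) : Fin (N + gmDegree d s μ + 1) × Fin T → ℂ :=
  (matP d s μ f g N)⁻¹ *ᵥ rhs d s μ f g N α

/-- `A_N(e^{iλ}) = ∑_{k=0}^N a(k) e^{ikλ}`; with `bCoeff` for `a` this is `B_N(e^{iλ})`. -/
def trigPoly {T : ℕ} (N : ℕ) (x : ℕ → Fin T → ℂ) (t : ℝ) : Fin T → ℂ :=
  fun p => ∑ k ∈ Finset.range (N + 1), x k p * expo k t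

/-- `C_N(e^{iλ}) = ∑_{k=0}^{N+n(γ)} c(k) e^{ikλ}`. -/
def cPoly {T r : ℕ} (d s μ : Fin r → ℕ) (f g : ℝ → Matrix (Fin T) (Fin T) ℂ) (N : ℕ)
    (α : ℕ → Fin T → ℂ) (t : ℝ) : Fin T → ℂ :=
  fun p => ∑ k : Fin (N + gmDegree d s μ + 1), cCoeff d s μ f g N α (k, p) * expo (k : ℕ) t

/-- The spectral characteristic
`hᵀ = Bᵀ χ_μ(e^{-iλ}) / β - Aᵀ g conj(β) (f + |β|² g)⁻¹
  - Cᵀ (conj(β) / χ_μ(e^{iλ})) (f + |β|² g)⁻¹`. -/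
def specChar {T r : ℕ} (d s μ : Fin r → ℕ) (f g : ℝ → Matrix (Fin T) (Fin T) ℂ) (N : ℕ)
    (α : ℕ → Fin T → ℂ) (t : ℝ) : Fin T → ℂ :=
  (chi d s (intStep μ) t / beta d s t) • trigPoly N (bCoeff d s μ N α) t
    - conj (beta d s t) • (trigPoly N α t ᵥ* (g t * (obsDensity d s f g t)⁻¹))
    - (conj (beta d s t) / conj (chi d s (intStep μ) t)) •
        (cPoly d s μ f g N α t ᵥ* (obsDensity d s f g t)⁻¹)

/-! ## Stochastic integrals and the spectral process -/

/-- `vᵀ W conj(v)`. -/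
def hermForm {T : ℕ} (W : Matrix (Fin T) (Fin T) ℂ) (v : Fin T → ℂ) : ℂ :=
  (v ᵥ* W) ⬝ᵥ star v

/-- The vector step function `∑ᵢ cᵢ 1_{[xᵢ, yᵢ)}`. -/
def stepFun {T n : ℕ} (x y : Fin n → ℝ) (c : Fin n → Fin T → ℂ) (t : ℝ) : Fin T → ℂ :=
  ∑ i, (Set.Ico (x i) (y i)).indicator (fun _ => c i) t

/-- The integral `∑ᵢ cᵢᵀ (Z(yᵢ) - Z(xᵢ))` of a step function. -/
def stepIntegral {Ω : Type*} {T n : ℕ} (Z : Fin T → ℝ → Ω → ℂ) (x y : Fin n → ℝ)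
    (c : Fin n → Fin T → ℂ) : Ω → ℂ := fun ω =>
  ∑ i, ∑ p, c i p * (Z p (y i) ω - Z p (x i) ω)

/-- `Y = ∫ h(λ)ᵀ dZ(λ)`, where `w` is the spectral density of `Z`: there are step functions
arbitrarily close to `h` in `L₂(w)` with integrals arbitrarily close to `Y` in mean square. -/
structure IsStochasticIntegral {Ω : Type*} [MeasurableSpace Ω] (P : Measure Ω) {T : ℕ}
    (w : ℝ → Matrix (Fin T) (Fin T) ℂ) (Z : Fin T → ℝ → Ω → ℂ) (h : ℝ → Fin T → ℂ)
    (Y : Ω → ℂ) : Prop where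
  aemeasurable : ∀ p, AEMeasurable (fun t => h t p) freqMeasure
  memLp : MemLp Y 2 P
  approx : ∀ ε : ENNReal, 0 < ε → ∃ (n : ℕ) (x y : Fin n → ℝ) (c : Fin n → Fin T → ℂ),
    (∀ i, -Real.pi ≤ x i ∧ x i ≤ y i ∧ y i < Real.pi) ∧
    ∫⁻ t, ENNReal.ofReal (hermForm (w t) (h t - stepFun x y c t)).re ∂freqMeasure < ε ∧
    ∫⁻ ω, ‖Y ω - stepIntegral Z x y c ω‖ₑ ^ 2 ∂P < ε

/-- `Z` is the spectral process of the GM increments of the vector sequence `ζ`: a process on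
`[-π, π)` with centred uncorrelated increments and spectral density `w`, such that
`χ_ν ζ_p(k) = ∫ e^{ikλ} (χ_ν(e^{-iλ}) / β(iλ)) dZ_p(λ)` for all steps `ν`. -/
structure IsSpectralProcess {Ω : Type*} [MeasurableSpace Ω] (P : Measure Ω) {T r : ℕ}
    (d s : Fin r → ℕ) (ζ : Fin T → ℤ → Ω → ℂ) (w : ℝ → Matrix (Fin T) (Fin T) ℂ)
    (Z : Fin T → ℝ → Ω → ℂ) : Prop where
  memLp : ∀ p, ∀ x ∈ Set.Ico (-Real.pi) Real.pi, MemLp (Z p x) 2 P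
  centred : ∀ p x y, -Real.pi ≤ x → x < y → y < Real.pi →
    ∫ ω, (Z p y ω - Z p x ω) ∂P = 0
  structural : ∀ p q x y, -Real.pi ≤ x → x < y → y < Real.pi →
    ∫ ω, (Z p y ω - Z p x ω) * conj (Z q y ω - Z q x ω) ∂P =
      ∫ t in Set.Ico x y, w t p q ∂freqMeasure
  uncorrelated : ∀ p q x y x' y', -Real.pi ≤ x → x < y → y ≤ x' → x' < y' → y' < Real.pi →
    ∫ ω, (Z p y ω - Z p x ω) * conj (Z q y' ω - Z q x' ω) ∂P = 0
  representation : ∀ ν, AdmissibleStep ν → ∀ p k,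
    IsStochasticIntegral P w Z
      (fun t => Pi.single p (expo k t * (chi d s ν t / beta d s t)))
      (gmIncrement d s ν (ζ p) k)

/-! ## Linear estimates -/

/-- The closed linear span in `L₂` of the increments `χ_μ ζ_p(k)`, `k ∈ K`, `p = 1, …, T`. -/
def incrementSpan {Ω : Type*} [MeasurableSpace Ω] (P : Measure Ω) {T r : ℕ}
    (d s μ : Fin r → ℕ) (ζ : Fin T → ℤ → Ω → ℂ) (K : Set ℤ) : Submodule ℂ (Lp ℂ 2 P) :=
  (Submodule.span ℂ {y : Lp ℂ 2 P | ∃ k ∈ K, ∃ p,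
    (y : Ω → ℂ) =ᵐ[P] gmIncrement d s (intStep μ) (ζ p) k}).topologicalClosure

/-- The space spanned by the observed increments: those with `k ≤ -1`, together with those with
`k ≥ N + n(γ) + 1`; they involve only the values of `ζ` on `ℤ ∖ {0, …, N}`. -/
def observedSpace {Ω : Type*} [MeasurableSpace Ω] (P : Measure Ω) {T r : ℕ}
    (d s μ : Fin r → ℕ) (ζ : Fin T → ℤ → Ω → ℂ) (N : ℕ) : Submodule ℂ (Lp ℂ 2 P) :=
  (incrementSpan P d s μ ζ (Set.Iic (-1)) ⊔
    incrementSpan P d s μ ζ (Set.Ici ((N : ℤ) + (gmDegree d s μ : ℤ) + 1))).topologicalClosure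

/-- The linear estimates of the functional with coefficients `α`: the random variables
`Y = y - V_N ζ` with `y` in the space spanned by the observed increments. -/
def IsLinearEstimate {Ω : Type*} [MeasurableSpace Ω] (P : Measure Ω) {T r : ℕ}
    (d s μ : Fin r → ℕ) (ζ : Fin T → ℤ → Ω → ℂ) (N : ℕ) (α : ℕ → Fin T → ℂ)
    (Y : Ω → ℂ) : Prop :=
  ∃ y ∈ observedSpace P d s μ ζ N, Y =ᵐ[P] fun ω => y ω - initialPart d s μ N α ζ ω

/-- `Y` is a linear estimate of `A` with the least mean square error. -/
def IsOptimalEstimate {Ω : Type*} [MeasurableSpace Ω] (P : Measure Ω) {T r : ℕ}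
    (d s μ : Fin r → ℕ) (ζ : Fin T → ℤ → Ω → ℂ) (N : ℕ) (α : ℕ → Fin T → ℂ)
    (A Y : Ω → ℂ) : Prop :=
  IsLinearEstimate P d s μ ζ N α Y ∧
    ∀ Y', IsLinearEstimate P d s μ ζ N α Y' →
      ∫⁻ ω, ‖A ω - Y ω‖ₑ ^ 2 ∂P ≤ ∫⁻ ω, ‖A ω - Y' ω‖ₑ ^ 2 ∂P

end GMInterp

end

/-!
The proof is a projection argument carried out in the frequency domain.

*Spectral isometry.* Let `w = f + |β|² g`.  The space `L₂(w)` of row vector functions is realised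
inside an ordinary `L₂` space by `h ↦ h S` with a measurable square root `S` of `w`
(`exists_isFactor`, `toWeighted`).  The increment `χ_ν ζ_p(k)` corresponds to the function
`e^{ikλ} (χ_ν / β) e_p`, which lies in `L₂(w)` because `χ_ν / β` is bounded
(`exists_norm_chi_div_beta_le`).  The increments and these functions have the same Gram matrix,
and the functions are total by uniqueness of Fourier coefficients, so the correspondence extends
to an isometry `V : L₂(w) → L₂(P)` (`exists_mapsToGMIncrements`).  The images of the functions
`1_{[-π, x)} e_p` form a spectral process.  Conversely, for any spectral process `Z` the
stochastic integral is such an isometry (`isStochasticIntegral_iff`,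
`exists_isometry_of_isSpectralProcess`), so everything below holds with `V h = ∫ hᵀ dZ`.

*Reduction to increments.*  Since `∑ d_μ(k) xᵏ` is the inverse of `∑ e(k) xᵏ`, the functional of
`ζ` equals `∑ b(k)ᵀ χ_μ ζ(k) - V_N ζ` (`sum_mul_eq_increments_sub_initial`).  Hence
`A_M ϑ + V_N ζ = ∑ b(k)ᵀ χ_μ ζ(k) - ∑ α(k)ᵀ η(k)`, where `α(k)` are the block coefficients, and an
optimal estimate amounts to the projection of the right-hand side on the closed span of the
observed increments.

*Dual family.*  The functions `e^{ikλ} (conj β / conj χ_μ) e_pᵀ w⁻¹` belong to `L₂(w)` precisely by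
the minimality condition, and they are biorthogonal to the functions of the increments of step `μ`
(`inner_specDual_specIncrement`).  Their Gram matrix over the missing times `0, …, N + n` is `P_N`,
which is therefore invertible.  Biorthogonality also shows that the orthogonal complement of the
observed increments inside the range of `V` is the span of the dual functions with these indices.

*Projection.*  The projection of `η_p(k)` on the range of `V` has the function
`e^{ikλ} conj β e_pᵀ g w⁻¹`, so the spectral characteristic is the function of the increments minus
that of the noise minus a combination of dual functions with coefficients `c`.  The equation
`P_N c = R` says exactly that it is orthogonal to the dual functions with indices `0, …, N + n`,
that is, that the estimate lies in the observed space (`map_specChar_mem_observedSpace`); the error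
is orthogonal to that space (`target_sub_mem_orthogonal`).

*Error.*  The error is the dual combination minus the part of `∑ α(k)ᵀ η(k)` orthogonal to the
range of `V`.  By Pythagoras its squared norm is `⟨P_N c, c⟩ + ⟨Q_N a, a⟩`, where `Q_N` appears
because `g - |β|² g w⁻¹ g = f w⁻¹ g` (`inner_target_sub_self`).  The integral form follows from a
pointwise identity whose cross terms cancel because `f w⁻¹ g = g w⁻¹ f`
(`hermForm_error_decomposition`).
-/

namespace GMInterp

/-! ### Increments and their coefficients -/

lemma expo_add (j k : ℤ) (t : ℝ) : expo (j + k) t = expo j t * expo k t := by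
  simp only [expo, ← Complex.exp_add]
  congr 1
  push_cast
  ring

@[simp] lemma expo_zero (t : ℝ) : expo 0 t = 1 := by simp [expo]

lemma conj_expo (k : ℤ) (t : ℝ) : conj (expo k t) = expo (-k) t := by
  simp only [expo, ← Complex.exp_conj]
  simp

lemma expo_mul_nat (k : ℤ) (l : ℕ) (t : ℝ) : expo (k * l) t = expo k t ^ l := by
  simp only [expo, ← Complex.exp_nat_mul]
  congr 1
  push_cast
  ring

lemma expo_sum {ι : Type*} (u : Finset ι) (k : ι → ℤ) (t : ℝ) :
    expo (∑ i ∈ u, k i) t = ∏ i ∈ u, expo (k i) t := by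
  classical
  induction u using Finset.induction_on with
  | empty => simp
  | insert i u hi ih => rw [Finset.sum_insert hi, Finset.prod_insert hi, expo_add, ih]

lemma norm_expo (k : ℤ) (t : ℝ) : ‖expo k t‖ = 1 := by
  have : Complex.I * (k : ℂ) * (t : ℂ) = ((k * t : ℝ) : ℂ) * Complex.I := by
    push_cast; ring
  rw [expo, this, Complex.norm_exp_ofReal_mul_I]

section Coefficients

variable {r : ℕ}

/-- The index set of the expansion of a GM increment. -/
abbrev gmIndex (d : Fin r → ℕ) : Finset (Fin r → ℕ) :=
  Fintype.piFinset (fun i => Finset.range (d i + 1))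

/-- The coefficient of `x (m - ∑ νᵢ sᵢ lᵢ)` in a GM increment. -/
noncomputable abbrev gmWeight (d l : Fin r → ℕ) : ℂ :=
  (-1 : ℂ) ^ (∑ i, l i) * (∏ i, ((d i).choose (l i) : ℂ))

lemma prod_one_sub_pow {R : Type*} [CommRing R] [Algebra ℂ R] (d : Fin r → ℕ) (x : Fin r → R) :
    ∏ i, (1 - x i) ^ d i =
      ∑ l ∈ gmIndex d, algebraMap ℂ R (gmWeight d l) * ∏ i, x i ^ l i := by
  have h : ∀ i, (1 - x i) ^ d i =
      ∑ l ∈ Finset.range (d i + 1), algebraMap ℂ R ((-1) ^ l * ((d i).choose l : ℂ)) * x i ^ l := by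
    intro i
    rw [sub_eq_neg_add, add_pow]
    refine Finset.sum_congr rfl fun l _ => ?_
    rw [neg_pow]
    simp
    ring
  simp only [h]
  rw [Finset.prod_univ_sum]
  refine Finset.sum_congr rfl fun l _ => ?_
  rw [Finset.prod_mul_distrib, ← map_prod, Finset.prod_mul_distrib, Finset.prod_pow_eq_pow_sum]

lemma chi_eq_sum (d s : Fin r → ℕ) (ν : Fin r → ℤ) (t : ℝ) :
    chi d s ν t = ∑ l ∈ gmIndex d, gmWeight d l * expo (-∑ i, ν i * (s i : ℤ) * (l i : ℤ)) t := by
  rw [chi, prod_one_sub_pow]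
  refine Finset.sum_congr rfl fun l _ => ?_
  rw [← Finset.sum_neg_distrib, expo_sum]
  simp only [Algebra.algebraMap_self, RingHom.id_apply]
  congr 1
  refine Finset.prod_congr rfl fun i _ => ?_
  rw [← expo_mul_nat, neg_mul]

lemma eCoeff_eq_sum (d s μ : Fin r → ℕ) (k : ℤ) :
    eCoeff d s μ k =
      ∑ l ∈ gmIndex d, gmWeight d l * if k = ((∑ i, μ i * s i * l i : ℕ) : ℤ) then 1 else 0 := by
  unfold eCoeff
  split_ifs with hk
  · lift k to ℕ using hk
    rw [prod_one_sub_pow, Polynomial.finsetSum_coeff]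
    refine Finset.sum_congr rfl fun l _ => ?_
    simp only [← pow_mul]
    rw [Finset.prod_pow_eq_pow_sum, Polynomial.algebraMap_apply, Polynomial.coeff_C_mul,
      Polynomial.coeff_X_pow]
    simp only [Algebra.algebraMap_self, RingHom.id_apply, Int.toNat_natCast, Nat.cast_inj]
  · refine (Finset.sum_eq_zero fun l _ => ?_).symm
    rw [if_neg, mul_zero]
    omega

lemma weight_le_gmDegree (d s μ : Fin r → ℕ) {l : Fin r → ℕ} (hl : l ∈ gmIndex d) :
    ∑ i, μ i * s i * l i ≤ gmDegree d s μ := by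
  refine Finset.sum_le_sum fun i _ => Nat.mul_le_mul_left _ ?_
  have := Fintype.mem_piFinset.1 hl i
  rw [Finset.mem_range] at this
  omega

/-- The coefficients `e` collect the terms of the multiple sum that defines an increment. -/
lemma sum_gmWeight_mul (d s μ : Fin r → ℕ) (y : ℤ → ℂ) :
    ∑ l ∈ gmIndex d, gmWeight d l * y (∑ i, intStep μ i * (s i : ℤ) * (l i : ℤ)) =
      ∑ j ∈ Finset.range (gmDegree d s μ + 1), eCoeff d s μ j * y j := by
  simp only [eCoeff_eq_sum, Finset.sum_mul]
  rw [Finset.sum_comm]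
  refine Finset.sum_congr rfl fun l hl => ?_
  rw [Finset.sum_eq_single_of_mem (∑ i, μ i * s i * l i)
    (Finset.mem_range.2 (Nat.lt_succ_of_le (weight_le_gmDegree d s μ hl)))]
  · rw [if_pos rfl, mul_one]
    congr 2
    push_cast
    rfl
  · intro j _ hj
    rw [if_neg (by exact_mod_cast hj)]
    simp

lemma eCoeff_eq_zero (d s μ : Fin r → ℕ) {k : ℤ} (hk : k < 0 ∨ (gmDegree d s μ : ℤ) < k) :
    eCoeff d s μ k = 0 := by
  rw [eCoeff_eq_sum]
  refine Finset.sum_eq_zero fun l hl => ?_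
  have := weight_le_gmDegree d s μ hl
  rw [if_neg (by omega), mul_zero]

/-- The polynomial `∏ (1 - x^{μᵢ sᵢ})^{dᵢ}` is palindromic up to the sign `(-1)^{∑ dᵢ}`. -/
lemma eCoeff_gmDegree_sub (d s μ : Fin r → ℕ) (k : ℤ) :
    eCoeff d s μ (gmDegree d s μ - k) = (-1) ^ (∑ i, d i) * eCoeff d s μ k := by
  rw [eCoeff_eq_sum, eCoeff_eq_sum, Finset.mul_sum]
  have hmem : ∀ l ∈ gmIndex d, ∀ i, l i ≤ d i := fun l hl i => by
    have := Fintype.mem_piFinset.1 hl i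
    rw [Finset.mem_range] at this
    omega
  refine Finset.sum_nbij' (fun l i => d i - l i) (fun l i => d i - l i) ?_ ?_ ?_ ?_ ?_
  · intro l _
    refine Fintype.mem_piFinset.2 fun i => Finset.mem_range.2 ?_
    omega
  · intro l _
    refine Fintype.mem_piFinset.2 fun i => Finset.mem_range.2 ?_
    omega
  · intro l hl
    funext i
    have := hmem l hl i
    simp only
    omega
  · intro l hl
    funext i
    have := hmem l hl i
    simp only
    omega
  · intro l hl
    have h1 : ∑ i, l i + ∑ i, (d i - l i) = ∑ i, d i := by
      rw [← Finset.sum_add_distrib]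
      exact Finset.sum_congr rfl fun i _ => Nat.add_sub_cancel' (hmem l hl i)
    have h2 : ∑ i, μ i * s i * l i + ∑ i, μ i * s i * (d i - l i) = gmDegree d s μ := by
      rw [← Finset.sum_add_distrib]
      refine Finset.sum_congr rfl fun i _ => ?_
      rw [← mul_add, Nat.add_sub_cancel' (hmem l hl i)]
    have h3 : ∏ i, ((d i).choose (d i - l i) : ℂ) = ∏ i, ((d i).choose (l i) : ℂ) :=
      Finset.prod_congr rfl fun i _ => by rw [Nat.choose_symm (hmem l hl i)]
    have h4 : (-1 : ℂ) ^ (∑ i, d i) * (-1) ^ (∑ i, (d i - l i)) = (-1) ^ (∑ i, l i) := by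
      rw [← h1, pow_add, mul_assoc, ← mul_pow]
      simp
    have h5 : ((gmDegree d s μ : ℤ) - k = ((∑ i, μ i * s i * l i : ℕ) : ℤ)) ↔
        (k = ((∑ i, μ i * s i * (d i - l i) : ℕ) : ℤ)) := by omega
    simp only [gmWeight]
    rw [h3, ← h4, if_congr h5 rfl rfl]
    ring

lemma chi_intStep (d s μ : Fin r → ℕ) (t : ℝ) :
    chi d s (intStep μ) t =
      ∑ j ∈ Finset.range (gmDegree d s μ + 1), eCoeff d s μ j * expo (-j) t := by
  rw [chi_eq_sum]
  exact sum_gmWeight_mul d s μ fun k => expo (-k) t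

lemma conj_eCoeff (d s μ : Fin r → ℕ) (k : ℤ) : conj (eCoeff d s μ k) = eCoeff d s μ k := by
  rw [eCoeff_eq_sum]
  simp [apply_ite]

lemma conj_chi_intStep (d s μ : Fin r → ℕ) (t : ℝ) :
    conj (chi d s (intStep μ) t) =
      ∑ j ∈ Finset.range (gmDegree d s μ + 1), eCoeff d s μ j * expo j t := by
  simp [chi_intStep, conj_eCoeff, conj_expo]

section Increment

variable {Ω : Type*}

lemma gmIncrement_eq_sum (d s : Fin r → ℕ) (ν : Fin r → ℤ) (x : ℤ → Ω → ℂ) (m : ℤ) :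
    gmIncrement d s ν x m = ∑ l ∈ gmIndex d,
      gmWeight d l • x (m - ∑ i, ν i * (s i : ℤ) * (l i : ℤ)) := by
  funext ω
  simp [gmIncrement]

lemma gmIncrement_add (d s : Fin r → ℕ) (ν : Fin r → ℤ) (x y : ℤ → Ω → ℂ) (m : ℤ) :
    gmIncrement d s ν (fun m ω => x m ω + y m ω) m =
      gmIncrement d s ν x m + gmIncrement d s ν y m := by
  funext ω
  simp [gmIncrement, mul_add, Finset.sum_add_distrib]

lemma gmIncrement_intStep (d s μ : Fin r → ℕ) (x : ℤ → Ω → ℂ) (m : ℤ) (ω : Ω) :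
    gmIncrement d s (intStep μ) x m ω =
      ∑ j ∈ Finset.range (gmDegree d s μ + 1), eCoeff d s μ j * x (m - j) ω :=
  sum_gmWeight_mul d s μ fun k => x (m - k) ω

lemma gmIncrement_block (T : ℕ) (d s : Fin r → ℕ) (ν : Fin r → ℤ) (x : ℤ → Ω → ℂ) (p : Fin T)
    (m : ℤ) :
    gmIncrement d s ν (block T x p) m =
      gmIncrement d (fun i => T * s i) ν x (m * T + ((p : ℕ) : ℤ)) := by
  funext ω
  simp only [gmIncrement, block]
  refine Finset.sum_congr rfl fun l _ => ?_
  congr 2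
  rw [sub_mul, Finset.sum_mul, sub_add_eq_add_sub]
  congr 1
  refine Finset.sum_congr rfl fun i _ => ?_
  push_cast
  ring

end Increment

/-! ### The functional in terms of increments -/

lemma one_sub_X_pow_mul_mk {c : ℕ} (hc : 0 < c) :
    (1 - (PowerSeries.X : PowerSeries ℂ) ^ c) *
      PowerSeries.mk (fun n => if c ∣ n then (1 : ℂ) else 0) = 1 := by
  ext n
  rw [sub_mul, one_mul, map_sub, PowerSeries.coeff_X_pow_mul', PowerSeries.coeff_mk,
    PowerSeries.coeff_mk, PowerSeries.coeff_one]
  by_cases hn : n = 0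
  · subst hn
    simp [hc.ne']
  · by_cases hcn : c ≤ n
    · have : c ∣ n - c ↔ c ∣ n := Nat.dvd_sub_iff_left hcn dvd_rfl
      simp [hcn, this, hn]
    · have : ¬ c ∣ n := fun h => hcn (Nat.le_of_dvd (Nat.pos_of_ne_zero hn) h)
      simp [hcn, this, hn]

/-- The coefficients `d_μ` are those of the inverse power series of `e`. -/
lemma sum_eCoeff_mul_dCoeff (d s μ : Fin r → ℕ) (hs : ∀ i, 0 < s i) (hμ : ∀ i, 0 < μ i)
    (n : ℕ) :
    ∑ k ∈ Finset.range (n + 1), eCoeff d s μ k * dCoeff d s μ (n - k) = if n = 0 then 1 else 0 := by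
  have h : ((∏ i, (1 - (Polynomial.X : Polynomial ℂ) ^ (μ i * s i)) ^ d i : Polynomial ℂ) :
      PowerSeries ℂ) *
      (∏ i, (PowerSeries.mk (fun n => if μ i * s i ∣ n then (1 : ℂ) else 0)) ^ d i) = 1 := by
    have : ((∏ i, (1 - (Polynomial.X : Polynomial ℂ) ^ (μ i * s i)) ^ d i : Polynomial ℂ) :
      PowerSeries ℂ) = ∏ i, (1 - (PowerSeries.X : PowerSeries ℂ) ^ (μ i * s i)) ^ d i := by
      rw [← Polynomial.coeToPowerSeries.ringHom_apply, map_prod]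
      simp
    rw [this, ← Finset.prod_mul_distrib]
    refine Finset.prod_eq_one fun i _ => ?_
    rw [← mul_pow, one_sub_X_pow_mul_mk (Nat.mul_pos (hμ i) (hs i)), one_pow]
  have h2 := congrArg (PowerSeries.coeff n) h
  rw [PowerSeries.coeff_mul, PowerSeries.coeff_one,
    Finset.Nat.sum_antidiagonal_eq_sum_range_succ_mk] at h2
  rw [← h2]
  refine Finset.sum_congr rfl fun k _ => ?_
  simp [eCoeff, dCoeff]

/-- The block coefficients are recovered from `b` by the coefficients `e`. -/
lemma sum_eCoeff_mul_bCoeff {T : ℕ} (d s μ : Fin r → ℕ) (hs : ∀ i, 0 < s i) (hμ : ∀ i, 0 < μ i)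
    (N : ℕ) (α : ℕ → Fin T → ℂ) (p : Fin T) {m : ℕ} (hm : m ≤ N) :
    ∑ k ∈ Finset.range (N + 1), eCoeff d s μ ((k : ℤ) - m) * bCoeff d s μ N α k p = α m p := by
  have h1 : ∀ k ∈ Finset.range (N + 1), eCoeff d s μ ((k : ℤ) - m) * bCoeff d s μ N α k p =
      ∑ l ∈ Finset.range (N + 1),
        if k ≤ l then eCoeff d s μ ((k : ℤ) - m) * dCoeff d s μ (l - k) * α l p else 0 := by
    intro k _
    rw [bCoeff, ← Finset.sum_filter, Finset.mul_sum]
    refine Finset.sum_congr ?_ fun l _ => by ring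
    ext l
    simp only [Finset.mem_Icc, Finset.mem_filter, Finset.mem_range]
    omega
  rw [Finset.sum_congr rfl h1, Finset.sum_comm]
  -- for fixed `l ≥ m` the inner sum over `k` is the convolution of `e` and `d_μ` at `l - m`
  have h2 : ∀ l ∈ Finset.range (N + 1), (∑ k ∈ Finset.range (N + 1),
      if k ≤ l then eCoeff d s μ ((k : ℤ) - m) * dCoeff d s μ (l - k) * α l p else 0) =
      (if l = m then 1 else 0) * α l p := by
    intro l hl
    rw [Finset.mem_range] at hl
    by_cases hlm : m ≤ l
    · have h3 := sum_eCoeff_mul_dCoeff d s μ hs hμ (l - m)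
      have h4 : (l - m = 0) ↔ l = m := by omega
      rw [← if_congr h4 rfl rfl, ← h3, Finset.sum_mul, ← Finset.sum_filter]
      symm
      refine Finset.sum_of_injOn (fun k => k + m) ?_ ?_ ?_ ?_
      · intro i _ j _ h
        simpa using h
      · intro k hk
        simp only [Finset.coe_range, Set.mem_Iio, Finset.coe_filter, Finset.mem_range,
          Set.mem_ofPred_eq] at hk ⊢
        omega
      · intro k hk1 hk2
        simp only [Finset.coe_range, Set.mem_image, Set.mem_Iio, not_exists, not_and,
          Finset.mem_filter, Finset.mem_range] at hk1 hk2
        rw [eCoeff_eq_zero, zero_mul, zero_mul]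
        by_contra hcon
        push Not at hcon
        exact hk2 (k - m) (by omega) (by omega)
      · intro k _
        rw [Nat.cast_add, add_sub_cancel_right, Nat.sub_add_eq, Nat.sub_right_comm]
    · rw [if_neg (by omega), zero_mul]
      refine Finset.sum_eq_zero fun k _ => ?_
      split_ifs with hk
      · rw [eCoeff_eq_zero d s μ (Or.inl (by omega))]
        simp
      · rfl
  rw [Finset.sum_congr rfl h2]
  simp [Nat.lt_succ_of_le hm]

/-- The functional `∑ α(m) y(m)` is `∑ b(k) χ_μ y(k)` minus a functional of the initial values. -/
lemma sum_mul_eq_increments_sub_initial {T : ℕ} (d s μ : Fin r → ℕ) (hs : ∀ i, 0 < s i)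
    (hμ : ∀ i, 0 < μ i) (N : ℕ) (α : ℕ → Fin T → ℂ) (p : Fin T) (y : ℤ → ℂ) :
    ∑ m ∈ Finset.range (N + 1), α m p * y m =
      ∑ k ∈ Finset.range (N + 1), bCoeff d s μ N α k p *
          ∑ j ∈ Finset.range (gmDegree d s μ + 1), eCoeff d s μ j * y (k - j) -
        ∑ k ∈ Finset.Icc (-(gmDegree d s μ : ℤ)) (-1), vCoeff d s μ N α k p * y k := by
  set n := gmDegree d s μ with hn
  have h1 : ∀ k ∈ Finset.range (N + 1), ∑ j ∈ Finset.range (n + 1), eCoeff d s μ j * y (k - j) =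
      ∑ m ∈ Finset.Icc (-(n : ℤ)) N, eCoeff d s μ (k - m) * y m := by
    intro k hk
    rw [Finset.mem_range] at hk
    refine Finset.sum_of_injOn (fun j => (k : ℤ) - j) ?_ ?_ ?_ ?_
    · intro i _ j _ h
      simp only at h
      omega
    · intro j hj
      simp only [Finset.coe_range, Set.mem_Iio] at hj
      simp only [Finset.coe_Icc, Set.mem_Icc]
      omega
    · intro m _ hm
      simp only [Finset.coe_range, Set.mem_image, Set.mem_Iio, not_exists, not_and] at hm
      rw [eCoeff_eq_zero, zero_mul]
      by_contra hcon
      push Not at hcon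
      exact hm (k - m).toNat (by omega) (by omega)
    · intro j _
      rw [sub_sub_cancel]
  have h1' : ∑ k ∈ Finset.range (N + 1), bCoeff d s μ N α k p *
      ∑ j ∈ Finset.range (n + 1), eCoeff d s μ j * y (k - j) =
      ∑ k ∈ Finset.range (N + 1), ∑ m ∈ Finset.Icc (-(n : ℤ)) N,
        bCoeff d s μ N α k p * (eCoeff d s μ (k - m) * y m) :=
    Finset.sum_congr rfl fun k hk => by rw [h1 k hk, Finset.mul_sum]
  rw [h1']
  rw [Finset.sum_comm]
  -- the negative times give the functional of the initial values, the others give `α`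
  have h2 : Finset.Icc (-(n : ℤ)) N = Finset.Icc (-(n : ℤ)) (-1) ∪ Finset.Icc (0 : ℤ) N := by
    ext m
    simp only [Finset.mem_union, Finset.mem_Icc]
    omega
  have h3 : Disjoint (Finset.Icc (-(n : ℤ)) (-1)) (Finset.Icc (0 : ℤ) N) := by
    rw [Finset.disjoint_left]
    intro m
    simp only [Finset.mem_Icc]
    omega
  rw [h2, Finset.sum_union h3]
  have h4 : ∑ k ∈ Finset.Icc (-(n : ℤ)) (-1), vCoeff d s μ N α k p * y k =
      ∑ m ∈ Finset.Icc (-(n : ℤ)) (-1), ∑ k ∈ Finset.range (N + 1),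
        bCoeff d s μ N α k p * (eCoeff d s μ (k - m) * y m) := by
    refine Finset.sum_congr rfl fun m _ => ?_
    rw [vCoeff, Finset.sum_mul]
    exact Finset.sum_congr rfl fun k _ => by ring
  rw [h4, add_sub_cancel_left]
  refine Finset.sum_nbij' (fun m => (m : ℤ)) Int.toNat ?_ ?_ ?_ ?_ ?_
  · intro m hm
    simp only [Finset.mem_range, Finset.mem_Icc] at hm ⊢
    omega
  · intro m hm
    simp only [Finset.mem_range, Finset.mem_Icc] at hm ⊢
    omega
  · intro m _
    simp
  · intro m hm
    simp only [Finset.mem_Icc] at hm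
    omega
  · intro m hm
    rw [Finset.mem_range] at hm
    rw [← sum_eCoeff_mul_bCoeff d s μ hs hμ N α p (Nat.le_of_lt_succ hm), Finset.sum_mul]
    exact Finset.sum_congr rfl fun k _ => by ring

lemma sum_range_eq_blocks {T : ℕ} (hT : 0 < T) (M : ℕ) (a : ℕ → ℂ) (y : ℤ → ℂ) :
    ∑ k ∈ Finset.range (M + 1), a k * y k =
      ∑ m ∈ Finset.range (M / T + 1), ∑ p : Fin T,
        blockCoeff T M a m p * y (m * T + ((p : ℕ) : ℤ)) := by
  have h : ∀ m : ℕ, ∑ p : Fin T, blockCoeff T M a m p * y (m * T + ((p : ℕ) : ℤ)) =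
      ∑ p ∈ Finset.range T,
        if m * T + p ≤ M then a (m * T + p) * y ((m * T + p : ℕ) : ℤ) else 0 := by
    intro m
    rw [Finset.sum_range]
    refine Finset.sum_congr rfl fun p _ => ?_
    simp only [blockCoeff, ite_mul, zero_mul]
    push_cast
    rfl
  simp only [h]
  rw [← Finset.sum_product', ← Finset.sum_filter]
  refine Finset.sum_nbij' (fun k => (k / T, k % T)) (fun x => x.1 * T + x.2) ?_ ?_ ?_ ?_ ?_
  · intro k hk
    simp only [Finset.mem_range] at hk
    simp only [Finset.mem_filter, Finset.mem_product, Finset.mem_range, Nat.div_add_mod']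
    exact ⟨⟨Nat.lt_succ_of_le (Nat.div_le_div_right (by omega)), Nat.mod_lt _ hT⟩, by omega⟩
  · intro x hx
    simp only [Finset.mem_filter] at hx
    simp only [Finset.mem_range]
    omega
  · intro k _
    exact Nat.div_add_mod' k T
  · rintro ⟨m, p⟩ hx
    simp only [Finset.mem_filter, Finset.mem_product, Finset.mem_range] at hx
    simp only [Prod.mk.injEq]
    constructor
    · rw [mul_comm, Nat.mul_add_div hT, Nat.div_eq_of_lt hx.1.2, add_zero]
    · rw [mul_comm, Nat.mul_add_mod, Nat.mod_eq_of_lt hx.1.2]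
  · intro k _
    simp only [Nat.div_add_mod']

/-- Multiplication of `A_N` by `χ_μ(e^{iλ})` shifts its coefficients to `(-1)^{∑ dᵢ} a_μ`. -/
lemma conj_chi_mul_trigPoly {T : ℕ} (d s μ : Fin r → ℕ) (N : ℕ) (α : ℕ → Fin T → ℂ) (t : ℝ)
    (p : Fin T) :
    conj (chi d s (intStep μ) t) * trigPoly N α t p =
      (-1) ^ (∑ i, d i) * trigPoly (N + gmDegree d s μ) (aShift d s μ N α) t p := by
  set n := gmDegree d s μ with hn
  rw [conj_chi_intStep, trigPoly, trigPoly, ← hn, Finset.mul_sum, Finset.mul_sum]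
  have h1 : ∀ l ∈ Finset.range (N + 1),
      (∑ j ∈ Finset.range (n + 1), eCoeff d s μ j * expo j t) * (α l p * expo l t) =
      ∑ m ∈ Finset.range (N + n + 1), eCoeff d s μ ((m : ℤ) - l) * α l p * expo m t := by
    intro l hl
    rw [Finset.mem_range] at hl
    rw [Finset.sum_mul]
    refine Finset.sum_of_injOn (fun j => l + j) ?_ ?_ ?_ ?_
    · intro i _ j _ h
      simpa using h
    · intro j hj
      simp only [Finset.coe_range, Set.mem_Iio] at hj ⊢
      omega
    · intro m _ hm
      simp only [Finset.coe_range, Set.mem_image, Set.mem_Iio, not_exists, not_and] at hm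
      rw [eCoeff_eq_zero, zero_mul, zero_mul]
      by_contra hcon
      push Not at hcon
      exact hm (m - l) (by omega) (by omega)
    · intro j _
      push_cast
      rw [add_sub_cancel_left, expo_add]
      ring
  rw [Finset.sum_congr rfl h1, Finset.sum_comm]
  refine Finset.sum_congr rfl fun m _ => ?_
  rw [aShift, Finset.sum_mul, Finset.mul_sum]
  refine Finset.sum_congr rfl fun l _ => ?_
  have h2 : (l : ℤ) - m + n = gmDegree d s μ - ((m : ℤ) - l) := by rw [← hn]; ring
  rw [← hn, h2, eCoeff_gmDegree_sub, ← mul_assoc, ← mul_assoc, ← mul_assoc, ← mul_pow]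
  simp

end Coefficients

/-! ### Matrix identities -/

section Matrix

variable {T : ℕ}

lemma hermForm_eq (W : Matrix (Fin T) (Fin T) ℂ) (v : Fin T → ℂ) :
    hermForm W v = v ⬝ᵥ (W *ᵥ star v) := by
  rw [hermForm, Matrix.dotProduct_mulVec]

lemma hermForm_nonneg {W : Matrix (Fin T) (Fin T) ℂ} (hW : W.PosSemidef) (v : Fin T → ℂ) :
    0 ≤ hermForm W v := by
  have := (Matrix.posSemidef_iff_dotProduct_mulVec.1 hW).2 (star v)
  rwa [star_star, ← hermForm_eq] at this

lemma ofReal_re_hermForm {W : Matrix (Fin T) (Fin T) ℂ} (hW : W.PosSemidef) (v : Fin T → ℂ) :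
    ((hermForm W v).re : ℂ) = hermForm W v :=
  (Complex.eq_re_of_ofReal_le (r := 0) (by simpa using hermForm_nonneg hW v)).symm

lemma hermForm_smul (W : Matrix (Fin T) (Fin T) ℂ) (c : ℂ) (v : Fin T → ℂ) :
    hermForm W (c • v) = (‖c‖ ^ 2 : ℝ) * hermForm W v := by
  rw [hermForm, hermForm, Matrix.smul_vecMul, star_smul, smul_dotProduct, dotProduct_smul,
    smul_eq_mul, smul_eq_mul, ← mul_assoc]
  congr 1
  rw [Complex.star_def, Complex.mul_conj, Complex.normSq_eq_norm_sq]

lemma hermForm_single (W : Matrix (Fin T) (Fin T) ℂ) (p : Fin T) :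
    hermForm W (Pi.single p 1) = W p p := by
  have : star (Pi.single p (1 : ℂ) : Fin T → ℂ) = Pi.single p 1 := by
    rw [← Pi.single_star, star_one]
  rw [hermForm, this]
  simp

lemma hermForm_vecMul {G : Matrix (Fin T) (Fin T) ℂ} (hG : G.IsHermitian)
    (X : Matrix (Fin T) (Fin T) ℂ) (v : Fin T → ℂ) :
    hermForm X (v ᵥ* G) = hermForm (G * X * G) v := by
  rw [hermForm_eq, hermForm_eq, Matrix.star_vecMul, hG.eq, Matrix.mulVec_mulVec,
    ← Matrix.dotProduct_mulVec, Matrix.mulVec_mulVec, Matrix.mul_assoc]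

lemma hermForm_add_matrix (X Y : Matrix (Fin T) (Fin T) ℂ) (v : Fin T → ℂ) :
    hermForm (X + Y) v = hermForm X v + hermForm Y v := by
  rw [hermForm, hermForm, hermForm, Matrix.vecMul_add, add_dotProduct]

lemma hermForm_smul_matrix (c : ℂ) (X : Matrix (Fin T) (Fin T) ℂ) (v : Fin T → ℂ) :
    hermForm (c • X) v = c * hermForm X v := by
  rw [hermForm, hermForm, Matrix.vecMul_smul, smul_dotProduct, smul_eq_mul]

lemma hermForm_sub_matrix (X Y : Matrix (Fin T) (Fin T) ℂ) (v : Fin T → ℂ) :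
    hermForm (X - Y) v = hermForm X v - hermForm Y v := by
  rw [hermForm, hermForm, hermForm, Matrix.vecMul_sub, sub_dotProduct]

lemma hermForm_add (X : Matrix (Fin T) (Fin T) ℂ) (u v : Fin T → ℂ) :
    hermForm X (u + v) =
      hermForm X u + u ⬝ᵥ (X *ᵥ star v) + v ⬝ᵥ (X *ᵥ star u) + hermForm X v := by
  simp only [hermForm_eq, star_add, Matrix.mulVec_add, add_dotProduct, dotProduct_add]
  ring

lemma re_diag_nonneg {W : Matrix (Fin T) (Fin T) ℂ} (hW : W.PosSemidef) (p : Fin T) :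
    0 ≤ (W p p).re := by
  have := hermForm_nonneg hW (Pi.single p 1)
  rw [hermForm_single] at this
  exact (Complex.le_def.1 this).1

lemma re_diag_le_re_trace {W : Matrix (Fin T) (Fin T) ℂ} (hW : W.PosSemidef) (p : Fin T) :
    (W p p).re ≤ W.trace.re := by
  rw [Matrix.trace, Complex.re_sum]
  exact Finset.single_le_sum (f := fun q => (W q q).re) (fun q _ => re_diag_nonneg hW q)
    (Finset.mem_univ p)

variable {F G : Matrix (Fin T) (Fin T) ℂ} {b : ℝ}

lemma posSemidef_obs (hF : F.PosSemidef) (hG : G.PosSemidef) (hb : 0 ≤ b) :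
    (F + (b : ℂ) • G).PosSemidef :=
  hF.add (hG.smul (by exact_mod_cast hb))

/-- `f w⁻¹ g = g - |β|² g w⁻¹ g`. -/
lemma mul_inv_mul_eq_sub (hW : IsUnit (F + (b : ℂ) • G).det) :
    F * (F + (b : ℂ) • G)⁻¹ * G = G - (b : ℂ) • (G * (F + (b : ℂ) • G)⁻¹ * G) := by
  set W := F + (b : ℂ) • G with hWdef
  have hF : F = W - (b : ℂ) • G := by rw [hWdef, add_sub_cancel_right]
  conv_lhs => rw [hF]
  rw [sub_mul, sub_mul, Matrix.mul_nonsing_inv _ hW, one_mul, smul_mul_assoc, smul_mul_assoc]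

lemma mul_inv_mul_comm (hW : IsUnit (F + (b : ℂ) • G).det) :
    F * (F + (b : ℂ) • G)⁻¹ * G = G * (F + (b : ℂ) • G)⁻¹ * F := by
  rw [mul_inv_mul_eq_sub hW]
  set W := F + (b : ℂ) • G with hWdef
  have hF : F = W - (b : ℂ) • G := by rw [hWdef, add_sub_cancel_right]
  conv_rhs => rw [hF]
  rw [mul_sub, mul_assoc G W⁻¹ W, Matrix.nonsing_inv_mul _ hW, mul_one, mul_smul_comm]

/-- With `w = f + |β|² g`, this is
`f w⁻¹ g = f (w⁻¹ g w⁻¹) f + |β|² g (w⁻¹ f w⁻¹) g`, a sum of nonnegative definite matrices. -/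
lemma mul_inv_mul_eq_add (hW : IsUnit (F + (b : ℂ) • G).det) :
    F * (F + (b : ℂ) • G)⁻¹ * G =
      F * ((F + (b : ℂ) • G)⁻¹ * G * (F + (b : ℂ) • G)⁻¹) * F +
        (b : ℂ) • (G * ((F + (b : ℂ) • G)⁻¹ * F * (F + (b : ℂ) • G)⁻¹) * G) := by
  have hcomm := mul_inv_mul_comm hW
  set W := F + (b : ℂ) • G with hWdef
  have h1 : F * (W⁻¹ * G * W⁻¹) * F = F * W⁻¹ * G * W⁻¹ * F := by simp only [mul_assoc]
  have h2 : G * (W⁻¹ * F * W⁻¹) * G = F * W⁻¹ * G * W⁻¹ * G := by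
    rw [hcomm]
    simp only [mul_assoc]
  rw [h1, h2, ← mul_smul_comm, ← mul_add, ← hWdef, mul_assoc _ W⁻¹ W,
    Matrix.nonsing_inv_mul _ hW, mul_one]

lemma inv_mul_add_inv_mul (hW : IsUnit (F + (b : ℂ) • G).det) :
    (F + (b : ℂ) • G)⁻¹ * F * (F + (b : ℂ) • G)⁻¹ +
      (b : ℂ) • ((F + (b : ℂ) • G)⁻¹ * G * (F + (b : ℂ) • G)⁻¹) = (F + (b : ℂ) • G)⁻¹ := by
  set W := F + (b : ℂ) • G with hWdef
  rw [← smul_mul_assoc, ← mul_smul_comm, ← add_mul, ← mul_add, ← hWdef,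
    Matrix.nonsing_inv_mul _ hW, one_mul]

lemma posSemidef_mul_inv_mul (hF : F.PosSemidef) (hG : G.PosSemidef) (hb : 0 ≤ b)
    (hW : IsUnit (F + (b : ℂ) • G).det) : (F * (F + (b : ℂ) • G)⁻¹ * G).PosSemidef := by
  have hWi : ((F + (b : ℂ) • G)⁻¹).IsHermitian := (posSemidef_obs hF hG hb).isHermitian.inv
  rw [mul_inv_mul_eq_add hW]
  have key : ∀ {A B : Matrix (Fin T) (Fin T) ℂ}, A.PosSemidef → B.IsHermitian →
      (B * A * B).PosSemidef := fun {A B} hA hB => by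
    have := hA.mul_mul_conjTranspose_same B
    rwa [hB.eq] at this
  exact (key (key hG hWi) hF.isHermitian).add
    ((key (key hF hWi) hG.isHermitian).smul (by exact_mod_cast hb))

/-- The integrands of the two forms of the mean square error agree: the cross terms cancel
because `f w⁻¹ g = g w⁻¹ f`. -/
lemma hermForm_error_decomposition (hF : F.PosSemidef) (hG : G.PosSemidef)
    (hW : IsUnit (F + (b : ℂ) • G).det) {c : ℂ} (hc : c ≠ 0) (x y : Fin T → ℂ) :
    ((b / ‖c‖ ^ 2 : ℝ) : ℂ) *
        hermForm ((F + (b : ℂ) • G)⁻¹ * F * (F + (b : ℂ) • G)⁻¹) (conj c • (x ᵥ* G) + y) +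
      ((1 / ‖c‖ ^ 2 : ℝ) : ℂ) *
        hermForm ((F + (b : ℂ) • G)⁻¹ * G * (F + (b : ℂ) • G)⁻¹)
          (conj c • (x ᵥ* F) - (b : ℂ) • y) =
      hermForm (F * (F + (b : ℂ) • G)⁻¹ * G) x +
        ((b / ‖c‖ ^ 2 : ℝ) : ℂ) * hermForm (F + (b : ℂ) • G)⁻¹ y := by
  have hcomm := mul_inv_mul_comm hW
  have hadd := mul_inv_mul_eq_add hW
  have hinv := inv_mul_add_inv_mul hW
  set V := (F + (b : ℂ) • G)⁻¹ with hV
  have hc2 : ((‖c‖ ^ 2 : ℝ) : ℂ) ≠ 0 := by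
    simpa using hc
  have h1 : hermForm (F * V * G) x = hermForm (V * G * V) (x ᵥ* F) +
      b * hermForm (V * F * V) (x ᵥ* G) := by
    rw [hermForm_vecMul hF.isHermitian, hermForm_vecMul hG.isHermitian, ← hermForm_smul_matrix,
      ← hermForm_add_matrix, ← hadd]
  have h2 : hermForm V y = hermForm (V * F * V) y + b * hermForm (V * G * V) y := by
    rw [← hermForm_smul_matrix, ← hermForm_add_matrix, hinv]
  have h3 : (x ᵥ* G) ⬝ᵥ ((V * F * V) *ᵥ star y) = (x ᵥ* F) ⬝ᵥ ((V * G * V) *ᵥ star y) := by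
    rw [← Matrix.dotProduct_mulVec, ← Matrix.dotProduct_mulVec, Matrix.mulVec_mulVec,
      Matrix.mulVec_mulVec]
    have : G * (V * F * V) = F * (V * G * V) := by
      rw [← mul_assoc, ← mul_assoc, ← mul_assoc, ← mul_assoc, hcomm]
    rw [this]
  have h4 : y ⬝ᵥ ((V * F * V) *ᵥ star (x ᵥ* G)) = y ⬝ᵥ ((V * G * V) *ᵥ star (x ᵥ* F)) := by
    rw [Matrix.star_vecMul, Matrix.star_vecMul, hF.isHermitian.eq, hG.isHermitian.eq,
      Matrix.mulVec_mulVec, Matrix.mulVec_mulVec]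
    have : (V * F * V) * G = (V * G * V) * F := by
      simp only [mul_assoc]
      simp only [mul_assoc] at hcomm
      rw [hcomm]
    rw [this]
  have hneg : conj c • (x ᵥ* F) - (b : ℂ) • y = conj c • (x ᵥ* F) + (-(b : ℂ)) • y := by
    rw [neg_smul, sub_eq_add_neg]
  rw [hneg, hermForm_add, hermForm_add, hermForm_smul, hermForm_smul, hermForm_smul, h1, h2]
  simp only [star_smul, Matrix.mulVec_smul, smul_dotProduct, dotProduct_smul, smul_eq_mul, h3, h4]
  simp only [Complex.star_def, map_neg, Complex.conj_conj, Complex.conj_ofReal, norm_neg,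
    RCLike.norm_conj, Complex.norm_real, Real.norm_eq_abs, sq_abs]
  have e1 : ((b / ‖c‖ ^ 2 : ℝ) : ℂ) = (b : ℂ) / ((‖c‖ ^ 2 : ℝ) : ℂ) := by push_cast; rfl
  have e2 : ((1 / ‖c‖ ^ 2 : ℝ) : ℂ) = 1 / ((‖c‖ ^ 2 : ℝ) : ℂ) := by push_cast; rfl
  have e3 : ((b ^ 2 : ℝ) : ℂ) = (b : ℂ) ^ 2 := by push_cast; rfl
  rw [e1, e2, e3]
  generalize ((‖c‖ ^ 2 : ℝ) : ℂ) = n at hc2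
  field_simp
  ring

end Matrix

/-! ### The frequency domain -/

instance : IsFiniteMeasure freqMeasure := by
  unfold freqMeasure
  refine ⟨?_⟩
  rw [Measure.smul_apply, smul_eq_mul]
  refine ENNReal.mul_lt_top ?_ (measure_lt_top _ _)
  rw [ENNReal.inv_lt_top, ENNReal.ofReal_pos]
  positivity

lemma freqMeasure_absolutelyContinuous :
    freqMeasure ≪ volume.restrict (Set.Ico (-Real.pi) Real.pi) :=
  Measure.smul_absolutelyContinuous

lemma ae_mem_Ico : ∀ᵐ t ∂freqMeasure, t ∈ Set.Ico (-Real.pi) Real.pi :=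
  freqMeasure_absolutelyContinuous.ae_le (ae_restrict_mem measurableSet_Ico)

lemma freqMeasure_countable {s : Set ℝ} (hs : s.Countable) : freqMeasure s = 0 :=
  freqMeasure_absolutelyContinuous (hs.measure_zero _)

lemma integral_freqMeasure_one : ∫ _, (1 : ℂ) ∂freqMeasure = 1 := by
  have h : freqMeasure Set.univ = 1 := by
    rw [freqMeasure, Measure.smul_apply, Measure.restrict_apply_univ, Real.volume_Ico, smul_eq_mul,
      sub_neg_eq_add, ← two_mul]
    refine ENNReal.inv_mul_cancel ?_ ENNReal.ofReal_ne_top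
    rw [Ne, ENNReal.ofReal_eq_zero, not_le]
    positivity
  rw [integral_const, measureReal_def, h]
  simp

lemma continuous_expo (k : ℤ) : Continuous (expo k) := by
  unfold expo
  fun_prop

lemma continuous_chi {r : ℕ} (d s : Fin r → ℕ) (ν : Fin r → ℤ) : Continuous (chi d s ν) := by
  unfold chi
  have := continuous_expo
  fun_prop

lemma continuous_beta {r : ℕ} (d s : Fin r → ℕ) : Continuous (beta d s) := by
  unfold beta
  fun_prop

lemma expo_eq_one_iff (k : ℤ) (t : ℝ) :
    expo k t = 1 ↔ ∃ n : ℤ, (k : ℝ) * t = n * (2 * Real.pi) := by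
  rw [expo, Complex.exp_eq_one_iff]
  refine exists_congr fun n => ?_
  have h1 : Complex.I * (k : ℂ) * (t : ℂ) = ((k * t : ℝ) : ℂ) * Complex.I := by push_cast; ring
  have h2 : (n : ℂ) * (2 * Real.pi * Complex.I) = ((n * (2 * Real.pi) : ℝ) : ℂ) * Complex.I := by
    push_cast; ring
  rw [h1, h2, mul_left_inj' Complex.I_ne_zero, Complex.ofReal_inj]

lemma ae_chi_ne_zero {r : ℕ} (d s : Fin r → ℕ) (ν : Fin r → ℤ) (hs : ∀ i, 0 < s i)
    (hν : ∀ i, ν i ≠ 0) : ∀ᵐ t ∂freqMeasure, chi d s ν t ≠ 0 := by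
  refine measure_mono_null (t := ⋃ j, ⋃ n : ℤ, {(n * (2 * Real.pi)) / (-(ν j * (s j : ℤ)) : ℤ)}) ?_
    (freqMeasure_countable (Set.countable_iUnion fun j => Set.countable_iUnion fun n =>
      Set.countable_singleton _))
  intro t ht
  simp only [Set.mem_compl_iff, Set.mem_ofPred_eq, not_not] at ht
  rw [chi, Finset.prod_eq_zero_iff] at ht
  obtain ⟨j, _, hj⟩ := ht
  have hj := (sub_eq_zero.1 (eq_zero_of_pow_eq_zero hj)).symm
  rw [expo_eq_one_iff] at hj
  obtain ⟨n, hn⟩ := hj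
  simp only [Set.mem_iUnion, Set.mem_singleton_iff]
  refine ⟨j, n, ?_⟩
  rw [← hn, mul_div_cancel_left₀]
  have := hν j
  have := (hs j).ne'
  exact_mod_cast neg_ne_zero.2 (mul_ne_zero (hν j) (Int.natCast_ne_zero.2 this))

lemma norm_beta_factor (k : ℤ) (s : ℕ) (t : ℝ) :
    ‖Complex.I * (t : ℂ) - 2 * (Real.pi : ℂ) * Complex.I * (k : ℂ) / (s : ℂ)‖ =
      |t - 2 * Real.pi * k / s| := by
  have : Complex.I * (t : ℂ) - 2 * (Real.pi : ℂ) * Complex.I * (k : ℂ) / (s : ℂ) =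
      Complex.I * ((t - 2 * Real.pi * k / s : ℝ) : ℂ) := by
    push_cast; ring
  rw [this, norm_mul, Complex.norm_I, one_mul, Complex.norm_real, Real.norm_eq_abs]

lemma ae_beta_ne_zero {r : ℕ} (d s : Fin r → ℕ) : ∀ᵐ t ∂freqMeasure, beta d s t ≠ 0 := by
  refine measure_mono_null (t := ⋃ j, ⋃ n : ℤ, {2 * Real.pi * n / (s j : ℝ)}) ?_
    (freqMeasure_countable (Set.countable_iUnion fun j => Set.countable_iUnion fun n =>
      Set.countable_singleton _))
  intro t ht
  simp only [Set.mem_compl_iff, Set.mem_ofPred_eq, not_not] at ht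
  rw [beta, Finset.prod_eq_zero_iff] at ht
  obtain ⟨j, _, hj⟩ := ht
  obtain ⟨k, _, hk⟩ := Finset.prod_eq_zero_iff.1 hj
  have hk := norm_eq_zero.2 (eq_zero_of_pow_eq_zero hk)
  rw [norm_beta_factor, abs_eq_zero, sub_eq_zero] at hk
  simp only [Set.mem_iUnion, Set.mem_singleton_iff]
  exact ⟨j, k, hk⟩

lemma norm_one_sub_expo_le (s : ℕ) (hs : 0 < s) (ν k : ℤ) (t : ℝ) :
    ‖1 - expo (-(ν * (s : ℤ))) t‖ ≤ |(ν : ℝ)| * s * |t - 2 * Real.pi * k / s| := by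
  have hs' : (s : ℝ) ≠ 0 := by positivity
  have h : expo (-(ν * (s : ℤ))) t =
      Complex.exp (Complex.I * ((-(ν * s) * (t - 2 * Real.pi * k / s) : ℝ) : ℂ)) := by
    rw [expo, Complex.exp_eq_exp_iff_exists_int]
    refine ⟨-(ν * k), ?_⟩
    have hs'' : (s : ℂ) ≠ 0 := by exact_mod_cast hs.ne'
    push_cast
    field_simp
    ring
  rw [h, norm_sub_rev]
  refine (Real.norm_exp_I_mul_ofReal_sub_one_le).trans ?_
  rw [Real.norm_eq_abs, abs_mul, abs_neg, abs_mul, Nat.abs_cast]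

/-- A root of `∏ (iλ - 2πik/s)` is a root of `1 - e^{-iλνs}`, and at most one of the roots lies
within `π/s` of a given point, so the quotient of the two functions is bounded. -/
lemma exists_norm_one_sub_expo_div_le (s : ℕ) (hs : 0 < s) (ν : ℤ) (I : Finset ℤ) :
    ∃ C : ℝ, ∀ t : ℝ, ‖(1 - expo (-(ν * (s : ℤ))) t) / ∏ k ∈ I,
      (Complex.I * (t : ℂ) - 2 * (Real.pi : ℂ) * Complex.I * (k : ℂ) / (s : ℂ))‖ ≤ C := by
  have hs' : (0 : ℝ) < s := by positivity
  set δ : ℝ := Real.pi / s with hδ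
  have hδ0 : 0 < δ := by positivity
  refine ⟨2 / δ ^ I.card + |(ν : ℝ)| * s / δ ^ (I.card - 1), fun t => ?_⟩
  rw [norm_div, norm_prod]
  simp only [norm_beta_factor]
  have hA : 0 ≤ 2 / δ ^ I.card := by positivity
  have hB : 0 ≤ |(ν : ℝ)| * s / δ ^ (I.card - 1) := by positivity
  by_cases h : ∃ k ∈ I, |t - 2 * Real.pi * k / s| < δ
  · obtain ⟨k, hk, hkt⟩ := h
    have hfar : ∀ j ∈ I.erase k, δ ≤ |t - 2 * Real.pi * j / s| := by
      intro j hj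
      have hjk : j - k ≠ 0 := sub_ne_zero.2 (Finset.ne_of_mem_erase hj)
      have h1 : (1 : ℝ) ≤ |((j - k : ℤ) : ℝ)| := by
        exact_mod_cast Int.one_le_abs hjk
      have h2 : (t - 2 * Real.pi * k / s) - (t - 2 * Real.pi * j / s) =
          2 * δ * ((j - k : ℤ) : ℝ) := by
        rw [hδ]
        push_cast
        field_simp
        ring
      have h3 : 2 * δ ≤ |(t - 2 * Real.pi * k / s) - (t - 2 * Real.pi * j / s)| := by
        rw [h2, abs_mul, abs_of_pos (by positivity : 0 < 2 * δ)]
        nlinarith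
      have h4 := abs_sub (t - 2 * Real.pi * k / s) (t - 2 * Real.pi * j / s)
      linarith
    rw [← Finset.mul_prod_erase I _ hk]
    have hprod : δ ^ (I.card - 1) ≤ ∏ j ∈ I.erase k, |t - 2 * Real.pi * j / s| := by
      rw [← Finset.card_erase_of_mem hk, ← Finset.prod_const]
      exact Finset.prod_le_prod (fun _ _ => hδ0.le) hfar
    rcases eq_or_ne (t - 2 * Real.pi * k / s) 0 with h0 | h0
    · rw [h0, abs_zero, zero_mul, div_zero]
      positivity
    · have h0' : 0 < |t - 2 * Real.pi * k / s| := abs_pos.2 h0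
      have hp : 0 < δ ^ (I.card - 1) := by positivity
      calc _ ≤ (|(ν : ℝ)| * s * |t - 2 * Real.pi * k / s|) /
            (|t - 2 * Real.pi * k / s| * δ ^ (I.card - 1)) := by
            gcongr
            exact norm_one_sub_expo_le s hs ν k t
        _ = |(ν : ℝ)| * s / δ ^ (I.card - 1) := by
            rw [mul_comm (|(ν : ℝ)| * s), mul_div_mul_left _ _ h0'.ne']
        _ ≤ _ := by linarith
  · push Not at h
    have hprod : δ ^ I.card ≤ ∏ j ∈ I, |t - 2 * Real.pi * j / s| := by
      rw [← Finset.prod_const]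
      exact Finset.prod_le_prod (fun _ _ => hδ0.le) h
    have h2 : ‖1 - expo (-(ν * (s : ℤ))) t‖ ≤ 2 := by
      refine (norm_sub_le _ _).trans ?_
      rw [norm_expo, norm_one]
      norm_num
    calc _ ≤ 2 / δ ^ I.card := by gcongr
      _ ≤ _ := by linarith

/-- The quotient `χ_ν(e^{-iλ}) / β(λ)` is bounded, also for steps `ν` of negative sign. -/
lemma exists_norm_chi_div_beta_le {r : ℕ} (d s : Fin r → ℕ) (hs : ∀ i, 0 < s i) (ν : Fin r → ℤ) :
    ∃ C : ℝ, ∀ t, ‖chi d s ν t / beta d s t‖ ≤ C := by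
  choose C hC using fun j => exists_norm_one_sub_expo_div_le (s j) (hs j) (ν j)
    (Finset.Icc (-((s j / 2 : ℕ) : ℤ)) ((s j / 2 : ℕ) : ℤ))
  refine ⟨∏ j, C j ^ d j, fun t => ?_⟩
  rw [chi, beta, ← Finset.prod_div_distrib, norm_prod]
  refine Finset.prod_le_prod (fun _ _ => norm_nonneg _) fun j _ => ?_
  rw [Finset.prod_pow, ← div_pow, norm_pow]
  exact pow_le_pow_left₀ (norm_nonneg _) (hC j t) _

/-! ### Uniqueness of integrable functions -/

/-- An integrable function all of whose Fourier coefficients vanish is zero. -/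
lemma ae_eq_zero_of_fourier {F : ℝ → ℂ} (hF : Integrable F freqMeasure)
    (h : ∀ k : ℤ, ∫ t, expo k t * F t ∂freqMeasure = 0) : F =ᵐ[freqMeasure] 0 := by
  have : Fact (0 < 2 * Real.pi) := ⟨by positivity⟩
  have hcoe : Continuous (fun t : ℝ => (t : AddCircle (2 * Real.pi))) :=
    AddCircle.continuous_mk' _
  have hint : ∀ φ : C(AddCircle (2 * Real.pi), ℂ),
      Integrable (fun t : ℝ => φ (t : AddCircle (2 * Real.pi)) * F t) freqMeasure := fun φ =>
    hF.bdd_mul (c := ‖φ‖) (φ.continuous.comp hcoe).aestronglyMeasurable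
      (Filter.Eventually.of_forall fun t => φ.norm_coe_le_norm _)
  let Λ₀ : C(AddCircle (2 * Real.pi), ℂ) →ₗ[ℂ] ℂ :=
    { toFun := fun φ => ∫ t : ℝ, φ (t : AddCircle (2 * Real.pi)) * F t ∂freqMeasure
      map_add' := fun φ ψ => by
        rw [← integral_add (hint φ) (hint ψ)]
        simp [add_mul]
      map_smul' := fun c φ => by
        rw [RingHom.id_apply, smul_eq_mul, ← integral_const_mul]
        simp [mul_assoc] }
  let Λ := Λ₀.mkContinuous (∫ t, ‖F t‖ ∂freqMeasure) fun φ => by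
    refine (norm_integral_le_of_norm_le (hF.norm.const_mul ‖φ‖)
      (Filter.Eventually.of_forall fun t => ?_)).trans ?_
    · rw [norm_mul]
      gcongr
      exact φ.norm_coe_le_norm _
    · rw [integral_const_mul, mul_comm]
  have hker : (Submodule.span ℂ (Set.range (@fourier (2 * Real.pi)))).topologicalClosure ≤
      LinearMap.ker Λ.toLinearMap := by
    refine Submodule.topologicalClosure_minimal _ (Submodule.span_le.2 ?_) Λ.isClosed_ker
    rintro _ ⟨k, rfl⟩
    refine LinearMap.mem_ker.2 (Eq.trans (integral_congr_ae ?_) (h k))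
    refine Filter.Eventually.of_forall fun t => ?_
    simp only [fourier_coe_apply, expo]
    congr 2
    have : (Real.pi : ℂ) ≠ 0 := by exact_mod_cast Real.pi_ne_zero
    push_cast
    field_simp
  rw [span_fourier_closure_eq_top] at hker
  have hΛ : ∀ φ : C(AddCircle (2 * Real.pi), ℂ),
      ∫ t : ℝ, φ (t : AddCircle (2 * Real.pi)) * F t ∂freqMeasure = 0 := fun φ =>
    LinearMap.mem_ker.1 (hker (Submodule.mem_top (x := φ)))
  have hU := isOpen_Ioo.ae_eq_zero_of_integral_contDiff_smul_eq_zero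
    (U := Set.Ioo (-Real.pi) Real.pi) (f := F) (μ := freqMeasure)
    (hF.locallyIntegrable.locallyIntegrableOn _) ?_
  · filter_upwards [hU, ae_mem_Ico, compl_mem_ae_iff.2 (freqMeasure_countable
      (Set.countable_singleton (-Real.pi)))] with t h1 h2 h3
    exact h1 ⟨lt_of_le_of_ne h2.1 fun h => h3 h.symm, h2.2⟩
  · intro g hg _ hsupp
    have hz : ∀ t, t ∉ Set.Ioo (-Real.pi) Real.pi → g t = 0 := fun t ht =>
      image_eq_zero_of_notMem_tsupport fun h => ht (hsupp h)
    have hper : -Real.pi + 2 * Real.pi = Real.pi := by ring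
    have hcont : Continuous (AddCircle.liftIco (2 * Real.pi) (-Real.pi) fun t => (g t : ℂ)) := by
      refine AddCircle.liftIco_continuous ?_ ?_
      · rw [hz _ (by simp), hz _ (by simp [hper])]
      · exact (Complex.continuous_ofReal.comp hg.continuous).continuousOn
    rw [← hΛ ⟨_, hcont⟩]
    refine integral_congr_ae ?_
    filter_upwards [ae_mem_Ico] with t ht
    rw [ContinuousMap.coe_mk, AddCircle.liftIco_coe_apply (by rwa [hper]), Complex.real_smul]

/-- An integrable function all of whose integrals over `[-π, x)` vanish is zero. -/
lemma ae_eq_zero_of_setIntegral_Ico {F : ℝ → ℂ} (hF : Integrable F freqMeasure)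
    (h : ∀ x ∈ Set.Ico (-Real.pi) Real.pi, ∫ t in Set.Ico (-Real.pi) x, F t ∂freqMeasure = 0) :
    F =ᵐ[freqMeasure] 0 := by
  have hIio : ∀ x : ℝ, ∫ t in Set.Iio x, F t ∂freqMeasure =
      ∫ t in Set.Ico (-Real.pi) x, F t ∂freqMeasure := fun x => by
    refine setIntegral_congr_set ?_
    filter_upwards [ae_mem_Ico] with t ht
    refine propext ?_
    change t ∈ Set.Iio x ↔ t ∈ Set.Ico (-Real.pi) x
    simp [ht.1]
  have hsmall : ∀ x < Real.pi, ∫ t in Set.Iio x, F t ∂freqMeasure = 0 := fun x hx => by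
    rw [hIio]
    by_cases hx' : -Real.pi ≤ x
    · exact h x ⟨hx', hx⟩
    · rw [Set.Ico_eq_empty (by linarith)]
      simp
  have hpi : ∫ t, F t ∂freqMeasure = 0 := by
    have h1 := tendsto_setIntegral_of_monotone (μ := freqMeasure) (f := F)
      (s := fun n : ℕ => Set.Iio (Real.pi - 1 / ((n : ℝ) + 1))) (fun n => measurableSet_Iio)
      (fun m n hmn => Set.Iio_subset_Iio (by
        have : 1 / ((n : ℝ) + 1) ≤ 1 / ((m : ℝ) + 1) := by gcongr
        linarith)) hF.integrableOn
    have h2 : ∀ n : ℕ, ∫ t in Set.Iio (Real.pi - 1 / ((n : ℝ) + 1)), F t ∂freqMeasure = 0 :=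
      fun n => hsmall _ (by
        have : 0 < 1 / ((n : ℝ) + 1) := by positivity
        linarith)
    simp only [h2] at h1
    have h3 := tendsto_nhds_unique h1 tendsto_const_nhds
    rw [← h3, ← setIntegral_univ]
    refine setIntegral_congr_set ?_
    filter_upwards [ae_mem_Ico] with t ht
    refine propext ?_
    change t ∈ Set.univ ↔ t ∈ ⋃ n : ℕ, Set.Iio (Real.pi - 1 / ((n : ℝ) + 1))
    obtain ⟨n, hn⟩ := exists_nat_one_div_lt (sub_pos.2 ht.2)
    simp only [Set.mem_univ, true_iff, Set.mem_iUnion, Set.mem_Iio]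
    exact ⟨n, by linarith⟩
  refine hF.ae_eq_zero_of_forall_setIntegral_eq_zero fun s hs _ => ?_
  induction s, hs using MeasurableSpace.induction_on_inter
    ((BorelSpace.measurable_eq (α := ℝ)).trans (borel_eq_generateFrom_Iio ℝ)) isPiSystem_Iio with
  | empty => simp
  | basic s hs =>
    obtain ⟨x, rfl⟩ := hs
    by_cases hx : x < Real.pi
    · exact hsmall x hx
    · rw [← hpi]
      refine (setIntegral_congr_set ?_).trans setIntegral_univ
      filter_upwards [ae_mem_Ico] with t ht
      refine propext ?_
      change t ∈ Set.Iio x ↔ t ∈ Set.univ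
      simp only [Set.mem_Iio, Set.mem_univ, iff_true]
      linarith [ht.2]
  | compl s hs ih =>
    have := integral_add_compl (μ := freqMeasure) (f := F) hs hF
    rw [ih (measure_lt_top _ _), hpi, zero_add] at this
    exact this
  | iUnion s hd hs ih =>
    rw [integral_iUnion (μ := freqMeasure) (f := F) hs hd hF.integrableOn]
    exact (tsum_congr fun n => ih n (measure_lt_top _ _)).trans tsum_zero

/-! ### Hilbert space lemmas -/

section Hilbert

variable {ι H K : Type*} [NormedAddCommGroup H] [InnerProductSpace ℂ H] [NormedAddCommGroup K]
  [InnerProductSpace ℂ K]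

lemma inner_linearCombination (u : ι → H) (a b : ι →₀ ℂ) :
    inner ℂ (Finsupp.linearCombination ℂ u a) (Finsupp.linearCombination ℂ u b) =
      a.sum fun i x => b.sum fun j y => conj x * (y * inner ℂ (u i) (u j)) := by
  simp only [Finsupp.linearCombination_apply, Finsupp.sum, sum_inner, inner_sum, inner_smul_left,
    inner_smul_right, Finset.mul_sum]
  rw [Finset.sum_comm]
  exact Finset.sum_congr rfl fun i _ => Finset.sum_congr rfl fun j _ => by ring

/-- A family with the same Gram matrix as a total family is its image under an isometry. -/
lemma exists_linearIsometry_of_gram [CompleteSpace K] (u : ι → H) (v : ι → K)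
    (hgram : ∀ i j, inner ℂ (v i) (v j) = inner ℂ (u i) (u j))
    (hdense : Dense (Submodule.span ℂ (Set.range u) : Set H)) :
    ∃ V : H →ₗᵢ[ℂ] K, ∀ i, V (u i) = v i := by
  set e := Finsupp.linearCombination ℂ u
  set f := Finsupp.linearCombination ℂ v
  have hnorm : ∀ x, ‖f x‖ = ‖e x‖ := by
    intro x
    rw [@norm_eq_sqrt_re_inner ℂ, @norm_eq_sqrt_re_inner ℂ, inner_linearCombination,
      inner_linearCombination]
    simp only [hgram]
  have hd : DenseRange e := by
    rw [DenseRange, ← LinearMap.coe_range, Finsupp.range_linearCombination]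
    exact hdense
  have hle : ∃ C : ℝ, ∀ x, ‖f x‖ ≤ C * ‖e x‖ := ⟨1, fun x => by rw [one_mul, hnorm]⟩
  refine ⟨⟨(f.extendOfNorm e).toLinearMap, fun x => ?_⟩, fun i => ?_⟩
  · refine hd.induction_on (p := fun x => ‖f.extendOfNorm e x‖ = ‖x‖) x
      (isClosed_eq (by fun_prop) (by fun_prop)) fun a => ?_
    rw [LinearMap.extendOfNorm_eq hd hle, hnorm]
  · have := LinearMap.extendOfNorm_eq hd hle (Finsupp.single i 1)
    simpa [e, f] using this

/-- The foot of the perpendicular is the unique nearest point of a subspace. -/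
lemma nearest_iff_eq_of_orthogonal (H₀ : Submodule ℂ K) {X y₀ : K} (hy₀ : y₀ ∈ H₀)
    (horth : ∀ z ∈ H₀, inner ℂ z (X - y₀) = 0) {y : K} (hy : y ∈ H₀) :
    (∀ y' ∈ H₀, ‖X - y‖ ≤ ‖X - y'‖) ↔ y = y₀ := by
  have hpyth : ∀ y' ∈ H₀, ‖X - y'‖ * ‖X - y'‖ = ‖X - y₀‖ * ‖X - y₀‖ + ‖y₀ - y'‖ * ‖y₀ - y'‖ := by
    intro y' hy'
    have := norm_add_sq_eq_norm_sq_add_norm_sq_of_inner_eq_zero (𝕜 := ℂ) (y₀ - y') (X - y₀)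
      (horth _ (H₀.sub_mem hy₀ hy'))
    rw [show X - y' = (y₀ - y') + (X - y₀) by abel, this, add_comm]
  constructor
  · intro h
    have h1 := h y₀ hy₀
    have h2 := hpyth y hy
    have h3 : ‖y₀ - y‖ * ‖y₀ - y‖ ≤ 0 := by nlinarith [norm_nonneg (X - y), norm_nonneg (X - y₀)]
    have h4 : ‖y₀ - y‖ = 0 := by nlinarith [norm_nonneg (y₀ - y)]
    exact (sub_eq_zero.1 (norm_eq_zero.1 h4)).symm
  · rintro rfl y' hy'
    have := hpyth y' hy'
    exact abs_le_of_sq_le_sq' (by nlinarith [mul_self_nonneg ‖y - y'‖]) (norm_nonneg _) |>.2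

end Hilbert

/-! ### The space of vector functions with a matrix weight -/

section Weight

variable {T : ℕ}

/-- `S` is a measurable factor of the matrix weight `w`, that is `w = S Sᴴ`. -/
structure IsFactor (w S : ℝ → Matrix (Fin T) (Fin T) ℂ) : Prop where
  aemeasurable : ∀ p q, AEMeasurable (fun t => S t p q) freqMeasure
  mul_conjTranspose : ∀ᵐ t ∂freqMeasure, S t * (S t)ᴴ = w t

open scoped MatrixOrder Matrix.Norms.L2Operator in
/-- A measurable nonnegative definite matrix function has a measurable square root. -/
lemma exists_isFactor {w : ℝ → Matrix (Fin T) (Fin T) ℂ}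
    (hm : ∀ p q, AEMeasurable (fun t => w t p q) freqMeasure)
    (hw : ∀ᵐ t ∂freqMeasure, (w t).PosSemidef) : ∃ S, IsFactor w S := by
  have hwm : AEMeasurable (β := Fin T → Fin T → ℂ) w freqMeasure :=
    aemeasurable_pi_lambda _ fun p => aemeasurable_pi_lambda _ fun q => hm p q
  refine ⟨fun t => CFC.sqrt (w t), fun p q => ?_, ?_⟩
  · have hset : IsClosed
        {A : Fin T → Fin T → ℂ | (0 : Matrix (Fin T) (Fin T) ℂ) ≤ Matrix.of A} := by
      have : {A : Fin T → Fin T → ℂ | (0 : Matrix (Fin T) (Fin T) ℂ) ≤ Matrix.of A} =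
          {A | (Matrix.of A)ᴴ = Matrix.of A} ∩
            ⋂ x : Fin T → ℂ, {A | 0 ≤ star x ⬝ᵥ (Matrix.of A *ᵥ x)} := by
        ext A
        simp only [Set.mem_ofPred_eq, Set.mem_inter_iff, Set.mem_iInter,
          Matrix.nonneg_iff_posSemidef,
          Matrix.posSemidef_iff_dotProduct_mulVec, Matrix.IsHermitian]
      rw [this]
      have hof : Continuous (Matrix.of : (Fin T → Fin T → ℂ) → Matrix (Fin T) (Fin T) ℂ) :=
        continuous_id
      refine (isClosed_eq hof.matrix_conjTranspose hof).inter (isClosed_iInter fun x => ?_)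
      exact isClosed_le continuous_const
        (continuous_const.dotProduct (hof.matrix_mulVec continuous_const))
    have hc : ContinuousOn (fun A : Fin T → Fin T → ℂ =>
        (CFC.sqrt (Matrix.of A : Matrix (Fin T) (Fin T) ℂ)) p q)
        {A | (0 : Matrix (Fin T) (Fin T) ℂ) ≤ Matrix.of A} := by
      have h1 : ContinuousOn CFC.sqrt {A : Matrix (Fin T) (Fin T) ℂ | 0 ≤ A} :=
        CFC.continuousOn_sqrt
      have h2 : Continuous fun A : Matrix (Fin T) (Fin T) ℂ => A p q :=
        continuous_id.matrix_elem p q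
      exact h2.comp_continuousOn h1
    classical
    have hmeas := hc.measurable_piecewise (g := fun _ => (0 : ℂ)) continuousOn_const
      hset.measurableSet
    refine (hmeas.comp_aemeasurable hwm).congr ?_
    filter_upwards [hw] with t ht
    exact Set.piecewise_eq_of_mem _ _ _ ht.nonneg
  · filter_upwards [hw] with t ht
    have h0 : 0 ≤ w t := ht.nonneg
    have h1 : (CFC.sqrt (w t)).IsHermitian :=
      (Matrix.nonneg_iff_posSemidef.1 (CFC.sqrt_nonneg (w t))).isHermitian
    rw [h1.eq]
    exact CFC.sqrt_mul_sqrt_self (w t) h0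

/-- A row vector function `h`, multiplied by `S`.  If `w = S Sᴴ`, this maps `L₂(w)` isometrically
into the space of square integrable functions. -/
noncomputable def weighted (S : ℝ → Matrix (Fin T) (Fin T) ℂ) (h : ℝ → Fin T → ℂ) (t : ℝ) :
    EuclideanSpace ℂ (Fin T) :=
  WithLp.toLp 2 (h t ᵥ* S t)

/-- The function `h` belongs to `L₂(w)`, `w = S Sᴴ`. -/
structure MemWeighted (S : ℝ → Matrix (Fin T) (Fin T) ℂ) (h : ℝ → Fin T → ℂ) : Prop where
  aemeasurable : ∀ p, AEMeasurable (fun t => h t p) freqMeasure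
  memLp : MemLp (weighted S h) 2 freqMeasure

open scoped Classical in
/-- The element of the Hilbert space defined by a function in `L₂(w)`; zero for other functions. -/
noncomputable def toWeighted (S : ℝ → Matrix (Fin T) (Fin T) ℂ) (h : ℝ → Fin T → ℂ) :
    Lp (EuclideanSpace ℂ (Fin T)) 2 freqMeasure :=
  if hh : MemWeighted S h then hh.memLp.toLp _ else 0

variable {w S : ℝ → Matrix (Fin T) (Fin T) ℂ} {h k : ℝ → Fin T → ℂ}

lemma toWeighted_coe (hh : MemWeighted S h) : toWeighted S h =ᵐ[freqMeasure] weighted S h := by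
  rw [toWeighted, dif_pos hh]
  exact hh.memLp.coeFn_toLp

lemma MemWeighted.add (hh : MemWeighted S h) (hk : MemWeighted S k) :
    MemWeighted S (h + k) ∧ toWeighted S (h + k) = toWeighted S h + toWeighted S k := by
  have e : weighted S (h + k) = weighted S h + weighted S k := by
    funext t
    simp [weighted, Matrix.add_vecMul]
  have hm : MemWeighted S (h + k) :=
    ⟨fun p => (hh.aemeasurable p).add (hk.aemeasurable p), by rw [e]; exact hh.memLp.add hk.memLp⟩
  refine ⟨hm, ?_⟩
  rw [toWeighted, toWeighted, toWeighted, dif_pos hm, dif_pos hh, dif_pos hk, ← MemLp.toLp_add]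
  congr 1

lemma MemWeighted.smul (hh : MemWeighted S h) (c : ℂ) :
    MemWeighted S (c • h) ∧ toWeighted S (c • h) = c • toWeighted S h := by
  have e : weighted S (c • h) = c • weighted S h := by
    funext t
    simp [weighted, Matrix.smul_vecMul]
  have hm : MemWeighted S (c • h) :=
    ⟨fun p => (hh.aemeasurable p).const_smul c, by rw [e]; exact hh.memLp.const_smul c⟩
  refine ⟨hm, ?_⟩
  rw [toWeighted, toWeighted, dif_pos hm, dif_pos hh, ← MemLp.toLp_const_smul]
  congr 1

lemma memWeighted_zero : MemWeighted S 0 ∧ toWeighted S 0 = 0 := by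
  have e : weighted S 0 = 0 := by
    funext t
    simp [weighted]
  have hm : MemWeighted S 0 := ⟨fun p => aemeasurable_const, by rw [e]; exact MemLp.zero⟩
  refine ⟨hm, ?_⟩
  rw [toWeighted, dif_pos hm]
  simp only [e]
  exact MemLp.toLp_zero _

lemma MemWeighted.sub (hh : MemWeighted S h) (hk : MemWeighted S k) :
    MemWeighted S (h - k) ∧ toWeighted S (h - k) = toWeighted S h - toWeighted S k := by
  have h1 := hk.smul (-1)
  have h2 := hh.add h1.1
  have e : h - k = h + (-1 : ℂ) • k := by rw [neg_one_smul, sub_eq_add_neg]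
  rw [e]
  refine ⟨h2.1, ?_⟩
  rw [h2.2, h1.2, neg_one_smul, sub_eq_add_neg]

lemma MemWeighted.sum {ι : Type*} (u : Finset ι) (c : ι → ℂ) {φ : ι → ℝ → Fin T → ℂ}
    (hφ : ∀ i ∈ u, MemWeighted S (φ i)) :
    MemWeighted S (∑ i ∈ u, c i • φ i) ∧
      toWeighted S (∑ i ∈ u, c i • φ i) = ∑ i ∈ u, c i • toWeighted S (φ i) := by
  classical
  induction u using Finset.induction_on with
  | empty => simpa using memWeighted_zero
  | insert i u hi ih =>
    rw [Finset.sum_insert hi, Finset.sum_insert hi]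
    have h1 := (hφ i (Finset.mem_insert_self _ _)).smul (c i)
    have h2 := ih fun j hj => hφ j (Finset.mem_insert_of_mem hj)
    have h3 := h1.1.add h2.1
    exact ⟨h3.1, by rw [h3.2, h1.2, h2.2]⟩

lemma inner_weighted {t : ℝ} (ht : S t * (S t)ᴴ = w t) :
    inner ℂ (weighted S h t) (weighted S k t) = (k t ᵥ* w t) ⬝ᵥ star (h t) := by
  rw [EuclideanSpace.inner_eq_star_dotProduct, weighted, weighted, ← ht, ← Matrix.vecMul_vecMul,
    Matrix.star_vecMul, Matrix.dotProduct_mulVec]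

lemma inner_toWeighted (hS : IsFactor w S) (hh : MemWeighted S h) (hk : MemWeighted S k) :
    inner ℂ (toWeighted S h) (toWeighted S k) =
      ∫ t, (k t ᵥ* w t) ⬝ᵥ star (h t) ∂freqMeasure := by
  rw [L2.inner_def]
  refine integral_congr_ae ?_
  filter_upwards [toWeighted_coe hh, toWeighted_coe hk, hS.mul_conjTranspose] with t h1 h2 h3
  rw [h1, h2, inner_weighted h3]

lemma integrable_inner_weighted (hS : IsFactor w S) (hh : MemWeighted S h)
    (hk : MemWeighted S k) :
    Integrable (fun t => (k t ᵥ* w t) ⬝ᵥ star (h t)) freqMeasure := by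
  refine (L2.integrable_inner (𝕜 := ℂ) (toWeighted S h) (toWeighted S k)).congr ?_
  filter_upwards [toWeighted_coe hh, toWeighted_coe hk, hS.mul_conjTranspose] with t h1 h2 h3
  rw [h1, h2, inner_weighted h3]

lemma aestronglyMeasurable_weighted (hS : IsFactor w S)
    (hh : ∀ p, AEMeasurable (fun t => h t p) freqMeasure) :
    AEStronglyMeasurable (weighted S h) freqMeasure := by
  refine AEMeasurable.aestronglyMeasurable ?_
  refine (WithLp.measurable_toLp 2 (Fin T → ℂ)).comp_aemeasurable
    (aemeasurable_pi_lambda _ fun q => ?_)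
  simp only [Matrix.vecMul, dotProduct]
  exact Finset.aemeasurable_fun_sum _ fun p _ => (hh p).mul (hS.aemeasurable p q)

lemma norm_sq_weighted {t : ℝ} (ht : S t * (S t)ᴴ = w t) :
    ((‖weighted S h t‖ ^ 2 : ℝ) : ℂ) = hermForm (w t) (h t) := by
  rw [hermForm, ← inner_weighted ht, inner_self_eq_norm_sq_to_K]
  push_cast
  rfl

/-- Membership in `L₂(w)` follows from an integrable bound on the quadratic form of `w`. -/
lemma memWeighted_of_bound (hS : IsFactor w S)
    (hh : ∀ p, AEMeasurable (fun t => h t p) freqMeasure) {B : ℝ → ℝ}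
    (hB : Integrable B freqMeasure)
    (hle : ∀ᵐ t ∂freqMeasure, ‖hermForm (w t) (h t)‖ ≤ B t) : MemWeighted S h := by
  have hm := aestronglyMeasurable_weighted hS hh
  refine ⟨hh, (memLp_two_iff_integrable_sq_norm hm).2 ?_⟩
  refine hB.mono' (hm.norm.pow 2) ?_
  filter_upwards [hle, hS.mul_conjTranspose] with t h1 h2
  rw [← norm_sq_weighted h2, Complex.norm_real] at h1
  exact h1

/-- A family `q φₖ eₚ` is total in `L₂(w)` if integrable functions are determined by their
integrals against the `φₖ`. -/
lemma dense_span_toWeighted (hS : IsFactor w S) (hw : ∀ᵐ t ∂freqMeasure, IsUnit (w t).det)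
    {κ : Type*} (φ : κ → ℝ → ℂ) (q : ℝ → ℂ) (hq : ∀ᵐ t ∂freqMeasure, q t ≠ 0)
    (hmem : ∀ p, MemWeighted S fun t => Pi.single p (q t))
    (hmemφ : ∀ k p, MemWeighted S fun t => Pi.single p (φ k t * q t))
    (huniq : ∀ F : ℝ → ℂ, Integrable F freqMeasure → (∀ k, ∫ t, φ k t * F t ∂freqMeasure = 0) →
      F =ᵐ[freqMeasure] 0) :
    Dense (Submodule.span ℂ (Set.range fun kp : κ × Fin T =>
      toWeighted S fun t => Pi.single kp.2 (φ kp.1 t * q t)) :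
        Set (Lp (EuclideanSpace ℂ (Fin T)) 2 freqMeasure)) := by
  -- for `u` orthogonal to the family, the integrable functions `q (S ū)ₚ` vanish, whence `u = 0`
  -- because `S` is invertible
  rw [Submodule.dense_iff_topologicalClosure_eq_top, Submodule.topologicalClosure_eq_top_iff,
    Submodule.eq_bot_iff]
  intro u hu
  have hin : ∀ (c : ℂ) (p : Fin T) (t : ℝ),
      inner ℂ (u t) (WithLp.toLp 2 ((Pi.single p c : Fin T → ℂ) ᵥ* S t)) =
        c * (S t *ᵥ star (u t).ofLp) p := by
    intro c p t
    rw [EuclideanSpace.inner_eq_star_dotProduct, ← Matrix.dotProduct_mulVec, single_dotProduct]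
  have hint : ∀ p, Integrable (fun t => q t * (S t *ᵥ star (u t).ofLp) p) freqMeasure := by
    intro p
    refine (L2.integrable_inner (𝕜 := ℂ) u (toWeighted S fun t => Pi.single p (q t))).congr ?_
    filter_upwards [toWeighted_coe (hmem p)] with t h1
    rw [h1, weighted, hin]
  have hzero : ∀ p, (fun t => q t * (S t *ᵥ star (u t).ofLp) p) =ᵐ[freqMeasure] 0 := by
    intro p
    refine huniq _ (hint p) fun k => ?_
    have h0 : inner ℂ u (toWeighted S fun t => Pi.single p (φ k t * q t)) = 0 :=
      (Submodule.mem_orthogonal' _ _).1 hu _ (Submodule.subset_span ⟨(k, p), rfl⟩)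
    rw [L2.inner_def] at h0
    rw [← h0]
    refine integral_congr_ae ?_
    filter_upwards [toWeighted_coe (hmemφ k p)] with t h1
    rw [h1, weighted, hin, mul_assoc]
  rw [Lp.eq_zero_iff_ae_eq_zero]
  filter_upwards [ae_all_iff.2 hzero, hq, hw, hS.mul_conjTranspose] with t h1 h2 h3 h4
  have h5 : S t *ᵥ star (u t).ofLp = 0 := by
    funext p
    exact (mul_eq_zero.1 (h1 p)).resolve_left h2
  have h6 : IsUnit (S t).det := by
    rw [← h4, Matrix.det_mul] at h3
    exact isUnit_of_mul_isUnit_left h3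
  have h7 : star (u t).ofLp = 0 := by
    have := congrArg (fun x => (S t)⁻¹ *ᵥ x) h5
    simpa [Matrix.mulVec_mulVec, Matrix.nonsing_inv_mul _ h6] using this
  have h8 : (u t).ofLp = 0 := star_eq_zero.1 h7
  ext p
  exact congrFun h8 p

end Weight

/-! ### Stochastic integrals -/

section StochasticIntegral

variable {T : ℕ} {w S : ℝ → Matrix (Fin T) (Fin T) ℂ} {h : ℝ → Fin T → ℂ}

/-- The function `1_{[x, y)} e_p`. -/
noncomputable def indicatorVec (x y : ℝ) (p : Fin T) (t : ℝ) : Fin T → ℂ :=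
  Pi.single p ((Set.Ico x y).indicator 1 t)

lemma stepFun_eq_sum {n : ℕ} (x y : Fin n → ℝ) (c : Fin n → Fin T → ℂ) :
    stepFun x y c = ∑ ip ∈ (Finset.univ : Finset (Fin n × Fin T)),
      c ip.1 ip.2 • indicatorVec (x ip.1) (y ip.1) ip.2 := by
  funext t
  ext q
  rw [← Finset.univ_product_univ, Finset.sum_product]
  simp only [stepFun, Finset.sum_apply, Pi.smul_apply, indicatorVec]
  refine Finset.sum_congr rfl fun i _ => ?_
  by_cases ht : t ∈ Set.Ico (x i) (y i)
  · simp [ht, Pi.single_apply]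
  · simp [ht]

lemma aemeasurable_single {q : ℝ → ℂ} (hq : AEMeasurable q freqMeasure) (p p' : Fin T) :
    AEMeasurable (fun t => (Pi.single p (q t) : Fin T → ℂ) p') freqMeasure := by
  rcases eq_or_ne p' p with rfl | hp
  · simpa using hq
  · simp only [Pi.single_eq_of_ne hp]
    exact aemeasurable_const

lemma hermForm_single_smul (W : Matrix (Fin T) (Fin T) ℂ) (p : Fin T) (c : ℂ) :
    hermForm W (Pi.single p c) = (‖c‖ ^ 2 : ℝ) * W p p := by
  rw [← hermForm_single W p, ← hermForm_smul, ← Pi.single_smul, smul_eq_mul, mul_one]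

lemma memWeighted_single (hS : IsFactor w S)
    {q : ℝ → ℂ} (hq : AEMeasurable q freqMeasure) (p : Fin T)
    (hi : Integrable (fun t => ((‖q t‖ ^ 2 : ℝ) : ℂ) * w t p p) freqMeasure) :
    MemWeighted S fun t => Pi.single p (q t) := by
  refine memWeighted_of_bound hS (aemeasurable_single hq p) hi.norm
    (Filter.Eventually.of_forall fun t => ?_)
  rw [hermForm_single_smul]

lemma memWeighted_indicatorVec (hS : IsFactor w S)
    (hw : ∀ p q, Integrable (fun t => w t p q) freqMeasure) (x y : ℝ) (p : Fin T) :
    MemWeighted S (indicatorVec x y p) := by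
  refine memWeighted_single hS ?_ p ?_
  · exact ((measurable_one.indicator measurableSet_Ico).aemeasurable :
      AEMeasurable ((Set.Ico x y).indicator (1 : ℝ → ℂ)) freqMeasure)
  · refine ((hw p p).indicator (measurableSet_Ico (a := x) (b := y))).congr
      (Filter.Eventually.of_forall fun t => ?_)
    by_cases ht : t ∈ Set.Ico x y <;> simp [ht]

lemma inner_indicatorVec (hS : IsFactor w S)
    (hw : ∀ p q, Integrable (fun t => w t p q) freqMeasure) (x y x' y' : ℝ) (p q : Fin T) :
    inner ℂ (toWeighted S (indicatorVec x y p)) (toWeighted S (indicatorVec x' y' q)) =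
      ∫ t in Set.Ico x y ∩ Set.Ico x' y', w t q p ∂freqMeasure := by
  rw [inner_toWeighted hS (memWeighted_indicatorVec hS hw x y p)
    (memWeighted_indicatorVec hS hw x' y' q),
    ← integral_indicator (measurableSet_Ico.inter measurableSet_Ico)]
  refine integral_congr_ae (Filter.Eventually.of_forall fun t => ?_)
  by_cases h1 : t ∈ Set.Ico x y <;> by_cases h2 : t ∈ Set.Ico x' y' <;>
    simp [h1, h2, indicatorVec, -Set.mem_Ico, -Matrix.vecMul_zero]

lemma indicatorVec_sub {x y : ℝ} (hx : -Real.pi ≤ x) (hxy : x ≤ y) (p : Fin T) :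
    indicatorVec x y p = indicatorVec (-Real.pi) y p - indicatorVec (-Real.pi) x p := by
  funext t
  rw [Pi.sub_apply]
  simp only [indicatorVec, ← Pi.single_sub]
  congr 1
  simp only [Set.indicator_apply, Set.mem_Ico, Pi.one_apply]
  split_ifs <;> first | (exfalso; grind) | simp

/-- The functions `1_{[-π, x)} e_p` are total in `L₂(w)`. -/
lemma dense_span_indicatorVec (hS : IsFactor w S)
    (hw : ∀ p q, Integrable (fun t => w t p q) freqMeasure)
    (hdet : ∀ᵐ t ∂freqMeasure, IsUnit (w t).det) :
    Dense (Submodule.span ℂ (Set.range fun kp : Set.Ico (-Real.pi) Real.pi × Fin T =>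
      toWeighted S (indicatorVec (-Real.pi) (kp.1 : ℝ) kp.2)) :
        Set (Lp (EuclideanSpace ℂ (Fin T)) 2 freqMeasure)) := by
  have := dense_span_toWeighted hS hdet (κ := Set.Ico (-Real.pi) Real.pi)
    (fun x => (Set.Ico (-Real.pi) (x : ℝ)).indicator 1) (fun _ => 1)
    (Filter.Eventually.of_forall fun _ => one_ne_zero)
    (fun p => memWeighted_single hS aemeasurable_const p (by simpa using hw p p))
    (fun x p => by
      simp only [mul_one]
      exact memWeighted_indicatorVec hS hw (-Real.pi) x p)
    (fun F hF h => ae_eq_zero_of_setIntegral_Ico hF fun x hx => by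
      rw [← h ⟨x, hx⟩, ← integral_indicator measurableSet_Ico]
      refine integral_congr_ae (Filter.Eventually.of_forall fun t => ?_)
      by_cases ht : t ∈ Set.Ico (-Real.pi) x <;> simp [ht, -Set.mem_Ico])
  simp only [mul_one] at this
  exact this

variable {Ω : Type*} [MeasurableSpace Ω] {P : Measure Ω}

lemma memLp_sum_smul {ι : Type*} (u : Finset ι) (c : ι → ℂ) {X : ι → Ω → ℂ}
    (hX : ∀ i ∈ u, MemLp (X i) 2 P) : MemLp (∑ i ∈ u, c i • X i) 2 P :=
  memLp_finsetSum' u fun i hi => (hX i hi).const_smul (c i)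

lemma coeFn_sum_smul {ι : Type*} (u : Finset ι) (c : ι → ℂ) (Y : ι → Lp ℂ 2 P) {X : ι → Ω → ℂ}
    (h : ∀ i ∈ u, Y i =ᵐ[P] X i) :
    ((∑ i ∈ u, c i • Y i : Lp ℂ 2 P) : Ω → ℂ) =ᵐ[P] ∑ i ∈ u, c i • X i := by
  classical
  induction u using Finset.induction_on with
  | empty => simpa using Lp.coeFn_zero ℂ 2 P
  | insert i u hi ih =>
    rw [Finset.sum_insert hi, Finset.sum_insert hi]
    refine (Lp.coeFn_add _ _).trans ?_
    exact ((Lp.coeFn_smul _ _).trans ((h i (Finset.mem_insert_self _ _)).const_smul (c i))).add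
      (ih fun j hj => h j (Finset.mem_insert_of_mem hj))

lemma enorm_sq_Lp {E α : Type*} [NormedAddCommGroup E] [MeasurableSpace α] {μ : Measure α}
    (u : Lp E 2 μ) {v : α → E} (h : u =ᵐ[μ] v) : ‖u‖ₑ ^ 2 = ∫⁻ t, ‖v t‖ₑ ^ 2 ∂μ := by
  rw [Lp.enorm_def, eLpNorm_congr_ae h,
    eLpNorm_eq_lintegral_rpow_enorm_toReal (by norm_num) (by norm_num)]
  simp only [ENNReal.toReal_ofNat, ENNReal.rpow_ofNat, one_div]
  rw [← ENNReal.rpow_natCast, ← ENNReal.rpow_mul]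
  norm_num

lemma enorm_sq_toWeighted (hS : IsFactor w S)
    (hh : MemWeighted S h) :
    ‖toWeighted S h‖ₑ ^ 2 = ∫⁻ t, ENNReal.ofReal (hermForm (w t) (h t)).re ∂freqMeasure := by
  rw [enorm_sq_Lp _ (toWeighted_coe hh)]
  refine lintegral_congr_ae ?_
  filter_upwards [hS.mul_conjTranspose] with t ht
  rw [← norm_sq_weighted ht, Complex.ofReal_re, ENNReal.ofReal_pow (norm_nonneg _),
    ofReal_norm]

/-- The isometry `V` maps `1_{[x, y)} e_p` to the increment of `Z_p` over `[x, y)`. -/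
def MapsToIncrements (S : ℝ → Matrix (Fin T) (Fin T) ℂ)
    (V : Lp (EuclideanSpace ℂ (Fin T)) 2 freqMeasure →ₗᵢ[ℂ] Lp ℂ 2 P) (Z : Fin T → ℝ → Ω → ℂ) :
    Prop :=
  ∀ p x y, -Real.pi ≤ x → x ≤ y → y < Real.pi →
    V (toWeighted S (indicatorVec x y p)) =ᵐ[P] fun ω => Z p y ω - Z p x ω

lemma memWeighted_stepFun (hS : IsFactor w S)
    (hw : ∀ p q, Integrable (fun t => w t p q) freqMeasure) {n : ℕ} (x y : Fin n → ℝ)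
    (c : Fin n → Fin T → ℂ) : MemWeighted S (stepFun x y c) := by
  rw [stepFun_eq_sum]
  exact (MemWeighted.sum _ _ fun ip _ => memWeighted_indicatorVec hS hw _ _ _).1

lemma map_stepFun (hS : IsFactor w S)
    (hw : ∀ p q, Integrable (fun t => w t p q) freqMeasure)
    {V : Lp (EuclideanSpace ℂ (Fin T)) 2 freqMeasure →ₗᵢ[ℂ] Lp ℂ 2 P} {Z : Fin T → ℝ → Ω → ℂ}
    (hV : MapsToIncrements S V Z) {n : ℕ} (x y : Fin n → ℝ)
    (c : Fin n → Fin T → ℂ) (hxy : ∀ i, -Real.pi ≤ x i ∧ x i ≤ y i ∧ y i < Real.pi) :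
    V (toWeighted S (stepFun x y c)) =ᵐ[P] stepIntegral Z x y c := by
  rw [stepFun_eq_sum, (MemWeighted.sum _ (fun ip : Fin n × Fin T => c ip.1 ip.2)
    fun ip _ => memWeighted_indicatorVec hS hw _ _ _).2, map_sum]
  simp only [map_smul]
  refine (coeFn_sum_smul _ _ _ fun ip _ => hV ip.2 _ _ (hxy ip.1).1 (hxy ip.1).2.1
    (hxy ip.1).2.2).trans (Filter.EventuallyEq.of_eq ?_)
  funext ω
  rw [← Finset.univ_product_univ, Finset.sum_product]
  simp [stepIntegral, Finset.sum_apply]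

lemma enorm_sub_sq_lt {α : Type*} [SeminormedAddCommGroup α] {u v : α} {ε : ENNReal}
    (h : edist u v < min 1 ε) : ‖u - v‖ₑ ^ 2 < ε := by
  rw [← edist_eq_enorm_sub]
  have h1 := (lt_min_iff.1 h)
  calc edist u v ^ 2 = edist u v * edist u v := sq _
    _ ≤ 1 * edist u v := by gcongr; exact h1.1.le
    _ < ε := by rw [one_mul]; exact h1.2

/-- Stochastic integration with respect to `Z` is the isometry that maps `1_{[x, y)} e_p` to the
increment of `Z_p` over `[x, y)`. -/
lemma isStochasticIntegral_iff (hS : IsFactor w S)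
    (hw : ∀ p q, Integrable (fun t => w t p q) freqMeasure)
    (hdet : ∀ᵐ t ∂freqMeasure, IsUnit (w t).det)
    {V : Lp (EuclideanSpace ℂ (Fin T)) 2 freqMeasure →ₗᵢ[ℂ] Lp ℂ 2 P} {Z : Fin T → ℝ → Ω → ℂ}
    (hV : MapsToIncrements S V Z) (hh : MemWeighted S h) (Y : Ω → ℂ) :
    IsStochasticIntegral P w Z h Y ↔ Y =ᵐ[P] V (toWeighted S h) := by
  have hstep : ∀ {n : ℕ} (x y : Fin n → ℝ) (c : Fin n → Fin T → ℂ),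
      ∫⁻ t, ENNReal.ofReal (hermForm (w t) (h t - stepFun x y c t)).re ∂freqMeasure =
        ‖toWeighted S h - toWeighted S (stepFun x y c)‖ₑ ^ 2 := by
    intro n x y c
    have h1 := hh.sub (memWeighted_stepFun hS hw x y c)
    rw [← h1.2, enorm_sq_toWeighted hS h1.1]
    rfl
  have hstep2 : ∀ {n : ℕ} (x y : Fin n → ℝ) (c : Fin n → Fin T → ℂ),
      (∀ i, -Real.pi ≤ x i ∧ x i ≤ y i ∧ y i < Real.pi) → ∀ (Y' : Lp ℂ 2 P), Y' =ᵐ[P] Y →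
      ∫⁻ ω, ‖Y ω - stepIntegral Z x y c ω‖ₑ ^ 2 ∂P =
        ‖Y' - V (toWeighted S (stepFun x y c))‖ₑ ^ 2 := by
    intro n x y c hxy Y' hY'
    refine (enorm_sq_Lp _ ?_).symm
    exact (Lp.coeFn_sub _ _).trans (hY'.sub (map_stepFun hS hw hV x y c hxy))
  constructor
  · rintro ⟨-, hY, happ⟩
    suffices hsuff : hY.toLp Y = V (toWeighted S h) by
      rw [← hsuff]
      exact hY.coeFn_toLp.symm
    -- both sides are close to the integral of one step function
    refine eq_of_forall_dist_le fun ε hε => ?_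
    obtain ⟨n, x, y, c, hxy, h1, h2⟩ :=
      happ (ENNReal.ofReal ((ε / 2) ^ 2)) (by simpa using by positivity)
    rw [hstep, ENNReal.ofReal_pow (by positivity)] at h1
    rw [hstep2 x y c hxy _ hY.coeFn_toLp, ENNReal.ofReal_pow (by positivity)] at h2
    have h1' := lt_of_not_ge fun hge => h1.not_ge (pow_le_pow_left' hge 2)
    have h2' := lt_of_not_ge fun hge => h2.not_ge (pow_le_pow_left' hge 2)
    rw [← ofReal_norm, ENNReal.ofReal_lt_ofReal_iff (by positivity)] at h1' h2'
    rw [← V.norm_map, map_sub] at h1'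
    have h3 := norm_sub_le_norm_sub_add_norm_sub (hY.toLp Y)
      (V (toWeighted S (stepFun x y c))) (V (toWeighted S h))
    rw [norm_sub_rev (V (toWeighted S (stepFun x y c)))] at h3
    rw [dist_eq_norm]
    linarith
  · intro hY
    refine ⟨hh.aemeasurable, (Lp.memLp (V (toWeighted S h))).ae_eq hY.symm, fun ε hε => ?_⟩
    obtain ⟨u, hu, hdist⟩ := EMetric.mem_closure_iff.1
      ((dense_span_indicatorVec hS hw hdet).closure_eq ▸ Set.mem_univ (toWeighted S h)) (min 1 ε)
      (lt_min one_pos hε)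
    obtain ⟨c, hc⟩ := (Finsupp.mem_span_range_iff_exists_finsupp).1 hu
    set E := c.support.equivFin with hE
    set x : Fin c.support.card → ℝ := fun _ => -Real.pi with hx
    set y : Fin c.support.card → ℝ := fun i => ((E.symm i).1.1 : ℝ) with hy
    set κ : Fin c.support.card → Fin T → ℂ := fun i =>
      Pi.single (E.symm i).1.2 (c (E.symm i)) with hκ
    have hxy : ∀ i, -Real.pi ≤ x i ∧ x i ≤ y i ∧ y i < Real.pi := fun i =>
      ⟨le_rfl, (E.symm i).1.1.2.1, (E.symm i).1.1.2.2⟩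
    have hu' : toWeighted S (stepFun x y κ) = u := by
      rw [stepFun_eq_sum, (MemWeighted.sum _ (fun ip : Fin c.support.card × Fin T => κ ip.1 ip.2)
        fun ip _ => memWeighted_indicatorVec hS hw _ _ _).2, ← hc, Finsupp.sum,
        ← Finset.univ_product_univ, Finset.sum_product]
      have hR : ∀ G : Set.Ico (-Real.pi) Real.pi × Fin T →
          Lp (EuclideanSpace ℂ (Fin T)) 2 freqMeasure,
          ∑ a ∈ c.support, G a = ∑ i, G (E.symm i) := fun G => by
        rw [← Finset.sum_coe_sort]
        exact (E.symm.sum_comp fun a : c.support => G a).symm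
      rw [hR]
      refine Finset.sum_congr rfl fun i _ => ?_
      rw [Finset.sum_eq_single (E.symm i).1.2]
      · simp [hκ, hx, hy]
      · intro p _ hp
        simp [hκ, Pi.single_eq_of_ne hp]
      · simp
    refine ⟨_, x, y, κ, hxy, ?_, ?_⟩
    · rw [hstep, hu']
      exact enorm_sub_sq_lt hdist
    · rw [hstep2 x y κ hxy _ hY.symm, hu', ← map_sub]
      refine lt_of_eq_of_lt ?_ (enorm_sub_sq_lt hdist)
      rw [enorm_eq_nnnorm, enorm_eq_nnnorm, V.nnnorm_map]

end StochasticIntegral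

/-! ### Second moments of the increments -/

section L2

variable {Ω : Type*} [MeasurableSpace Ω] {P : Measure Ω}

open scoped Classical in
/-- The element of `L₂(P)` defined by a random variable; zero if it is not square integrable. -/
noncomputable def toL2 (P : Measure Ω) (X : Ω → ℂ) : Lp ℂ 2 P :=
  if hX : MemLp X 2 P then hX.toLp X else 0

variable {X Y : Ω → ℂ}

lemma toL2_coe (hX : MemLp X 2 P) : toL2 P X =ᵐ[P] X := by
  rw [toL2, dif_pos hX]
  exact hX.coeFn_toLp

lemma toL2_eq_iff (hX : MemLp X 2 P) (y : Lp ℂ 2 P) : toL2 P X = y ↔ X =ᵐ[P] y :=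
  ⟨fun h => h ▸ (toL2_coe hX).symm, fun h => Lp.ext ((toL2_coe hX).trans h)⟩

lemma toL2_add (hX : MemLp X 2 P) (hY : MemLp Y 2 P) :
    toL2 P (X + Y) = toL2 P X + toL2 P Y :=
  (toL2_eq_iff (hX.add hY) _).2
    (((toL2_coe hX).symm.add (toL2_coe hY).symm).trans (Lp.coeFn_add _ _).symm)

lemma toL2_sum {ι : Type*} (u : Finset ι) (c : ι → ℂ) {X : ι → Ω → ℂ}
    (hX : ∀ i ∈ u, MemLp (X i) 2 P) :
    toL2 P (∑ i ∈ u, c i • X i) = ∑ i ∈ u, c i • toL2 P (X i) :=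
  (toL2_eq_iff (memLp_sum_smul u c hX) _).2
    (coeFn_sum_smul u c _ fun i hi => toL2_coe (hX i hi)).symm

lemma inner_L2 (u v : Lp ℂ 2 P) (hX : u =ᵐ[P] X) (hY : v =ᵐ[P] Y) :
    inner ℂ u v = ∫ ω, Y ω * conj (X ω) ∂P := by
  rw [L2.inner_def]
  refine integral_congr_ae ?_
  filter_upwards [hX, hY] with ω h1 h2
  rw [h1, h2]
  simp

lemma inner_toL2 (hX : MemLp X 2 P) (hY : MemLp Y 2 P) :
    inner ℂ (toL2 P X) (toL2 P Y) = ∫ ω, Y ω * conj (X ω) ∂P :=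
  inner_L2 _ _ (toL2_coe hX) (toL2_coe hY)

end L2

section Moments

variable {Ω : Type*} [MeasurableSpace Ω] {P : Measure Ω} {T r : ℕ} {d s : Fin r → ℕ}
  {ξ η : Fin T → ℤ → Ω → ℂ} {f g : ℝ → Matrix (Fin T) (Fin T) ℂ}

lemma integrable_expo_mul {φ : ℝ → ℂ} (hφ : Integrable φ freqMeasure) (k : ℤ) :
    Integrable (fun t => expo k t * φ t) freqMeasure :=
  hφ.bdd_mul (c := 1) (continuous_expo k).aestronglyMeasurable
    (Filter.Eventually.of_forall fun t => (norm_expo k t).le)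

/-- Covariances of linear combinations of the values of a stationary sequence. -/
lemma inner_sum_stationary (hg : IsStationarySpectralDensity P η g) {ι κ : Type*}
    (u : Finset ι) (a : ι → ℂ) (p : ι → Fin T) (k : ι → ℤ)
    (v : Finset κ) (b : κ → ℂ) (q : κ → Fin T) (m : κ → ℤ) :
    inner ℂ (∑ i ∈ u, a i • toL2 P (η (p i) (k i))) (∑ j ∈ v, b j • toL2 P (η (q j) (m j))) =
      ∫ t, ∑ i ∈ u, ∑ j ∈ v,
        b j * expo (m j) t * conj (a i * expo (k i) t) * g t (q j) (p i) ∂freqMeasure := by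
  have hterm : ∀ i j, (fun t => b j * expo (m j) t * conj (a i * expo (k i) t) * g t (q j) (p i)) =
      fun t => (conj (a i) * b j) * (expo (m j - k i) t * g t (q j) (p i)) := by
    intro i j
    funext t
    rw [map_mul, conj_expo, sub_eq_add_neg, expo_add]
    ring
  have hint : ∀ i j, Integrable (fun t => b j * expo (m j) t * conj (a i * expo (k i) t) *
      g t (q j) (p i)) freqMeasure := by
    intro i j
    rw [hterm]
    exact (integrable_expo_mul (hg.density.integrable _ _) _).const_mul _
  rw [integral_finsetSum _ fun i _ => integrable_finsetSum _ fun j _ => hint i j, sum_inner]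
  refine Finset.sum_congr rfl fun i _ => ?_
  rw [integral_finsetSum _ fun j _ => hint i j, inner_sum]
  refine Finset.sum_congr rfl fun j _ => ?_
  rw [inner_smul_left, inner_smul_right, inner_toL2 (hg.memLp _ _) (hg.memLp _ _), hg.cov, hterm,
    integral_const_mul, mul_assoc]

lemma memLp_increment_stationary (hg : IsStationarySpectralDensity P η g) (ν : Fin r → ℤ)
    (p : Fin T) (k : ℤ) :
    MemLp (gmIncrement d s ν (η p) k) 2 P ∧
      toL2 P (gmIncrement d s ν (η p) k) = ∑ l ∈ gmIndex d,
        gmWeight d l • toL2 P (η p (k - ∑ i, ν i * (s i : ℤ) * (l i : ℤ))) := by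
  rw [gmIncrement_eq_sum]
  exact ⟨memLp_sum_smul _ _ fun l _ => hg.memLp _ _, toL2_sum _ _ fun l _ => hg.memLp _ _⟩

lemma expo_mul_chi (ν : Fin r → ℤ) (k : ℤ) (t : ℝ) :
    expo k t * chi d s ν t =
      ∑ l ∈ gmIndex d, gmWeight d l * expo (k - ∑ i, ν i * (s i : ℤ) * (l i : ℤ)) t := by
  rw [chi_eq_sum, Finset.mul_sum]
  refine Finset.sum_congr rfl fun l _ => ?_
  rw [sub_eq_add_neg, expo_add]
  ring

lemma inner_increment_sum_stationary (hg : IsStationarySpectralDensity P η g) (ν : Fin r → ℤ)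
    (p : Fin T) (k : ℤ) {κ : Type*} (v : Finset κ) (b : κ → ℂ) (q : κ → Fin T) (m : κ → ℤ) :
    inner ℂ (toL2 P (gmIncrement d s ν (η p) k)) (∑ j ∈ v, b j • toL2 P (η (q j) (m j))) =
      ∫ t, ∑ j ∈ v, b j * expo (m j) t * conj (expo k t * chi d s ν t) * g t (q j) p
        ∂freqMeasure := by
  rw [(memLp_increment_stationary hg ν p k).2, inner_sum_stationary hg]
  congr 1
  funext t
  rw [Finset.sum_comm]
  refine Finset.sum_congr rfl fun j _ => ?_
  rw [expo_mul_chi, map_sum, Finset.mul_sum, Finset.sum_mul]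

lemma inner_increments_stationary (hg : IsStationarySpectralDensity P η g) (ν₁ ν₂ : Fin r → ℤ)
    (p q : Fin T) (k m : ℤ) :
    inner ℂ (toL2 P (gmIncrement d s ν₁ (η p) k)) (toL2 P (gmIncrement d s ν₂ (η q) m)) =
      ∫ t, expo m t * chi d s ν₂ t * conj (expo k t * chi d s ν₁ t) * g t q p ∂freqMeasure := by
  rw [(memLp_increment_stationary hg ν₂ q m).2, inner_increment_sum_stationary hg ν₁ p k
    (gmIndex d) (gmWeight d) (fun _ => q)]
  congr 1
  funext t
  rw [expo_mul_chi ν₂, Finset.sum_mul, Finset.sum_mul]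

/-- The sequences `ξ` and `η` satisfy the orthogonality assumption of the model. -/
def IncrementsUncorrelated (P : Measure Ω) (d s : Fin r → ℕ) (ξ η : Fin T → ℤ → Ω → ℂ) : Prop :=
  ∀ ν, AdmissibleStep ν → ∀ p q m k,
    ∫ ω, gmIncrement d s ν (ξ p) m ω * conj (η q k ω) ∂P = 0

lemma inner_stationary_increment_eq_zero (hf : IsGMSpectralDensity P d s ξ f)
    (hg : IsStationarySpectralDensity P η g) (hu : IncrementsUncorrelated P d s ξ η)
    {ν : Fin r → ℤ} (hν : AdmissibleStep ν) (p q : Fin T) (k m : ℤ) :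
    inner ℂ (toL2 P (η q m)) (toL2 P (gmIncrement d s ν (ξ p) k)) = 0 := by
  rw [inner_toL2 (hg.memLp _ _) (hf.memLp ν hν p k)]
  exact hu ν hν p q k m

variable {ζ : Fin T → ℤ → Ω → ℂ}

lemma memLp_increment_observed (hf : IsGMSpectralDensity P d s ξ f)
    (hg : IsStationarySpectralDensity P η g) (hζ : ∀ p m ω, ζ p m ω = ξ p m ω + η p m ω)
    {ν : Fin r → ℤ} (hν : AdmissibleStep ν) (p : Fin T) (k : ℤ) :
    MemLp (gmIncrement d s ν (ζ p) k) 2 P ∧ toL2 P (gmIncrement d s ν (ζ p) k) =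
      toL2 P (gmIncrement d s ν (ξ p) k) + toL2 P (gmIncrement d s ν (η p) k) := by
  have e : ζ p = fun m ω => ξ p m ω + η p m ω := by
    funext m ω
    exact hζ p m ω
  have h1 := (memLp_increment_stationary (d := d) (s := s) hg ν p k).1
  rw [e, gmIncrement_add]
  exact ⟨(hf.memLp ν hν p k).add h1, toL2_add (hf.memLp ν hν p k) h1⟩

/-- The observed increments are correlated with `η` only through the increments of `η`. -/
lemma inner_increment_observed_sum (hf : IsGMSpectralDensity P d s ξ f)
    (hg : IsStationarySpectralDensity P η g) (hu : IncrementsUncorrelated P d s ξ η)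
    (hζ : ∀ p m ω, ζ p m ω = ξ p m ω + η p m ω)
    {ν : Fin r → ℤ} (hν : AdmissibleStep ν) (p : Fin T) (k : ℤ)
    {κ : Type*} (v : Finset κ) (b : κ → ℂ) (q : κ → Fin T) (m : κ → ℤ) :
    inner ℂ (toL2 P (gmIncrement d s ν (ζ p) k)) (∑ j ∈ v, b j • toL2 P (η (q j) (m j))) =
      ∫ t, ∑ j ∈ v, b j * expo (m j) t * conj (expo k t * chi d s ν t) * g t (q j) p
        ∂freqMeasure := by
  rw [(memLp_increment_observed hf hg hζ hν p k).2, inner_add_left,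
    inner_increment_sum_stationary hg, inner_sum]
  rw [Finset.sum_eq_zero, zero_add]
  intro j _
  rw [inner_smul_right, ← inner_conj_symm,
    inner_stationary_increment_eq_zero hf hg hu hν, map_zero, mul_zero]

end Moments

/-! ### The spectral isometry -/

section Weights

variable {T r : ℕ} {d s : Fin r → ℕ} {f g : ℝ → Matrix (Fin T) (Fin T) ℂ}

lemma exists_norm_beta_le (d s : Fin r → ℕ) :
    ∃ C : ℝ, ∀ᵐ t ∂freqMeasure, ‖beta d s t‖ ≤ C := by
  obtain ⟨C, hC⟩ := (isCompact_Icc (a := -Real.pi) (b := Real.pi)).exists_bound_of_continuousOn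
    (continuous_beta d s).continuousOn
  refine ⟨C, ?_⟩
  filter_upwards [ae_mem_Ico] with t ht
  exact hC t (Set.Ico_subset_Icc_self ht)

lemma integrable_obsDensity (hf : IsMatrixDensity f) (hg : IsMatrixDensity g) (p q : Fin T) :
    Integrable (fun t => obsDensity d s f g t p q) freqMeasure := by
  obtain ⟨C, hC⟩ := exists_norm_beta_le d s
  have h : (fun t => obsDensity d s f g t p q) =
      fun t => f t p q + ((‖beta d s t‖ ^ 2 : ℝ) : ℂ) * g t p q := by
    funext t
    simp [obsDensity]
  rw [h]
  refine (hf.integrable p q).add ((hg.integrable p q).bdd_mul (c := C ^ 2) ?_ ?_)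
  · have := continuous_beta d s
    exact Continuous.aestronglyMeasurable (by fun_prop)
  · filter_upwards [hC] with t ht
    rw [Complex.norm_real, norm_pow, norm_norm]
    gcongr

lemma posSemidef_obsDensity (hf : IsMatrixDensity f) (hg : IsMatrixDensity g) :
    ∀ᵐ t ∂freqMeasure, (obsDensity d s f g t).PosSemidef := by
  filter_upwards [hf.posSemidef, hg.posSemidef] with t h1 h2
  exact posSemidef_obs h1 h2 (by positivity)

/-- The function `e^{ikλ} (χ_ν(e^{-iλ}) / β(λ)) e_p`, which corresponds to the increment
`χ_ν ζ_p(k)`. -/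
noncomputable def specIncrement (d s : Fin r → ℕ) (ν : Fin r → ℤ) (p : Fin T) (k : ℤ) (t : ℝ) :
    Fin T → ℂ :=
  Pi.single p (expo k t * (chi d s ν t / beta d s t))

variable {S : ℝ → Matrix (Fin T) (Fin T) ℂ}

lemma memWeighted_specIncrement (hs : ∀ i, 0 < s i) (hf : IsMatrixDensity f)
    (hg : IsMatrixDensity g) (hS : IsFactor (obsDensity d s f g) S) (ν : Fin r → ℤ) (p : Fin T)
    (k : ℤ) : MemWeighted S (specIncrement d s ν p k) := by
  obtain ⟨C, hC⟩ := exists_norm_chi_div_beta_le d s hs ν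
  have hm : Measurable fun t => expo k t * (chi d s ν t / beta d s t) :=
    (continuous_expo k).measurable.mul
      ((continuous_chi d s ν).measurable.div (continuous_beta d s).measurable)
  refine memWeighted_single hS hm.aemeasurable p ?_
  refine (integrable_obsDensity hf hg p p).bdd_mul (c := C ^ 2) ?_
    (Filter.Eventually.of_forall fun t => ?_)
  · exact (Complex.measurable_ofReal.comp (hm.norm.pow_const 2)).aestronglyMeasurable
  · rw [Complex.norm_real, norm_pow, norm_norm, norm_mul, norm_expo, one_mul]
    have := hC t
    gcongr

lemma admissibleStep_intStep {μ : Fin r → ℕ} (hμ : ∀ i, 0 < μ i) : AdmissibleStep (intStep μ) :=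
  Or.inl fun i => by simpa [intStep] using hμ i

/-- The functions that correspond to the increments with step `μ` are total. -/
lemma dense_span_specIncrement (hs : ∀ i, 0 < s i) {μ : Fin r → ℕ} (hμ : ∀ i, 0 < μ i)
    (hf : IsMatrixDensity f) (hg : IsMatrixDensity g)
    (hdet : ∀ᵐ t ∂freqMeasure, IsUnit (obsDensity d s f g t).det)
    (hS : IsFactor (obsDensity d s f g) S) :
    Dense (Submodule.span ℂ (Set.range fun kp : ℤ × Fin T =>
      toWeighted S (specIncrement d s (intStep μ) kp.2 kp.1)) :
        Set (Lp (EuclideanSpace ℂ (Fin T)) 2 freqMeasure)) := by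
  have h0 : ∀ p : Fin T, MemWeighted S (fun t =>
      Pi.single p (chi d s (intStep μ) t / beta d s t)) := fun p => by
    have := memWeighted_specIncrement hs hf hg hS (intStep μ) p 0
    unfold specIncrement at this
    simpa using this
  refine dense_span_toWeighted hS hdet expo (fun t => chi d s (intStep μ) t / beta d s t) ?_
    h0 (fun k p => memWeighted_specIncrement hs hf hg hS (intStep μ) p k)
    fun F hF h => ae_eq_zero_of_fourier hF h
  filter_upwards [ae_chi_ne_zero d s (intStep μ) hs fun i => by
    simpa [intStep] using (hμ i).ne', ae_beta_ne_zero d s] with t h1 h2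
  exact div_ne_zero h1 h2

variable {Ω : Type*} [MeasurableSpace Ω] {P : Measure Ω} {ξ η ζ : Fin T → ℤ → Ω → ℂ}

/-- The increments of `ζ` and their spectral functions have the same Gram matrix. -/
lemma inner_increments_observed (hs : ∀ i, 0 < s i) (hf : IsGMSpectralDensity P d s ξ f)
    (hg : IsStationarySpectralDensity P η g) (hu : IncrementsUncorrelated P d s ξ η)
    (hζ : ∀ p m ω, ζ p m ω = ξ p m ω + η p m ω) (hS : IsFactor (obsDensity d s f g) S)
    {ν₁ ν₂ : Fin r → ℤ} (hν₁ : AdmissibleStep ν₁) (hν₂ : AdmissibleStep ν₂)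
    (p q : Fin T) (k m : ℤ) :
    inner ℂ (toL2 P (gmIncrement d s ν₁ (ζ p) k)) (toL2 P (gmIncrement d s ν₂ (ζ q) m)) =
      inner ℂ (toWeighted S (specIncrement d s ν₁ p k))
        (toWeighted S (specIncrement d s ν₂ q m)) := by
  have hx : ∀ {ν ν' : Fin r → ℤ}, AdmissibleStep ν → ∀ p q k m,
      inner ℂ (toL2 P (gmIncrement d s ν' (η q) m)) (toL2 P (gmIncrement d s ν (ξ p) k)) = 0 := by
    intro ν ν' hν p q k m
    rw [(memLp_increment_stationary hg ν' q m).2, sum_inner]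
    refine Finset.sum_eq_zero fun l _ => ?_
    rw [inner_smul_left, inner_stationary_increment_eq_zero hf hg hu hν, mul_zero]
  rw [(memLp_increment_observed hf hg hζ hν₁ p k).2, (memLp_increment_observed hf hg hζ hν₂ q m).2,
    inner_add_left, inner_add_right, inner_add_right, hx hν₂, zero_add,
    ← inner_conj_symm (toL2 P (gmIncrement d s ν₁ (ξ p) k)) (toL2 P (gmIncrement d s ν₂ (η q) m)),
    hx hν₁, map_zero, add_zero, inner_toL2 (hf.memLp ν₁ hν₁ p k) (hf.memLp ν₂ hν₂ q m),
    hf.structural ν₂ ν₁ hν₂ hν₁, inner_increments_stationary hg,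
    inner_toWeighted hS (memWeighted_specIncrement hs hf.density hg.density hS ν₁ p k)
      (memWeighted_specIncrement hs hf.density hg.density hS ν₂ q m)]
  have hgint : Integrable (fun t => expo m t * chi d s ν₂ t * conj (expo k t * chi d s ν₁ t) *
      g t q p) freqMeasure := by
    have hc : Continuous fun t => expo m t * chi d s ν₂ t * conj (expo k t * chi d s ν₁ t) := by
      have h1 := continuous_expo
      have h2 := continuous_chi d s
      exact ((h1 m).mul (h2 ν₂)).mul (Complex.continuous_conj.comp ((h1 k).mul (h2 ν₁)))
    obtain ⟨C, hC⟩ := (isCompact_Icc (a := -Real.pi) (b := Real.pi)).exists_bound_of_continuousOn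
      hc.continuousOn
    refine (hg.density.integrable q p).bdd_mul (c := C) hc.aestronglyMeasurable ?_
    filter_upwards [ae_mem_Ico] with t ht
    exact hC t (Set.Ico_subset_Icc_self ht)
  have hpt : ∀ᵐ t ∂freqMeasure,
      (specIncrement d s ν₂ q m t ᵥ* obsDensity d s f g t) ⬝ᵥ star (specIncrement d s ν₁ p k t) =
      expo (m - k) t * chi d s ν₂ t * conj (chi d s ν₁ t) / ((‖beta d s t‖ ^ 2 : ℝ) : ℂ) * f t q p +
        expo m t * chi d s ν₂ t * conj (expo k t * chi d s ν₁ t) * g t q p := by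
    filter_upwards [ae_beta_ne_zero d s] with t ht
    have hb : conj (beta d s t) ≠ 0 := by simpa using ht
    have hnb : ((‖beta d s t‖ ^ 2 : ℝ) : ℂ) = beta d s t * conj (beta d s t) := by
      rw [Complex.mul_conj, Complex.normSq_eq_norm_sq]
    rw [specIncrement, specIncrement, ← Pi.single_star, dotProduct_single,
      Matrix.single_vecMul, sub_eq_add_neg, expo_add, ← conj_expo]
    simp only [Pi.smul_apply, Matrix.row, smul_eq_mul, obsDensity, Matrix.add_apply,
      Matrix.smul_apply, Complex.star_def, map_mul, map_div₀]
    rw [hnb]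
    field_simp
  have hfint : Integrable (fun t => expo (m - k) t * chi d s ν₂ t * conj (chi d s ν₁ t) /
      ((‖beta d s t‖ ^ 2 : ℝ) : ℂ) * f t q p) freqMeasure := by
    refine ((integrable_inner_weighted hS
      (memWeighted_specIncrement hs hf.density hg.density hS ν₁ p k)
      (memWeighted_specIncrement hs hf.density hg.density hS ν₂ q m)).sub hgint).congr ?_
    filter_upwards [hpt] with t ht
    rw [Pi.sub_apply, ht, add_sub_cancel_right]
  rw [integral_congr_ae hpt, integral_add hfint hgint]

/-- The isometry `V` maps the spectral function of each increment of `ζ` to that increment. -/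
def MapsToGMIncrements (P : Measure Ω) (d s : Fin r → ℕ) (ζ : Fin T → ℤ → Ω → ℂ)
    (S : ℝ → Matrix (Fin T) (Fin T) ℂ)
    (V : Lp (EuclideanSpace ℂ (Fin T)) 2 freqMeasure →ₗᵢ[ℂ] Lp ℂ 2 P) : Prop :=
  ∀ ν, AdmissibleStep ν → ∀ p k,
    V (toWeighted S (specIncrement d s ν p k)) = toL2 P (gmIncrement d s ν (ζ p) k)

/-- The spectral isometry exists.  One isometry serves all steps `ν` at once, since the Gram
matrices agree for any two steps and the functions with step `μ` are already total. -/
lemma exists_mapsToGMIncrements (hs : ∀ i, 0 < s i) {μ : Fin r → ℕ} (hμ : ∀ i, 0 < μ i)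
    (hf : IsGMSpectralDensity P d s ξ f)
    (hg : IsStationarySpectralDensity P η g) (hu : IncrementsUncorrelated P d s ξ η)
    (hζ : ∀ p m ω, ζ p m ω = ξ p m ω + η p m ω)
    (hdet : ∀ᵐ t ∂freqMeasure, IsUnit (obsDensity d s f g t).det)
    (hS : IsFactor (obsDensity d s f g) S) : ∃ V, MapsToGMIncrements P d s ζ S V := by
  obtain ⟨V, hV⟩ := exists_linearIsometry_of_gram
    (fun i : {ν : Fin r → ℤ // AdmissibleStep ν} × Fin T × ℤ =>
      toWeighted S (specIncrement d s i.1.1 i.2.1 i.2.2))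
    (fun i => toL2 P (gmIncrement d s i.1.1 (ζ i.2.1) i.2.2))
    (fun i j => inner_increments_observed hs hf hg hu hζ hS i.1.2 j.1.2 _ _ _ _)
    ((dense_span_specIncrement hs hμ hf.density hg.density hdet hS).mono
      (Submodule.span_mono (by
        rintro _ ⟨kp, rfl⟩
        exact ⟨(⟨intStep μ, admissibleStep_intStep hμ⟩, kp.2, kp.1), rfl⟩)))
  exact ⟨V, fun ν hν p k => hV (⟨ν, hν⟩, p, k)⟩

/-- The image of the spectral isometry consists of centred random variables. -/
lemma integral_eq_zero_of_mapsToGMIncrements [IsProbabilityMeasure P] (hs : ∀ i, 0 < s i)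
    {μ : Fin r → ℕ} (hμ : ∀ i, 0 < μ i) (hf : IsGMSpectralDensity P d s ξ f)
    (hg : IsStationarySpectralDensity P η g)
    (hζ : ∀ p m ω, ζ p m ω = ξ p m ω + η p m ω)
    (hdet : ∀ᵐ t ∂freqMeasure, IsUnit (obsDensity d s f g t).det)
    (hS : IsFactor (obsDensity d s f g) S)
    (hmean : ∀ ν, AdmissibleStep ν → ∀ p k, ∫ ω, gmIncrement d s ν (ζ p) k ω ∂P = 0)
    {V : Lp (EuclideanSpace ℂ (Fin T)) 2 freqMeasure →ₗᵢ[ℂ] Lp ℂ 2 P}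
    (hV : MapsToGMIncrements P d s ζ S V) (u : Lp (EuclideanSpace ℂ (Fin T)) 2 freqMeasure) :
    ∫ ω, V u ω ∂P = 0 := by
  have h1 : MemLp (fun _ : Ω => (1 : ℂ)) 2 P := memLp_const 1
  have h2 : ∀ v : Lp ℂ 2 P, ∫ ω, v ω ∂P = inner ℂ (toL2 P fun _ => 1) v := fun v => by
    rw [inner_L2 _ _ (toL2_coe h1) (ae_eq_refl v)]
    simp
  rw [h2]
  have hd := dense_span_specIncrement hs hμ hf.density hg.density hdet hS
  refine hd.induction (P := fun u => inner ℂ (toL2 P fun _ => 1) (V u) = 0) ?_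
    (isClosed_eq (by fun_prop) continuous_const) u
  intro u hu
  induction hu using Submodule.span_induction with
  | mem x hx =>
    obtain ⟨⟨k, p⟩, rfl⟩ := hx
    have hν := admissibleStep_intStep hμ
    rw [hV _ hν, ← h2, ← hmean _ hν p k]
    exact integral_congr_ae (toL2_coe (memLp_increment_observed hf hg hζ hν p k).1)
  | zero => simp
  | add x y _ _ hx hy => rw [map_add, inner_add_right, hx, hy, add_zero]
  | smul c x _ hx => rw [map_smul, inner_smul_right, hx, mul_zero]

/-- The spectral process of `ζ` consists of the images of the functions `1_{[-π, x)} e_p`. -/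
lemma exists_isSpectralProcess [IsProbabilityMeasure P] (hs : ∀ i, 0 < s i)
    {μ : Fin r → ℕ} (hμ : ∀ i, 0 < μ i) (hf : IsGMSpectralDensity P d s ξ f)
    (hg : IsStationarySpectralDensity P η g)
    (hζ : ∀ p m ω, ζ p m ω = ξ p m ω + η p m ω)
    (hdet : ∀ᵐ t ∂freqMeasure, IsUnit (obsDensity d s f g t).det)
    (hS : IsFactor (obsDensity d s f g) S)
    (hmean : ∀ ν, AdmissibleStep ν → ∀ p k, ∫ ω, gmIncrement d s ν (ζ p) k ω ∂P = 0)
    {V : Lp (EuclideanSpace ℂ (Fin T)) 2 freqMeasure →ₗᵢ[ℂ] Lp ℂ 2 P}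
    (hV : MapsToGMIncrements P d s ζ S V) :
    ∃ Z, IsSpectralProcess P d s ζ (obsDensity d s f g) Z := by
  have hw := integrable_obsDensity (d := d) (s := s) hf.density hg.density
  set Z : Fin T → ℝ → Ω → ℂ := fun p x => V (toWeighted S (indicatorVec (-Real.pi) x p)) with hZ
  have hinc : MapsToIncrements S V Z := by
    intro p x y hx hxy _
    rw [indicatorVec_sub hx hxy, ((memWeighted_indicatorVec hS hw _ _ p).sub
      (memWeighted_indicatorVec hS hw _ _ p)).2, map_sub]
    exact Lp.coeFn_sub _ _
  have hcov : ∀ p q x y x' y', -Real.pi ≤ x → x < y → y < Real.pi →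
      -Real.pi ≤ x' → x' < y' → y' < Real.pi →
      ∫ ω, (Z p y ω - Z p x ω) * conj (Z q y' ω - Z q x' ω) ∂P =
        ∫ t in Set.Ico x' y' ∩ Set.Ico x y, obsDensity d s f g t p q ∂freqMeasure := by
    intro p q x y x' y' hx hxy hy hx' hxy' hy'
    rw [← inner_indicatorVec hS hw, ← V.inner_map_map]
    exact (inner_L2 _ _ (hinc q x' y' hx' hxy'.le hy') (hinc p x y hx hxy.le hy)).symm
  refine ⟨Z, fun p x _ => Lp.memLp _, fun p x y hx hxy hy => ?_, fun p q x y hx hxy hy => ?_,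
    fun p q x y x' y' hx hxy hyx' hxy' hy' => ?_, fun ν hν p k => ?_⟩
  · rw [← integral_eq_zero_of_mapsToGMIncrements hs hμ hf hg hζ hdet hS hmean hV
      (toWeighted S (indicatorVec x y p))]
    exact (integral_congr_ae (hinc p x y hx hxy.le hy)).symm
  · rw [hcov p q x y x y hx hxy hy hx hxy hy, Set.inter_self]
  · have he : Set.Ico x' y' ∩ Set.Ico x y = ∅ := by
      ext t
      simp only [Set.mem_inter_iff, Set.mem_Ico, Set.mem_empty_iff_false, iff_false]
      rintro ⟨⟨h1, _⟩, _, h2⟩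
      linarith
    rw [hcov p q x y x' y' hx hxy (by linarith) (by linarith) hxy' hy', he]
    simp
  · have := (isStochasticIntegral_iff hS hw hdet hinc
      (memWeighted_specIncrement hs hf.density hg.density hS ν p k)
      (gmIncrement d s ν (ζ p) k)).2 ?_
    · exact this
    · rw [hV ν hν]
      exact (toL2_coe (memLp_increment_observed hf hg hζ hν p k).1).symm

/-- Stochastic integration with respect to any spectral process of `ζ` is an isometry that maps
the spectral functions of the increments of `ζ` to these increments. -/
lemma exists_isometry_of_isSpectralProcess (hs : ∀ i, 0 < s i)
    (hf : IsGMSpectralDensity P d s ξ f) (hg : IsStationarySpectralDensity P η g)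
    (hζ : ∀ p m ω, ζ p m ω = ξ p m ω + η p m ω)
    (hdet : ∀ᵐ t ∂freqMeasure, IsUnit (obsDensity d s f g t).det)
    (hS : IsFactor (obsDensity d s f g) S) {Z : Fin T → ℝ → Ω → ℂ}
    (hZ : IsSpectralProcess P d s ζ (obsDensity d s f g) Z) :
    ∃ V, MapsToIncrements S V Z ∧ MapsToGMIncrements P d s ζ S V := by
  have hw := integrable_obsDensity (d := d) (s := s) hf.density hg.density
  have hpi : -Real.pi ∈ Set.Ico (-Real.pi) Real.pi := ⟨le_rfl, by linarith [Real.pi_pos]⟩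
  set F : Set.Ico (-Real.pi) Real.pi × Fin T → Ω → ℂ := fun xp =>
    Z xp.2 xp.1 - Z xp.2 (-Real.pi) with hF
  have hFm : ∀ xp, MemLp (F xp) 2 P := fun xp => (hZ.memLp _ _ xp.1.2).sub (hZ.memLp _ _ hpi)
  have hZm : ∀ p x y, x ∈ Set.Ico (-Real.pi) Real.pi → y ∈ Set.Ico (-Real.pi) Real.pi →
      MemLp (fun ω => Z p y ω - Z p x ω) 2 P := fun p x y hx hy =>
    (hZ.memLp p y hy).sub (hZ.memLp p x hx)
  -- increments over `[-π, x)` and `[x, y)` are orthogonal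
  have horth : ∀ p q (x y : Set.Ico (-Real.pi) Real.pi), (x : ℝ) < y →
      inner ℂ (toL2 P fun ω => Z q y ω - Z q x ω) (toL2 P (F (x, p))) = 0 := by
    intro p q x y hxy
    rw [inner_toL2 (hZm q x y x.2 y.2) (hFm _)]
    rcases x.2.1.eq_or_lt with h0 | h0
    · simp [hF, ← h0]
    · exact hZ.uncorrelated p q _ _ _ _ le_rfl h0 le_rfl hxy y.2.2
  have hsame : ∀ p q (x : Set.Ico (-Real.pi) Real.pi),
      inner ℂ (toL2 P (F (x, q))) (toL2 P (F (x, p))) =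
        ∫ t in Set.Ico (-Real.pi) (x : ℝ), obsDensity d s f g t p q ∂freqMeasure := by
    intro p q x
    rw [inner_toL2 (hFm _) (hFm _)]
    rcases x.2.1.eq_or_lt with h0 | h0
    · simp [hF, ← h0]
    · exact hZ.structural p q _ _ le_rfl h0 x.2.2
  have hsplit : ∀ q (x y : Set.Ico (-Real.pi) Real.pi), toL2 P (F (y, q)) =
      toL2 P (F (x, q)) + toL2 P fun ω => Z q y ω - Z q x ω := by
    intro q x y
    rw [← toL2_add (hFm _) (hZm q x y x.2 y.2)]
    congr 1
    funext ω
    simp [hF]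
  obtain ⟨V, hV⟩ := exists_linearIsometry_of_gram
    (fun xp : Set.Ico (-Real.pi) Real.pi × Fin T =>
      toWeighted S (indicatorVec (-Real.pi) (xp.1 : ℝ) xp.2))
    (fun xp => toL2 P (F xp)) (by
      rintro ⟨x, q⟩ ⟨y, p⟩
      rw [inner_indicatorVec hS hw, Set.Ico_inter_Ico, max_self]
      rcases lt_trichotomy (x : ℝ) y with h | h | h
      · rw [min_eq_left h.le, hsplit p x y, inner_add_right, hsame,
          ← inner_conj_symm _ (toL2 P fun ω => Z p y ω - Z p x ω), horth q p x y h, map_zero,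
          add_zero]
      · obtain rfl := Subtype.ext h
        rw [min_self, hsame]
      · rw [min_eq_right h.le, hsplit q y x, inner_add_left, hsame, horth p q y x h, add_zero])
    (dense_span_indicatorVec hS hw hdet)
  have hinc : MapsToIncrements S V Z := by
    intro p x y hx hxy hy
    have hx' : x ∈ Set.Ico (-Real.pi) Real.pi := ⟨hx, by linarith⟩
    have hy' : y ∈ Set.Ico (-Real.pi) Real.pi := ⟨by linarith, hy⟩
    rw [indicatorVec_sub hx hxy, ((memWeighted_indicatorVec hS hw _ _ p).sub
      (memWeighted_indicatorVec hS hw _ _ p)).2, map_sub, hV (⟨y, hy'⟩, p), hV (⟨x, hx'⟩, p),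
      hsplit p ⟨x, hx'⟩ ⟨y, hy'⟩, add_sub_cancel_left]
    exact toL2_coe (hZm p x y hx' hy')
  refine ⟨V, hinc, fun ν hν p k => ?_⟩
  have := (isStochasticIntegral_iff hS hw hdet hinc
      (memWeighted_specIncrement hs hf.density hg.density hS ν p k)
      (gmIncrement d s ν (ζ p) k)).1 (hZ.representation ν hν p k)
  exact ((toL2_eq_iff (memLp_increment_observed hf hg hζ hν p k).1 _).2 this).symm

end Weights

/-! ### Fourier blocks -/

section Blocks

variable {T : ℕ}

/-- The vector trigonometric polynomial with coefficients stacked in `c`. -/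
noncomputable def blockPoly {L : ℕ} (c : Fin L × Fin T → ℂ) (t : ℝ) : Fin T → ℂ :=
  fun p => ∑ k : Fin L, c (k, p) * expo ((k : ℕ) : ℤ) t

lemma sum_stack {E : Type*} [AddCommGroup E] [Module ℂ E] {N L : ℕ} (hL : N < L)
    (x : ℕ → Fin T → ℂ) (F : ℕ → Fin T → E) :
    ∑ kp : Fin L × Fin T, stack N L x kp • F kp.1 kp.2 =
      ∑ k ∈ Finset.range (N + 1), ∑ p, x k p • F k p := by
  rw [← Finset.univ_product_univ, Finset.sum_product]
  simp only [stack]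
  rw [Finset.sum_fin_eq_sum_range (fun k : Fin L =>
    ∑ p, (if (k : ℕ) ≤ N then x k p else 0) • F k p)]
  symm
  refine Finset.sum_subset_zero_on_sdiff (Finset.range_subset_range.2 hL) ?_ ?_
  · intro k hk
    simp only [Finset.mem_sdiff, Finset.mem_range] at hk
    rw [dif_pos hk.1]
    simp [show ¬ k ≤ N by omega]
  · intro k hk
    rw [Finset.mem_range] at hk
    rw [dif_pos (by omega)]
    simp [show k ≤ N by omega]

lemma blockPoly_stack {N L : ℕ} (hL : N < L) (x : ℕ → Fin T → ℂ) :
    blockPoly (stack N L x) = trigPoly N x := by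
  funext t p
  have := sum_stack hL x (fun k q => if q = p then expo k t else 0)
  rw [← Finset.univ_product_univ, Finset.sum_product] at this
  simpa [blockPoly, trigPoly] using this

variable {L : ℕ} {K : ℝ → Matrix (Fin T) (Fin T) ℂ}

lemma integrable_blockPoly_vecMul (hK : ∀ p q, Integrable (fun t => K t p q) freqMeasure)
    (c : Fin L × Fin T → ℂ) (j : ℤ) (p : Fin T) :
    Integrable (fun t => expo (-j) t * (blockPoly c t ᵥ* K t) p) freqMeasure ∧
      ∫ t, expo (-j) t * (blockPoly c t ᵥ* K t) p ∂freqMeasure =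
        ∑ kq : Fin L × Fin T,
          (∫ t, expo (((kq.1 : ℕ) : ℤ) - j) t * K t kq.2 p ∂freqMeasure) * c kq := by
  have e : (fun t => expo (-j) t * (blockPoly c t ᵥ* K t) p) =
      fun t => ∑ kq : Fin L × Fin T, (expo (((kq.1 : ℕ) : ℤ) - j) t * K t kq.2 p) * c kq := by
    funext t
    rw [← Finset.univ_product_univ, Finset.sum_product_right]
    simp only [Matrix.vecMul, dotProduct, blockPoly, Finset.sum_mul, Finset.mul_sum]
    refine Finset.sum_congr rfl fun q _ => Finset.sum_congr rfl fun k _ => ?_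
    rw [sub_eq_add_neg, expo_add]
    ring
  have hi : ∀ kq : Fin L × Fin T, Integrable
      (fun t => (expo (((kq.1 : ℕ) : ℤ) - j) t * K t kq.2 p) * c kq) freqMeasure := fun kq =>
    (integrable_expo_mul (hK _ _) _).mul_const _
  rw [e]
  refine ⟨integrable_finsetSum _ fun kq _ => hi kq, ?_⟩
  rw [integral_finsetSum _ fun kq _ => hi kq]
  exact Finset.sum_congr rfl fun kq _ => integral_mul_const _ _

lemma fourierBlockMatrix_mulVec (hK : ∀ p q, Integrable (fun t => K t p q) freqMeasure)
    (c : Fin L × Fin T → ℂ) (jp : Fin L × Fin T) :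
    (fourierBlockMatrix L K *ᵥ c) jp =
      ∫ t, expo (-((jp.1 : ℕ) : ℤ)) t * (blockPoly c t ᵥ* K t) jp.2 ∂freqMeasure := by
  rw [(integrable_blockPoly_vecMul hK c _ _).2]
  rfl

/-- The quadratic form of a Fourier block matrix. -/
lemma fourierBlockMatrix_quadratic (hK : ∀ p q, Integrable (fun t => K t p q) freqMeasure)
    (c : Fin L × Fin T → ℂ) :
    Integrable (fun t => hermForm (K t) (blockPoly c t)) freqMeasure ∧
      (fourierBlockMatrix L K *ᵥ c) ⬝ᵥ star c =
        ∫ t, hermForm (K t) (blockPoly c t) ∂freqMeasure := by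
  have e : (fun t => hermForm (K t) (blockPoly c t)) =
      fun t => ∑ jp : Fin L × Fin T,
        (expo (-((jp.1 : ℕ) : ℤ)) t * (blockPoly c t ᵥ* K t) jp.2) * conj (c jp) := by
    funext t
    rw [← Finset.univ_product_univ, Finset.sum_product_right, hermForm, dotProduct]
    refine Finset.sum_congr rfl fun p _ => ?_
    rw [Pi.star_apply, Complex.star_def, blockPoly, map_sum, Finset.mul_sum]
    refine Finset.sum_congr rfl fun k _ => ?_
    rw [map_mul, conj_expo]
    ring
  have hi : ∀ jp : Fin L × Fin T, Integrable (fun t =>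
      (expo (-((jp.1 : ℕ) : ℤ)) t * (blockPoly c t ᵥ* K t) jp.2) * conj (c jp)) freqMeasure :=
    fun jp => (integrable_blockPoly_vecMul hK c _ _).1.mul_const _
  rw [e]
  refine ⟨integrable_finsetSum _ fun jp _ => hi jp, ?_⟩
  rw [integral_finsetSum _ fun jp _ => hi jp, dotProduct]
  refine Finset.sum_congr rfl fun jp _ => ?_
  rw [integral_mul_const, fourierBlockMatrix_mulVec hK]
  rfl

lemma integral_expo (k : ℤ) : ∫ t, expo k t ∂freqMeasure = if k = 0 then 1 else 0 := by
  split_ifs with hk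
  · subst hk
    simpa using integral_freqMeasure_one
  · have h1 : ∫ t in Set.Ico (-Real.pi) Real.pi, expo k t = 0 := by
      rw [integral_Ico_eq_integral_Ioo, ← integral_Ioc_eq_integral_Ioo,
        ← intervalIntegral.integral_of_le (by linarith [Real.pi_pos])]
      have hc : Complex.I * (k : ℂ) ≠ 0 := mul_ne_zero Complex.I_ne_zero (by exact_mod_cast hk)
      have := integral_exp_mul_complex (a := -Real.pi) (b := Real.pi) hc
      simp only [expo]
      rw [this, div_eq_zero_iff]
      left
      rw [sub_eq_zero, Complex.exp_eq_exp_iff_exists_int]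
      refine ⟨k, ?_⟩
      push_cast
      ring
    rw [freqMeasure, integral_smul_measure, h1, smul_zero]

end Blocks

/-! ### The dual family -/

section Dual

variable {T r : ℕ} {d s μ : Fin r → ℕ} {f g : ℝ → Matrix (Fin T) (Fin T) ℂ}

lemma aemeasurable_mul {A B : ℝ → Matrix (Fin T) (Fin T) ℂ}
    (hA : ∀ p q, AEMeasurable (fun t => A t p q) freqMeasure)
    (hB : ∀ p q, AEMeasurable (fun t => B t p q) freqMeasure) (p q : Fin T) :
    AEMeasurable (fun t => (A t * B t) p q) freqMeasure := by
  simp only [Matrix.mul_apply]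
  exact Finset.aemeasurable_fun_sum _ fun k _ => (hA p k).mul (hB k q)

lemma aemeasurable_vecMul {x : ℝ → Fin T → ℂ} {B : ℝ → Matrix (Fin T) (Fin T) ℂ}
    (hx : ∀ p, AEMeasurable (fun t => x t p) freqMeasure)
    (hB : ∀ p q, AEMeasurable (fun t => B t p q) freqMeasure) (q : Fin T) :
    AEMeasurable (fun t => (x t ᵥ* B t) q) freqMeasure := by
  simp only [Matrix.vecMul, dotProduct]
  exact Finset.aemeasurable_fun_sum _ fun k _ => (hx k).mul (hB k q)

lemma aemeasurable_hermForm {x : ℝ → Fin T → ℂ} {B : ℝ → Matrix (Fin T) (Fin T) ℂ}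
    (hx : ∀ p, AEMeasurable (fun t => x t p) freqMeasure)
    (hB : ∀ p q, AEMeasurable (fun t => B t p q) freqMeasure) :
    AEMeasurable (fun t => hermForm (B t) (x t)) freqMeasure := by
  simp only [hermForm, dotProduct]
  exact Finset.aemeasurable_fun_sum _ fun k _ => (aemeasurable_vecMul hx hB k).mul
    (Complex.continuous_conj.measurable.comp_aemeasurable (hx k))

lemma aemeasurable_inv {A : ℝ → Matrix (Fin T) (Fin T) ℂ}
    (hA : ∀ p q, AEMeasurable (fun t => A t p q) freqMeasure) (p q : Fin T) :
    AEMeasurable (fun t => (A t)⁻¹ p q) freqMeasure := by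
  have hof : Continuous (Matrix.of : (Fin T → Fin T → ℂ) → Matrix (Fin T) (Fin T) ℂ) :=
    continuous_id
  have h1 : Measurable fun B : Fin T → Fin T → ℂ => (Matrix.of B)⁻¹ p q := by
    simp only [Matrix.inv_def, Ring.inverse_eq_inv', Matrix.smul_apply, smul_eq_mul]
    exact hof.matrix_det.measurable.inv.mul (hof.matrix_adjugate.matrix_elem p q).measurable
  exact h1.comp_aemeasurable (aemeasurable_pi_lambda _ fun p => aemeasurable_pi_lambda _ fun q =>
    hA p q)

lemma vecMul_dotProduct_star_inv {W : Matrix (Fin T) (Fin T) ℂ} (hW : W.IsHermitian)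
    (hdet : IsUnit W.det) (x y : Fin T → ℂ) :
    (x ᵥ* W) ⬝ᵥ star (y ᵥ* W⁻¹) = x ⬝ᵥ star y := by
  rw [Matrix.star_vecMul, hW.inv.eq, ← Matrix.dotProduct_mulVec, Matrix.mulVec_mulVec,
    Matrix.mul_nonsing_inv _ hdet, Matrix.one_mulVec]

/-- The functions `e^{ikλ} (conj β / χ_μ(e^{iλ})) e_pᵀ w⁻¹`.  They are biorthogonal to the spectral
functions of the increments with step `μ`. -/
noncomputable def specDual (d s : Fin r → ℕ) (ν : Fin r → ℤ)
    (f g : ℝ → Matrix (Fin T) (Fin T) ℂ) (p : Fin T) (k : ℤ) (t : ℝ) : Fin T → ℂ :=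
  (conj (beta d s t) / conj (chi d s ν t) * expo k t) •
    (Pi.single p 1 ᵥ* (obsDensity d s f g t)⁻¹)

/-- The functions `e^{ikλ} conj β e_pᵀ g w⁻¹`, which correspond to the projections of the values
`η_p(k)` on the space of the increments of `ζ`. -/
noncomputable def specNoise (d s : Fin r → ℕ)
    (f g : ℝ → Matrix (Fin T) (Fin T) ℂ) (p : Fin T) (k : ℤ) (t : ℝ) : Fin T → ℂ :=
  (conj (beta d s t) * expo k t) • (Pi.single p 1 ᵥ* (g t * (obsDensity d s f g t)⁻¹))

/-- The assumptions on the orders, steps and densities that do not involve the random sequences: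
`f` and `g` are densities and the minimality condition holds for the step `μ`. -/
structure AdmissibleDensities (d s : Fin r → ℕ) (μ : Fin r → ℕ)
    (f g : ℝ → Matrix (Fin T) (Fin T) ℂ) : Prop where
  seasons_pos : ∀ i, 0 < s i
  step_pos : ∀ i, 0 < μ i
  signal : IsMatrixDensity f
  noise : IsMatrixDensity g
  minimality : MinimalityCondition d s (intStep μ) f g

variable {S : ℝ → Matrix (Fin T) (Fin T) ℂ}

lemma AdmissibleDensities.exists_isFactor (H : AdmissibleDensities d s μ f g) :
    ∃ S, IsFactor (obsDensity d s f g) S :=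
  GMInterp.exists_isFactor
    (fun p q => (integrable_obsDensity H.signal H.noise p q).aestronglyMeasurable.aemeasurable)
    (posSemidef_obsDensity H.signal H.noise)

lemma AdmissibleDensities.ae_regular (H : AdmissibleDensities d s μ f g) :
    ∀ᵐ t ∂freqMeasure, (f t).PosSemidef ∧ (g t).PosSemidef ∧ (obsDensity d s f g t).PosSemidef ∧
      IsUnit (obsDensity d s f g t).det ∧ chi d s (intStep μ) t ≠ 0 ∧ beta d s t ≠ 0 := by
  filter_upwards [H.signal.posSemidef, H.noise.posSemidef,
    posSemidef_obsDensity H.signal H.noise, H.minimality.isUnit_det,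
    ae_chi_ne_zero d s (intStep μ) H.seasons_pos fun i => by
      simpa [intStep] using (H.step_pos i).ne', ae_beta_ne_zero d s] with t h1 h2 h3 h4 h5 h6
  exact ⟨h1, h2, h3, h4, h5, h6⟩

lemma AdmissibleDensities.aemeasurable_inv_obs (H : AdmissibleDensities d s μ f g) (p q : Fin T) :
    AEMeasurable (fun t => (obsDensity d s f g t)⁻¹ p q) freqMeasure :=
  aemeasurable_inv (fun p q =>
    (integrable_obsDensity H.signal H.noise p q).aestronglyMeasurable.aemeasurable) p q

lemma AdmissibleDensities.memWeighted_specDual (H : AdmissibleDensities d s μ f g)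
    (hS : IsFactor (obsDensity d s f g) S) (p : Fin T) (k : ℤ) :
    MemWeighted S (specDual d s (intStep μ) f g p k) := by
  refine memWeighted_of_bound hS (fun q => ?_) H.minimality.integrable_trace.norm ?_
  · simp only [specDual, Pi.smul_apply, smul_eq_mul]
    have hc : Measurable fun t => conj (beta d s t) / conj (chi d s (intStep μ) t) * expo k t :=
      ((Complex.continuous_conj.comp (continuous_beta d s)).measurable.div
        (Complex.continuous_conj.comp (continuous_chi d s _)).measurable).mul
        (continuous_expo k).measurable
    have hv := aemeasurable_vecMul (x := fun _ => Pi.single p 1)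
      (fun _ => aemeasurable_const) H.aemeasurable_inv_obs q
    exact AEMeasurable.mul hc.aemeasurable hv
  · filter_upwards [H.ae_regular] with t ⟨_, _, hpos, hdet, _, _⟩
    have h1 : hermForm (obsDensity d s f g t) (specDual d s (intStep μ) f g p k t) =
        kernelP d s (intStep μ) f g t p p := by
      rw [specDual, hermForm_smul, hermForm_vecMul hpos.isHermitian.inv,
        Matrix.nonsing_inv_mul _ hdet, one_mul, hermForm_single, kernelP, Matrix.smul_apply,
        smul_eq_mul, norm_mul, norm_expo, mul_one, norm_div, RCLike.norm_conj, RCLike.norm_conj,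
        div_pow]
    have h2 : (kernelP d s (intStep μ) f g t).PosSemidef :=
      hpos.inv.smul (by
        have : (0 : ℝ) ≤ ‖beta d s t‖ ^ 2 / ‖chi d s (intStep μ) t‖ ^ 2 := by positivity
        exact_mod_cast this)
    have h3 : ((kernelP d s (intStep μ) f g t p p).re : ℂ) = kernelP d s (intStep μ) f g t p p := by
      rw [← hermForm_single (kernelP d s (intStep μ) f g t) p]
      exact ofReal_re_hermForm h2 _
    rw [h1, ← h3, Complex.norm_real, Real.norm_eq_abs, abs_of_nonneg (re_diag_nonneg h2 p)]
    exact (re_diag_le_re_trace h2 p).trans (Complex.re_le_norm _)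

lemma AdmissibleDensities.memWeighted_specNoise (H : AdmissibleDensities d s μ f g)
    (hS : IsFactor (obsDensity d s f g) S) (p : Fin T) (k : ℤ) :
    MemWeighted S (specNoise d s f g p k) := by
  refine memWeighted_of_bound hS (fun q => ?_) (H.noise.integrable p p).norm ?_
  · simp only [specNoise, Pi.smul_apply, smul_eq_mul]
    have hc : Measurable fun t => conj (beta d s t) * expo k t :=
      (Complex.continuous_conj.comp (continuous_beta d s)).measurable.mul
        (continuous_expo k).measurable
    have hv := aemeasurable_vecMul (x := fun _ => Pi.single p 1)
      (fun _ => aemeasurable_const) (aemeasurable_mul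
        (fun p q => (H.noise.integrable p q).aestronglyMeasurable.aemeasurable)
        H.aemeasurable_inv_obs) q
    exact AEMeasurable.mul hc.aemeasurable hv
  · filter_upwards [H.ae_regular] with t ⟨hf, hg, hpos, hdet, _, _⟩
    have h1 : hermForm (obsDensity d s f g t) (specNoise d s f g p k t) =
        ((‖beta d s t‖ ^ 2 : ℝ) : ℂ) * hermForm (g t * (obsDensity d s f g t)⁻¹ * g t)
          (Pi.single p 1) := by
      rw [specNoise, hermForm_smul, norm_mul, norm_expo, mul_one, RCLike.norm_conj,
        ← Matrix.vecMul_vecMul, hermForm_vecMul hpos.isHermitian.inv,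
        Matrix.nonsing_inv_mul _ hdet, one_mul, hermForm_vecMul hg.isHermitian]
    -- `g - |β|² g w⁻¹ g = f w⁻¹ g` is nonnegative definite, so the norm is bounded by `g p p`
    have h2 : hermForm (f t * (obsDensity d s f g t)⁻¹ * g t) (Pi.single p 1) =
        hermForm (g t) (Pi.single p 1) - hermForm (obsDensity d s f g t)
          (specNoise d s f g p k t) := by
      rw [h1, ← hermForm_smul_matrix, ← hermForm_sub_matrix]
      congr 1
      exact mul_inv_mul_eq_sub hdet
    have h3 : 0 ≤ (hermForm (f t * (obsDensity d s f g t)⁻¹ * g t) (Pi.single p 1)).re :=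
      (Complex.le_def.1 (hermForm_nonneg
        (posSemidef_mul_inv_mul hf hg (by positivity) hdet) _)).1
    have h4 : 0 ≤ (hermForm (obsDensity d s f g t) (specNoise d s f g p k t)).re :=
      (Complex.le_def.1 (hermForm_nonneg hpos _)).1
    rw [h2, Complex.sub_re, hermForm_single] at h3
    rw [← ofReal_re_hermForm hpos, Complex.norm_real, Real.norm_eq_abs, abs_of_nonneg h4]
    exact (sub_nonneg.1 h3).trans (Complex.re_le_norm _)

/-- Inner products with the dual family are Fourier coefficients. -/
lemma AdmissibleDensities.dotProduct_specDual (H : AdmissibleDensities d s μ f g)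
    (h : ℝ → Fin T → ℂ) (p : Fin T) (j : ℤ) :
    ∀ᵐ t ∂freqMeasure,
      (h t ᵥ* obsDensity d s f g t) ⬝ᵥ star (specDual d s (intStep μ) f g p j t) =
        expo (-j) t * (beta d s t / chi d s (intStep μ) t * h t p) := by
  filter_upwards [H.ae_regular] with t ⟨_, _, hpos, hdet, _, _⟩
  rw [specDual, star_smul, dotProduct_smul, vecMul_dotProduct_star_inv hpos.isHermitian hdet,
    ← Pi.single_star, dotProduct_single, star_one, mul_one, smul_eq_mul]
  simp only [Complex.star_def, map_mul, map_div₀, Complex.conj_conj, conj_expo]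
  ring

lemma AdmissibleDensities.inner_specDual (H : AdmissibleDensities d s μ f g)
    (hS : IsFactor (obsDensity d s f g) S) {h : ℝ → Fin T → ℂ} (hh : MemWeighted S h)
    (p : Fin T) (j : ℤ) {F : ℝ → ℂ}
    (hF : ∀ᵐ t ∂freqMeasure, expo (-j) t * (beta d s t / chi d s (intStep μ) t * h t p) = F t) :
    Integrable F freqMeasure ∧
      inner ℂ (toWeighted S (specDual d s (intStep μ) f g p j)) (toWeighted S h) =
        ∫ t, F t ∂freqMeasure := by
  have hD := H.memWeighted_specDual hS p j
  have e : (fun t => (h t ᵥ* obsDensity d s f g t) ⬝ᵥ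
      star (specDual d s (intStep μ) f g p j t)) =ᵐ[freqMeasure] F :=
    Filter.EventuallyEq.trans (H.dotProduct_specDual h p j) hF
  rw [inner_toWeighted hS hD hh]
  exact ⟨(integrable_inner_weighted hS hD hh).congr e, integral_congr_ae e⟩

end Dual

/-! ### The operators `P`, `T`, `Q` and the spectral characteristic -/

section Kernels

variable {T r : ℕ} {d s μ : Fin r → ℕ} {f g : ℝ → Matrix (Fin T) (Fin T) ℂ}
  {S : ℝ → Matrix (Fin T) (Fin T) ℂ}

lemma norm_sq_eq_mul_conj (z : ℂ) : ((‖z‖ ^ 2 : ℝ) : ℂ) = z * conj z := by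
  rw [Complex.mul_conj, Complex.normSq_eq_norm_sq]

/-- The dual family is biorthogonal to the spectral functions of the increments. -/
lemma AdmissibleDensities.inner_specDual_specIncrement (H : AdmissibleDensities d s μ f g)
    (hS : IsFactor (obsDensity d s f g) S) (p q : Fin T) (j k : ℤ) :
    inner ℂ (toWeighted S (specDual d s (intStep μ) f g p j))
      (toWeighted S (specIncrement d s (intStep μ) q k)) = if k = j ∧ q = p then 1 else 0 := by
  rw [(H.inner_specDual hS (memWeighted_specIncrement H.seasons_pos H.signal H.noise hS _ q k) p j
    (F := fun t => (if q = p then 1 else 0) * expo (k - j) t) ?_).2, integral_const_mul,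
    integral_expo]
  · by_cases h1 : q = p <;> by_cases h2 : k = j <;> simp [h1, h2, sub_eq_zero]
  · filter_upwards [H.ae_regular] with t ⟨_, _, _, _, hc, hb⟩
    rw [specIncrement, Pi.single_apply, sub_eq_add_neg, expo_add]
    by_cases h1 : p = q
    · subst h1
      simp only [if_true]
      field_simp
    · rw [if_neg h1, if_neg (Ne.symm h1)]
      simp

lemma AdmissibleDensities.inner_specDual_specDual (H : AdmissibleDensities d s μ f g)
    (hS : IsFactor (obsDensity d s f g) S) (p q : Fin T) (j k : ℤ) :
    Integrable (fun t => expo (k - j) t * kernelP d s (intStep μ) f g t q p) freqMeasure ∧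
    inner ℂ (toWeighted S (specDual d s (intStep μ) f g p j))
      (toWeighted S (specDual d s (intStep μ) f g q k)) =
        ∫ t, expo (k - j) t * kernelP d s (intStep μ) f g t q p ∂freqMeasure := by
  refine H.inner_specDual hS (H.memWeighted_specDual hS q k) p j ?_
  filter_upwards [H.ae_regular] with t ⟨_, _, _, _, hc, hb⟩
  have hc' : conj (chi d s (intStep μ) t) ≠ 0 := by simpa using hc
  rw [specDual, Pi.smul_apply, smul_eq_mul, Matrix.single_one_vecMul, Matrix.row, sub_eq_add_neg,
    expo_add, kernelP, Matrix.smul_apply, smul_eq_mul, Complex.ofReal_div, norm_sq_eq_mul_conj,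
    norm_sq_eq_mul_conj]
  field_simp

lemma AdmissibleDensities.inner_specDual_specNoise (H : AdmissibleDensities d s μ f g)
    (hS : IsFactor (obsDensity d s f g) S) (p q : Fin T) (j k : ℤ) :
    Integrable (fun t => expo (k - j) t * kernelT d s (intStep μ) f g t q p) freqMeasure ∧
    inner ℂ (toWeighted S (specDual d s (intStep μ) f g p j))
      (toWeighted S (specNoise d s f g q k)) =
        ∫ t, expo (k - j) t * kernelT d s (intStep μ) f g t q p ∂freqMeasure := by
  refine H.inner_specDual hS (H.memWeighted_specNoise hS q k) p j ?_
  filter_upwards [H.ae_regular] with t ⟨_, _, _, _, hc, hb⟩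
  rw [specNoise, Pi.smul_apply, smul_eq_mul, Matrix.single_one_vecMul, Matrix.row, sub_eq_add_neg,
    expo_add, kernelT, Matrix.smul_apply, smul_eq_mul, norm_sq_eq_mul_conj]
  field_simp

/-- The matrix function `|β|² g w⁻¹ g`. -/
noncomputable def kernelNoise (d s : Fin r → ℕ) (f g : ℝ → Matrix (Fin T) (Fin T) ℂ) (t : ℝ) :
    Matrix (Fin T) (Fin T) ℂ :=
  ((‖beta d s t‖ ^ 2 : ℝ) : ℂ) • (g t * (obsDensity d s f g t)⁻¹ * g t)

lemma vecMul_specNoise {t : ℝ} (hdet : IsUnit (obsDensity d s f g t).det) (p : Fin T) (k : ℤ) :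
    specNoise d s f g p k t ᵥ* obsDensity d s f g t =
      (conj (beta d s t) * expo k t) • (Pi.single p 1 ᵥ* g t) := by
  rw [specNoise, Matrix.smul_vecMul, Matrix.vecMul_vecMul, Matrix.mul_assoc,
    Matrix.nonsing_inv_mul _ hdet, Matrix.mul_one]

lemma AdmissibleDensities.inner_specNoise_specNoise (H : AdmissibleDensities d s μ f g)
    (hS : IsFactor (obsDensity d s f g) S) (p q : Fin T) (j k : ℤ) :
    Integrable (fun t => expo (k - j) t * kernelNoise d s f g t q p) freqMeasure ∧
    inner ℂ (toWeighted S (specNoise d s f g p j)) (toWeighted S (specNoise d s f g q k)) =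
        ∫ t, expo (k - j) t * kernelNoise d s f g t q p ∂freqMeasure := by
  have h1 := H.memWeighted_specNoise hS p j
  have h2 := H.memWeighted_specNoise hS q k
  have e : (fun t => (specNoise d s f g q k t ᵥ* obsDensity d s f g t) ⬝ᵥ
      star (specNoise d s f g p j t)) =ᵐ[freqMeasure]
      fun t => expo (k - j) t * kernelNoise d s f g t q p := by
    filter_upwards [H.ae_regular] with t ⟨_, hg, hpos, hdet, _, _⟩
    rw [vecMul_specNoise hdet, specNoise, star_smul, smul_dotProduct, dotProduct_smul,
      Matrix.star_vecMul, Matrix.conjTranspose_mul, hg.isHermitian.eq, hpos.isHermitian.inv.eq,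
      ← Pi.single_star, star_one, ← Matrix.dotProduct_mulVec, Matrix.mulVec_mulVec,
      single_dotProduct, one_mul, Matrix.mulVec_single_one, Matrix.col_apply, kernelNoise,
      Matrix.smul_apply, sub_eq_add_neg, expo_add, norm_sq_eq_mul_conj, ← Matrix.mul_assoc]
    simp only [smul_eq_mul, Complex.star_def, map_mul, Complex.conj_conj, conj_expo]
    ring
  rw [inner_toWeighted hS h1 h2]
  exact ⟨(integrable_inner_weighted hS h1 h2).congr e, integral_congr_ae e⟩

lemma AdmissibleDensities.inner_specIncrement_specNoise (H : AdmissibleDensities d s μ f g)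
    (hS : IsFactor (obsDensity d s f g) S) (ν : Fin r → ℤ) (p q : Fin T) (k m : ℤ) :
    Integrable (fun t => expo m t * conj (expo k t * chi d s ν t) * g t q p) freqMeasure ∧
    inner ℂ (toWeighted S (specIncrement d s ν p k)) (toWeighted S (specNoise d s f g q m)) =
      ∫ t, expo m t * conj (expo k t * chi d s ν t) * g t q p ∂freqMeasure := by
  have h1 := memWeighted_specIncrement H.seasons_pos H.signal H.noise hS ν p k
  have h2 := H.memWeighted_specNoise hS q m
  have e : (fun t => (specNoise d s f g q m t ᵥ* obsDensity d s f g t) ⬝ᵥ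
      star (specIncrement d s ν p k t)) =ᵐ[freqMeasure]
      fun t => expo m t * conj (expo k t * chi d s ν t) * g t q p := by
    filter_upwards [H.ae_regular] with t ⟨_, _, _, hdet, _, hb⟩
    have hb' : conj (beta d s t) ≠ 0 := by simpa using hb
    rw [vecMul_specNoise hdet, specIncrement, ← Pi.single_star, dotProduct_single,
      Pi.smul_apply, Matrix.single_one_vecMul, Matrix.row]
    simp only [smul_eq_mul, Complex.star_def, map_mul, map_div₀]
    field_simp
  rw [inner_toWeighted hS h1 h2]
  exact ⟨(integrable_inner_weighted hS h1 h2).congr e, integral_congr_ae e⟩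

lemma AdmissibleDensities.integrable_kernelP (H : AdmissibleDensities d s μ f g) (p q : Fin T) :
    Integrable (fun t => kernelP d s (intStep μ) f g t p q) freqMeasure := by
  obtain ⟨S, hS⟩ := H.exists_isFactor
  simpa using (H.inner_specDual_specDual hS q p 0 0).1

lemma AdmissibleDensities.integrable_kernelT (H : AdmissibleDensities d s μ f g) (p q : Fin T) :
    Integrable (fun t => kernelT d s (intStep μ) f g t p q) freqMeasure := by
  obtain ⟨S, hS⟩ := H.exists_isFactor
  simpa using (H.inner_specDual_specNoise hS q p 0 0).1

lemma AdmissibleDensities.integrable_kernelNoise (H : AdmissibleDensities d s μ f g)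
    (p q : Fin T) : Integrable (fun t => kernelNoise d s f g t p q) freqMeasure := by
  obtain ⟨S, hS⟩ := H.exists_isFactor
  simpa using (H.inner_specNoise_specNoise hS q p 0 0).1

lemma AdmissibleDensities.kernelQ_eq (H : AdmissibleDensities d s μ f g) (p q : Fin T) :
    (fun t => kernelQ d s f g t p q) =ᵐ[freqMeasure]
      fun t => g t p q - kernelNoise d s f g t p q := by
  filter_upwards [H.ae_regular] with t ⟨_, _, _, hdet, _, _⟩
  have : kernelQ d s f g t = g t - kernelNoise d s f g t := mul_inv_mul_eq_sub hdet
  rw [this, Matrix.sub_apply]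

lemma AdmissibleDensities.integrable_kernelQ (H : AdmissibleDensities d s μ f g) (p q : Fin T) :
    Integrable (fun t => kernelQ d s f g t p q) freqMeasure :=
  ((H.noise.integrable p q).sub (H.integrable_kernelNoise p q)).congr (H.kernelQ_eq p q).symm

lemma AdmissibleDensities.matQ_eq (H : AdmissibleDensities d s μ f g) (N : ℕ) :
    matQ d s f g N = fourierBlockMatrix (N + 1) g -
      fourierBlockMatrix (N + 1) (kernelNoise d s f g) := by
  ext jp kq
  rw [matQ, fourierBlockMatrix, fourierBlockMatrix, fourierBlockMatrix, Matrix.sub_apply,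
    Matrix.of_apply, Matrix.of_apply, Matrix.of_apply,
    ← integral_sub (integrable_expo_mul (H.noise.integrable _ _) _)
      (integrable_expo_mul (H.integrable_kernelNoise _ _) _)]
  refine integral_congr_ae ?_
  filter_upwards [H.kernelQ_eq kq.2 jp.2] with t ht
  rw [ht, mul_sub]

lemma inner_sum_eq_quadratic {ι E : Type*} [Fintype ι] [NormedAddCommGroup E]
    [InnerProductSpace ℂ E] (x : ι → E) (A : Matrix ι ι ℂ)
    (hA : ∀ i j, inner ℂ (x i) (x j) = A i j) (c : ι → ℂ) :
    inner ℂ (∑ i, c i • x i) (∑ i, c i • x i) = (A *ᵥ c) ⬝ᵥ star c := by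
  simp only [sum_inner, inner_sum, inner_smul_left, inner_smul_right, hA, dotProduct,
    Matrix.mulVec, Finset.sum_mul, Finset.mul_sum, Pi.star_apply, Complex.star_def]
  rw [Finset.sum_comm]
  exact Finset.sum_congr rfl fun i _ => Finset.sum_congr rfl fun j _ => by ring

/-- `P_N` is the Gram matrix of the dual family, which is linearly independent by
biorthogonality. -/
lemma AdmissibleDensities.isUnit_det_matP (H : AdmissibleDensities d s μ f g) (N : ℕ) :
    IsUnit (matP d s μ f g N).det := by
  obtain ⟨S, hS⟩ := H.exists_isFactor
  rw [← Matrix.isUnit_iff_isUnit_det, ← Matrix.mulVec_injective_iff_isUnit]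
  refine (injective_iff_map_eq_zero (matP d s μ f g N).mulVecLin).2 fun c hc => ?_
  rw [Matrix.mulVecLin_apply] at hc
  have h1 := inner_sum_eq_quadratic (fun jp : Fin (N + gmDegree d s μ + 1) × Fin T =>
    toWeighted S (specDual d s (intStep μ) f g jp.2 (jp.1 : ℕ))) (matP d s μ f g N)
    (fun jp kq => (H.inner_specDual_specDual hS jp.2 kq.2 _ _).2) c
  rw [hc, zero_dotProduct, inner_self_eq_zero] at h1
  funext kq
  have h2 := congrArg (fun u => inner ℂ (toWeighted S (specIncrement d s (intStep μ) kq.2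
    ((kq.1 : ℕ) : ℤ))) u) h1
  simp only [inner_sum, inner_smul_right, inner_zero_right] at h2
  rw [Finset.sum_eq_single kq] at h2
  · rw [← inner_conj_symm, H.inner_specDual_specIncrement hS] at h2
    simpa using h2
  · intro jp _ hne
    rw [← inner_conj_symm, H.inner_specDual_specIncrement hS, if_neg, map_zero, mul_zero]
    rintro ⟨h3, h4⟩
    exact hne (Prod.ext (Fin.ext (by exact_mod_cast h3.symm)) h4.symm)
  · simp

/-- Moving `χ_μ(e^{iλ})` from the kernel to the trigonometric polynomial. -/
lemma AdmissibleDensities.matT_mulVec_eq (H : AdmissibleDensities d s μ f g) (N : ℕ)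
    (α : ℕ → Fin T → ℂ)
    (hT' : ∀ p q, Integrable (fun t => kernelT' d s (intStep μ) f g t p q) freqMeasure) :
    matT d s μ f g N *ᵥ stack N _ α =
      (-1 : ℂ) ^ (∑ i, d i) •
        (matT' d s μ f g N *ᵥ stack (N + gmDegree d s μ) _ (aShift d s μ N α)) := by
  funext jp
  rw [Pi.smul_apply, matT, matT', fourierBlockMatrix_mulVec H.integrable_kernelT,
    fourierBlockMatrix_mulVec hT', smul_eq_mul, ← integral_const_mul, blockPoly_stack (by omega),
    blockPoly_stack (by omega)]
  refine integral_congr_ae ?_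
  filter_upwards [H.ae_regular] with t ⟨_, _, _, _, hc, _⟩
  have hc' : conj (chi d s (intStep μ) t) ≠ 0 := by simpa using hc
  have h1 : kernelT d s (intStep μ) f g t =
      conj (chi d s (intStep μ) t) • kernelT' d s (intStep μ) f g t := by
    rw [kernelT, kernelT', smul_smul, Complex.ofReal_div, norm_sq_eq_mul_conj (chi _ _ _ _)]
    congr 1
    field_simp
  have h2 : conj (chi d s (intStep μ) t) • trigPoly N α t =
      (-1 : ℂ) ^ (∑ i, d i) • trigPoly (N + gmDegree d s μ) (aShift d s μ N α) t := by
    funext p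
    exact conj_chi_mul_trigPoly d s μ N α t p
  rw [h1, Matrix.vecMul_smul, ← Matrix.smul_vecMul, h2, Matrix.smul_vecMul, Pi.smul_apply,
    smul_eq_mul]
  ring

/-- The spectral characteristic as a combination of increments, noise and dual functions. -/
lemma specChar_eq_sum (N : ℕ) (α : ℕ → Fin T → ℂ) :
    specChar d s μ f g N α =
      (∑ kp : Fin (N + gmDegree d s μ + 1) × Fin T,
          stack N _ (bCoeff d s μ N α) kp • specIncrement d s (intStep μ) kp.2 (kp.1 : ℕ)) -
        (∑ kp : Fin (N + gmDegree d s μ + 1) × Fin T,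
          stack N _ α kp • specNoise d s f g kp.2 (kp.1 : ℕ)) -
        ∑ kp : Fin (N + gmDegree d s μ + 1) × Fin T,
          cCoeff d s μ f g N α kp • specDual d s (intStep μ) f g kp.2 (kp.1 : ℕ) := by
  have hpoly : ∀ (c : Fin (N + gmDegree d s μ + 1) × Fin T → ℂ) (t : ℝ),
      blockPoly c t = ∑ kp, (c kp * expo ((kp.1 : ℕ) : ℤ) t) • (Pi.single kp.2 1 : Fin T → ℂ) := by
    intro c t
    funext p
    rw [← Finset.univ_product_univ, Finset.sum_product, Finset.sum_apply]
    refine Finset.sum_congr rfl fun k _ => ?_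
    rw [Finset.sum_apply, Finset.sum_eq_single p]
    · simp
    · intro q _ hq
      simp [Pi.single_eq_of_ne hq.symm]
    · simp
  have hvec : ∀ (c : Fin (N + gmDegree d s μ + 1) × Fin T → ℂ) (B : Matrix (Fin T) (Fin T) ℂ)
      (t : ℝ), blockPoly c t ᵥ* B =
        ∑ kp, (c kp * expo ((kp.1 : ℕ) : ℤ) t) • (Pi.single kp.2 1 ᵥ* B) := by
    intro c B t
    rw [hpoly, Matrix.sum_vecMul]
    exact Finset.sum_congr rfl fun kp _ => Matrix.smul_vecMul _ _ _
  have hN : N < N + gmDegree d s μ + 1 := by omega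
  funext t
  simp only [Pi.sub_apply, Finset.sum_apply, Pi.smul_apply]
  rw [specChar, ← blockPoly_stack hN, ← blockPoly_stack hN,
    show cPoly d s μ f g N α t = blockPoly (cCoeff d s μ f g N α) t from rfl, hvec, hvec, hpoly,
    Finset.smul_sum, Finset.smul_sum, Finset.smul_sum]
  congr 1
  · congr 1
    · refine Finset.sum_congr rfl fun kp _ => ?_
      rw [specIncrement, smul_smul, ← Pi.single_smul, ← Pi.single_smul]
      congr 1
      simp only [smul_eq_mul]
      ring
    · refine Finset.sum_congr rfl fun kp _ => ?_
      rw [specNoise, smul_smul, smul_smul]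
      congr 1
      ring
  · refine Finset.sum_congr rfl fun kp _ => ?_
    rw [specDual, smul_smul, smul_smul]
    congr 1
    ring

end Kernels

/-! ### Projection on the observed increments -/

section Projection

variable {Ω : Type*} [MeasurableSpace Ω] {P : Measure Ω} {T r : ℕ} {d s μ : Fin r → ℕ}
  {f g : ℝ → Matrix (Fin T) (Fin T) ℂ} {S : ℝ → Matrix (Fin T) (Fin T) ℂ}
  {ξ η ζ : Fin T → ℤ → Ω → ℂ}

/-- The increment times whose increments involve observed values only. -/
def observedTimes (d s μ : Fin r → ℕ) (N : ℕ) : Set ℤ :=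
  Set.Iic (-1) ∪ Set.Ici ((N : ℤ) + (gmDegree d s μ : ℤ) + 1)

lemma mem_observedTimes_iff {N : ℕ} {k : ℤ} :
    k ∈ observedTimes d s μ N ↔ ¬ ∃ j : Fin (N + gmDegree d s μ + 1), k = ((j : ℕ) : ℤ) := by
  simp only [observedTimes, Set.mem_union, Set.mem_Iic, Set.mem_Ici]
  constructor
  · rintro h ⟨j, rfl⟩
    have := j.2
    omega
  · intro h
    by_contra hcon
    exact h ⟨⟨k.toNat, by omega⟩, by simp only; omega⟩

/-- Orthogonality to the observed space can be tested on the observed increments. -/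
lemma mem_orthogonal_observedSpace_iff
    (hmem : ∀ q k, MemLp (gmIncrement d s (intStep μ) (ζ q) k) 2 P) (N : ℕ) (x : Lp ℂ 2 P) :
    x ∈ (observedSpace P d s μ ζ N)ᗮ ↔ ∀ k ∈ observedTimes d s μ N, ∀ q,
      inner ℂ (toL2 P (gmIncrement d s (intStep μ) (ζ q) k)) x = 0 := by
  have hspan : ∀ K : Set ℤ, x ∈ (incrementSpan P d s μ ζ K)ᗮ ↔ ∀ k ∈ K, ∀ q,
      inner ℂ (toL2 P (gmIncrement d s (intStep μ) (ζ q) k)) x = 0 := by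
    intro K
    rw [incrementSpan, Submodule.orthogonal_closure, Submodule.mem_orthogonal]
    constructor
    · intro h k hk q
      exact h _ (Submodule.subset_span ⟨k, hk, q, toL2_coe (hmem q k)⟩)
    · intro h u hu
      induction hu using Submodule.span_induction with
      | mem u hu =>
        obtain ⟨k, hk, q, hkq⟩ := hu
        rw [← (toL2_eq_iff (hmem q k) u).2 hkq.symm]
        exact h k hk q
      | zero => simp
      | add u v _ _ h1 h2 => rw [inner_add_left, h1, h2, add_zero]
      | smul c u _ h1 => rw [inner_smul_left, h1, mul_zero]
  rw [observedSpace, Submodule.orthogonal_closure, ← Submodule.inf_orthogonal, Submodule.mem_inf,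
    hspan, hspan]
  simp only [observedTimes, Set.mem_union]
  exact ⟨fun h k hk => hk.elim (h.1 k) (h.2 k), fun h => ⟨fun k hk => h k (Or.inl hk),
    fun k hk => h k (Or.inr hk)⟩⟩

variable {V : Lp (EuclideanSpace ℂ (Fin T)) 2 freqMeasure →ₗᵢ[ℂ] Lp ℂ 2 P}

/-- The element `∑ α(k)ᵀ η(k)` of `L₂(P)`. -/
noncomputable def noiseValue (P : Measure Ω) (η : Fin T → ℤ → Ω → ℂ) {L : ℕ}
    (c : Fin L × Fin T → ℂ) : Lp ℂ 2 P :=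
  ∑ kp : Fin L × Fin T, c kp • toL2 P (η kp.2 (kp.1 : ℕ))

/-- The spectral function of the projection of `∑ α(k)ᵀ η(k)` on the space of the increments. -/
noncomputable def noiseSpec (d s : Fin r → ℕ) (f g S : ℝ → Matrix (Fin T) (Fin T) ℂ) {L : ℕ}
    (c : Fin L × Fin T → ℂ) : Lp (EuclideanSpace ℂ (Fin T)) 2 freqMeasure :=
  ∑ kp : Fin L × Fin T, c kp • toWeighted S (specNoise d s f g kp.2 (kp.1 : ℕ))

/-- The combination of the dual functions with coefficients `c`. -/
noncomputable def dualSpec (d s μ : Fin r → ℕ) (f g S : ℝ → Matrix (Fin T) (Fin T) ℂ) {L : ℕ}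
    (c : Fin L × Fin T → ℂ) : Lp (EuclideanSpace ℂ (Fin T)) 2 freqMeasure :=
  ∑ kp : Fin L × Fin T, c kp • toWeighted S (specDual d s (intStep μ) f g kp.2 (kp.1 : ℕ))

/-- The combination of increments in the functional, as an element of the spectral domain. -/
noncomputable def incrementSpec (d s μ : Fin r → ℕ) (S : ℝ → Matrix (Fin T) (Fin T) ℂ) {L : ℕ}
    (c : Fin L × Fin T → ℂ) : Lp (EuclideanSpace ℂ (Fin T)) 2 freqMeasure :=
  ∑ kp : Fin L × Fin T, c kp • toWeighted S (specIncrement d s (intStep μ) kp.2 (kp.1 : ℕ))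

lemma AdmissibleDensities.toWeighted_specChar (H : AdmissibleDensities d s μ f g)
    (hS : IsFactor (obsDensity d s f g) S) (N : ℕ) (α : ℕ → Fin T → ℂ) :
    MemWeighted S (specChar d s μ f g N α) ∧ toWeighted S (specChar d s μ f g N α) =
      incrementSpec d s μ S (stack N (N + gmDegree d s μ + 1) (bCoeff d s μ N α)) -
        noiseSpec d s f g S (stack N (N + gmDegree d s μ + 1) α) -
        dualSpec d s μ f g S (cCoeff d s μ f g N α) := by
  have h1 := MemWeighted.sum Finset.univ
    (fun kp => stack N (N + gmDegree d s μ + 1) (bCoeff d s μ N α) kp)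
    (φ := fun kp => specIncrement d s (intStep μ) kp.2 (kp.1 : ℕ))
    fun kp _ => memWeighted_specIncrement H.seasons_pos H.signal H.noise hS _ _ _
  have h2 := MemWeighted.sum Finset.univ
    (fun kp => stack N (N + gmDegree d s μ + 1) α kp)
    (φ := fun kp => specNoise d s f g kp.2 (kp.1 : ℕ)) fun kp _ => H.memWeighted_specNoise hS _ _
  have h3 := MemWeighted.sum Finset.univ (fun kp => cCoeff d s μ f g N α kp)
    (φ := fun kp => specDual d s (intStep μ) f g kp.2 (kp.1 : ℕ))
    fun kp _ => H.memWeighted_specDual hS _ _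
  have h4 := h1.1.sub h2.1
  have h5 := h4.1.sub h3.1
  rw [specChar_eq_sum]
  refine ⟨h5.1, ?_⟩
  rw [h5.2, h4.2, h1.2, h2.2, h3.2]
  rfl

/-- The coefficients `c` are chosen so that the spectral characteristic is orthogonal to the dual
functions with indices `0, …, N + n`. -/
lemma AdmissibleDensities.inner_specDual_specChar (H : AdmissibleDensities d s μ f g)
    (hS : IsFactor (obsDensity d s f g) S) (N : ℕ) (α : ℕ → Fin T → ℂ)
    (jp : Fin (N + gmDegree d s μ + 1) × Fin T) :
    inner ℂ (toWeighted S (specDual d s (intStep μ) f g jp.2 (jp.1 : ℕ)))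
      (toWeighted S (specChar d s μ f g N α)) = 0 := by
  have h1 : inner ℂ (toWeighted S (specDual d s (intStep μ) f g jp.2 (jp.1 : ℕ)))
      (incrementSpec d s μ S (stack N (N + gmDegree d s μ + 1) (bCoeff d s μ N α))) =
      stack N (N + gmDegree d s μ + 1) (bCoeff d s μ N α) jp := by
    simp only [incrementSpec, inner_sum, inner_smul_right, H.inner_specDual_specIncrement hS]
    rw [Finset.sum_eq_single jp]
    · simp
    · rintro kq _ hne
      rw [if_neg, mul_zero]
      rintro ⟨h3, h4⟩
      exact hne (Prod.ext (Fin.ext (by exact_mod_cast h3)) h4)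
    · simp
  have h2 : inner ℂ (toWeighted S (specDual d s (intStep μ) f g jp.2 (jp.1 : ℕ)))
      (noiseSpec d s f g S (stack N (N + gmDegree d s μ + 1) α)) =
      (matT d s μ f g N *ᵥ stack N _ α) jp := by
    simp only [noiseSpec, inner_sum, inner_smul_right, (H.inner_specDual_specNoise hS _ _ _ _).2]
    exact Finset.sum_congr rfl fun kq _ => mul_comm _ _
  have h3 : inner ℂ (toWeighted S (specDual d s (intStep μ) f g jp.2 (jp.1 : ℕ)))
      (dualSpec d s μ f g S (cCoeff d s μ f g N α)) =
      (matP d s μ f g N *ᵥ cCoeff d s μ f g N α) jp := by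
    simp only [dualSpec, inner_sum, inner_smul_right, (H.inner_specDual_specDual hS _ _ _ _).2]
    exact Finset.sum_congr rfl fun kq _ => mul_comm _ _
  rw [(H.toWeighted_specChar hS N α).2, inner_sub_right, inner_sub_right, h1, h2, h3, cCoeff,
    Matrix.mulVec_mulVec, Matrix.mul_nonsing_inv _ (H.isUnit_det_matP N), Matrix.one_mulVec, rhs,
    Pi.sub_apply, sub_self]

/-- The estimate lies in the observed space: a vector orthogonal to the observed increments
becomes orthogonal to all increments after subtraction of a combination of the dual functions
with indices `0, …, N + n`, and the spectral characteristic is orthogonal to these. -/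
lemma AdmissibleDensities.map_specChar_mem_observedSpace (H : AdmissibleDensities d s μ f g)
    (hS : IsFactor (obsDensity d s f g) S) (hV : MapsToGMIncrements P d s ζ S V)
    (hmem : ∀ q k, MemLp (gmIncrement d s (intStep μ) (ζ q) k) 2 P) (N : ℕ)
    (α : ℕ → Fin T → ℂ) :
    V (toWeighted S (specChar d s μ f g N α)) ∈ observedSpace P d s μ ζ N := by
  have hclosed : (observedSpace P d s μ ζ N).topologicalClosure = observedSpace P d s μ ζ N :=
    (Submodule.isClosed_topologicalClosure _).submodule_topologicalClosure_eq
  rw [← hclosed, ← Submodule.orthogonal_orthogonal_eq_closure, Submodule.mem_orthogonal]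
  intro z hz
  rw [mem_orthogonal_observedSpace_iff hmem] at hz
  set a : Fin (N + gmDegree d s μ + 1) × Fin T → ℂ := fun jp =>
    inner ℂ (toL2 P (gmIncrement d s (intStep μ) (ζ jp.2) (jp.1 : ℕ))) z with ha
  set u := z - V (dualSpec d s μ f g S a) with hu
  have hν := admissibleStep_intStep H.step_pos
  have hu0 : ∀ k q, inner ℂ (V (toWeighted S (specIncrement d s (intStep μ) q k))) u = 0 := by
    intro k q
    rw [hu, inner_sub_right, V.inner_map_map, dualSpec, inner_sum]
    simp only [inner_smul_right]
    have hterm : ∀ jp : Fin (N + gmDegree d s μ + 1) × Fin T,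
        inner ℂ (toWeighted S (specIncrement d s (intStep μ) q k))
          (toWeighted S (specDual d s (intStep μ) f g jp.2 (jp.1 : ℕ))) =
          if k = ((jp.1 : ℕ) : ℤ) ∧ q = jp.2 then 1 else 0 := by
      intro jp
      rw [← inner_conj_symm, H.inner_specDual_specIncrement hS]
      simp [apply_ite]
    simp only [hterm]
    rw [hV _ hν]
    by_cases hk : k ∈ observedTimes d s μ N
    · rw [hz k hk q, Finset.sum_eq_zero, sub_zero]
      intro jp _
      rw [if_neg, mul_zero]
      rintro ⟨h1, _⟩
      exact mem_observedTimes_iff.1 hk ⟨jp.1, h1⟩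
    · rw [mem_observedTimes_iff, not_not] at hk
      obtain ⟨j, rfl⟩ := hk
      rw [Finset.sum_eq_single (j, q)]
      · simp [ha]
      · rintro kp _ hne
        rw [if_neg, mul_zero]
        rintro ⟨h3, h4⟩
        exact hne (Prod.ext (Fin.ext (by exact_mod_cast h3.symm)) h4.symm)
      · simp
  have hall : ∀ x, inner ℂ (V x) u = 0 := by
    intro x
    refine (dense_span_specIncrement H.seasons_pos H.step_pos H.signal H.noise
      H.minimality.isUnit_det hS).induction (P := fun x => inner ℂ (V x) u = 0) ?_
      (isClosed_eq (by fun_prop) continuous_const) x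
    intro x hx
    induction hx using Submodule.span_induction with
    | mem x hx =>
      obtain ⟨⟨k, q⟩, rfl⟩ := hx
      exact hu0 k q
    | zero => simp
    | add x y _ _ h1 h2 => rw [map_add, inner_add_left, h1, h2, add_zero]
    | smul c x _ h1 => rw [map_smul, inner_smul_left, h1, mul_zero]
  have hz' : z = u + V (dualSpec d s μ f g S a) := by rw [hu, sub_add_cancel]
  rw [hz', inner_add_left, ← inner_conj_symm, hall, map_zero, zero_add, V.inner_map_map, dualSpec,
    sum_inner]
  refine Finset.sum_eq_zero fun jp _ => ?_
  rw [inner_smul_left, H.inner_specDual_specChar hS, mul_zero]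

/-- The projection of `∑ α(k)ᵀ η(k)` on the space of the increments of `ζ` has the spectral
function `noiseSpec`. -/
lemma AdmissibleDensities.inner_map_noise_sub (H : AdmissibleDensities d s μ f g)
    (hS : IsFactor (obsDensity d s f g) S) (hf : IsGMSpectralDensity P d s ξ f)
    (hg : IsStationarySpectralDensity P η g) (hu : IncrementsUncorrelated P d s ξ η)
    (hζ : ∀ p m ω, ζ p m ω = ξ p m ω + η p m ω) (hV : MapsToGMIncrements P d s ζ S V)
    {L : ℕ} (c : Fin L × Fin T → ℂ) (x : Lp (EuclideanSpace ℂ (Fin T)) 2 freqMeasure) :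
    inner ℂ (V x) (noiseValue P η c - V (noiseSpec d s f g S c)) = 0 := by
  have hν := admissibleStep_intStep H.step_pos
  refine (dense_span_specIncrement H.seasons_pos H.step_pos H.signal H.noise
    H.minimality.isUnit_det hS).induction
    (P := fun x => inner ℂ (V x) (noiseValue P η c - V (noiseSpec d s f g S c)) = 0) ?_
    (isClosed_eq (by fun_prop) continuous_const) x
  intro x hx
  induction hx using Submodule.span_induction with
  | mem x hx =>
    obtain ⟨⟨k, q⟩, rfl⟩ := hx
    have hterm : ∀ (p q : Fin T) (m : ℤ), Integrable (fun t =>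
        expo m t * conj (expo k t * chi d s (intStep μ) t) * g t q p) freqMeasure := fun p q m =>
      (H.inner_specIncrement_specNoise hS (intStep μ) p q k m).1
    rw [inner_sub_right, V.inner_map_map, hV _ hν, noiseValue,
      inner_increment_observed_sum hf hg hu hζ hν, noiseSpec, inner_sum]
    simp only [inner_smul_right, (H.inner_specIncrement_specNoise hS (intStep μ) _ _ _ _).2,
      mul_assoc]
    rw [integral_finsetSum, sub_eq_zero]
    · exact Finset.sum_congr rfl fun kp _ => integral_const_mul _ _
    · intro kp _
      have := (hterm q kp.2 (kp.1 : ℕ)).const_mul (c kp)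
      simpa only [mul_assoc] using this
  | zero => simp
  | add x y _ _ h1 h2 => rw [map_add, inner_add_left, h1, h2, add_zero]
  | smul c x _ h1 => rw [map_smul, inner_smul_left, h1, mul_zero]

/-- The functional plus the initial part, as an element of `L₂(P)`. -/
noncomputable def target (P : Measure Ω) (d s μ : Fin r → ℕ) (η : Fin T → ℤ → Ω → ℂ)
    (S : ℝ → Matrix (Fin T) (Fin T) ℂ)
    (V : Lp (EuclideanSpace ℂ (Fin T)) 2 freqMeasure →ₗᵢ[ℂ] Lp ℂ 2 P) (N : ℕ)
    (α : ℕ → Fin T → ℂ) : Lp ℂ 2 P :=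
  V (incrementSpec d s μ S (stack N (N + gmDegree d s μ + 1) (bCoeff d s μ N α))) -
    noiseValue P η (stack N (N + gmDegree d s μ + 1) α)

/-- The error is the dual combination minus the part of the noise orthogonal to the range of
`V`. -/
lemma AdmissibleDensities.target_sub (H : AdmissibleDensities d s μ f g)
    (hS : IsFactor (obsDensity d s f g) S) (N : ℕ) (α : ℕ → Fin T → ℂ) :
    target P d s μ η S V N α - V (toWeighted S (specChar d s μ f g N α)) =
      V (dualSpec d s μ f g S (cCoeff d s μ f g N α)) -
        (noiseValue P η (stack N (N + gmDegree d s μ + 1) α) -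
          V (noiseSpec d s f g S (stack N (N + gmDegree d s μ + 1) α))) := by
  rw [(H.toWeighted_specChar hS N α).2, target, map_sub, map_sub]
  abel

/-- The error is orthogonal to the observed increments, as the dual functions in it belong to the
missing times `0, …, N + n`. -/
lemma AdmissibleDensities.target_sub_mem_orthogonal (H : AdmissibleDensities d s μ f g)
    (hS : IsFactor (obsDensity d s f g) S) (hf : IsGMSpectralDensity P d s ξ f)
    (hg : IsStationarySpectralDensity P η g) (hu : IncrementsUncorrelated P d s ξ η)
    (hζ : ∀ p m ω, ζ p m ω = ξ p m ω + η p m ω) (hV : MapsToGMIncrements P d s ζ S V) (N : ℕ)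
    (α : ℕ → Fin T → ℂ) :
    target P d s μ η S V N α - V (toWeighted S (specChar d s μ f g N α)) ∈
      (observedSpace P d s μ ζ N)ᗮ := by
  have hν := admissibleStep_intStep H.step_pos
  rw [mem_orthogonal_observedSpace_iff
    (fun q k => (memLp_increment_observed hf hg hζ hν q k).1)]
  intro k hk q
  rw [H.target_sub hS, inner_sub_right, ← hV _ hν, H.inner_map_noise_sub hS hf hg hu hζ hV,
    sub_zero, V.inner_map_map, dualSpec, inner_sum]
  refine Finset.sum_eq_zero fun jp _ => ?_
  rw [inner_smul_right, ← inner_conj_symm, H.inner_specDual_specIncrement hS, if_neg, map_zero,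
    mul_zero]
  rintro ⟨h1, _⟩
  exact mem_observedTimes_iff.1 hk ⟨jp.1, h1⟩

/-- The squared distance of the target from the observed space. -/
lemma AdmissibleDensities.inner_target_sub_self (H : AdmissibleDensities d s μ f g)
    (hS : IsFactor (obsDensity d s f g) S) (hf : IsGMSpectralDensity P d s ξ f)
    (hg : IsStationarySpectralDensity P η g) (hu : IncrementsUncorrelated P d s ξ η)
    (hζ : ∀ p m ω, ζ p m ω = ξ p m ω + η p m ω) (hV : MapsToGMIncrements P d s ζ S V) (N : ℕ)
    (α : ℕ → Fin T → ℂ) :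
    inner ℂ (target P d s μ η S V N α - V (toWeighted S (specChar d s μ f g N α)))
      (target P d s μ η S V N α - V (toWeighted S (specChar d s μ f g N α))) =
      (matP d s μ f g N *ᵥ cCoeff d s μ f g N α) ⬝ᵥ star (cCoeff d s μ f g N α) +
        (matQ d s f g N *ᵥ stack N _ α) ⬝ᵥ star (stack N _ α) := by
  have hnv : noiseValue P η (stack N (N + gmDegree d s μ + 1) α) =
      noiseValue P η (stack N (N + 1) α) :=
    (sum_stack (by omega) α fun k p => toL2 P (η p k)).trans
      (sum_stack (by omega) α fun k p => toL2 P (η p k)).symm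
  have hns : noiseSpec d s f g S (stack N (N + gmDegree d s μ + 1) α) =
      noiseSpec d s f g S (stack N (N + 1) α) :=
    (sum_stack (by omega) α fun k p => toWeighted S (specNoise d s f g p k)).trans
      (sum_stack (by omega) α fun k p => toWeighted S (specNoise d s f g p k)).symm
  rw [H.target_sub hS, hnv, hns]
  set a := stack N (N + 1) α
  set c := cCoeff d s μ f g N α
  have h0 := H.inner_map_noise_sub hS hf hg hu hζ hV a
  have h0' : ∀ x, inner ℂ (noiseValue P η a - V (noiseSpec d s f g S a)) (V x) = 0 := fun x => by
    rw [← inner_conj_symm, h0, map_zero]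
  have h1 : inner ℂ (dualSpec d s μ f g S c) (dualSpec d s μ f g S c) =
      (matP d s μ f g N *ᵥ c) ⬝ᵥ star c :=
    inner_sum_eq_quadratic _ (matP d s μ f g N)
      (fun jp kq => (H.inner_specDual_specDual hS jp.2 kq.2 _ _).2) c
  have h2 : inner ℂ (noiseSpec d s f g S a) (noiseSpec d s f g S a) =
      (fourierBlockMatrix (N + 1) (kernelNoise d s f g) *ᵥ a) ⬝ᵥ star a :=
    inner_sum_eq_quadratic _ (fourierBlockMatrix (N + 1) (kernelNoise d s f g))
      (fun jp kq => (H.inner_specNoise_specNoise hS jp.2 kq.2 _ _).2) a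
  have h3 : inner ℂ (noiseValue P η a) (noiseValue P η a) =
      (fourierBlockMatrix (N + 1) g *ᵥ a) ⬝ᵥ star a := by
    refine inner_sum_eq_quadratic _ (fourierBlockMatrix (N + 1) g) (fun jp kq => ?_) a
    rw [inner_toL2 (hg.memLp _ _) (hg.memLp _ _), hg.cov]
    rfl
  have h4 : inner ℂ (noiseValue P η a - V (noiseSpec d s f g S a))
      (noiseValue P η a - V (noiseSpec d s f g S a)) =
      inner ℂ (noiseValue P η a) (noiseValue P η a) -
        inner ℂ (noiseSpec d s f g S a) (noiseSpec d s f g S a) := by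
    have h5 : inner ℂ (V (noiseSpec d s f g S a)) (noiseValue P η a) =
        inner ℂ (noiseSpec d s f g S a) (noiseSpec d s f g S a) := by
      have := h0 (noiseSpec d s f g S a)
      rwa [inner_sub_right, V.inner_map_map, sub_eq_zero] at this
    rw [inner_sub_right, h0', sub_zero, inner_sub_left, h5]
  have key : ∀ u v : Lp ℂ 2 P, inner ℂ u v = 0 → inner ℂ v u = 0 →
      inner ℂ (u - v) (u - v) = inner ℂ u u + inner ℂ v v := fun u v h5 h6 => by
    rw [inner_sub_left, inner_sub_right, inner_sub_right, h5, h6]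
    ring
  rw [key _ _ (h0 _) (h0' _), V.inner_map_map, h1, h4, h2, h3, H.matQ_eq, Matrix.sub_mulVec,
    sub_dotProduct]

end Projection

/-! ### Optimal estimates -/

section Optimal

variable {Ω : Type*} [MeasurableSpace Ω] {P : Measure Ω} {T r : ℕ} {d s μ : Fin r → ℕ}
  {f g : ℝ → Matrix (Fin T) (Fin T) ℂ} {S : ℝ → Matrix (Fin T) (Fin T) ℂ}
  {ξ η ζ : Fin T → ℤ → Ω → ℂ}
  {V : Lp (EuclideanSpace ℂ (Fin T)) 2 freqMeasure →ₗᵢ[ℂ] Lp ℂ 2 P}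

/-- The functional differs from the target by the functional of the initial values. -/
lemma AdmissibleDensities.functional_add_initialPart (H : AdmissibleDensities d s μ f g)
    (hf : IsGMSpectralDensity P d s ξ f) (hg : IsStationarySpectralDensity P η g)
    (hζ : ∀ p m ω, ζ p m ω = ξ p m ω + η p m ω) (hV : MapsToGMIncrements P d s ζ S V) (N : ℕ)
    (α : ℕ → Fin T → ℂ) {A : Ω → ℂ}
    (hA : A = fun ω => ∑ m ∈ Finset.range (N + 1), ∑ p, α m p * ξ p m ω) :
    (fun ω => A ω + initialPart d s μ N α ζ ω) =ᵐ[P] target P d s μ η S V N α := by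
  have hν := admissibleStep_intStep H.step_pos
  set L := N + gmDegree d s μ + 1 with hL
  have hNL : N < L := by omega
  have h1 : (V (incrementSpec d s μ S (stack N L (bCoeff d s μ N α))) : Ω → ℂ) =ᵐ[P]
      ∑ kp : Fin L × Fin T, stack N L (bCoeff d s μ N α) kp •
        gmIncrement d s (intStep μ) (ζ kp.2) (kp.1 : ℕ) := by
    rw [incrementSpec, map_sum]
    simp only [map_smul]
    refine coeFn_sum_smul _ _ _ fun kp _ => ?_
    rw [hV _ hν]
    exact toL2_coe (memLp_increment_observed hf hg hζ hν _ _).1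
  have h2 : (noiseValue P η (stack N L α) : Ω → ℂ) =ᵐ[P]
      ∑ kp : Fin L × Fin T, stack N L α kp • η kp.2 (kp.1 : ℕ) :=
    coeFn_sum_smul _ _ _ fun kp _ => toL2_coe (hg.memLp _ _)
  refine Filter.EventuallyEq.trans (Filter.EventuallyEq.of_eq ?_)
    ((Lp.coeFn_sub _ _).trans (h1.sub h2)).symm
  funext ω
  rw [Pi.sub_apply, sum_stack hNL (bCoeff d s μ N α)
      (fun k p => gmIncrement d s (intStep μ) (ζ p) (k : ℕ)),
    sum_stack hNL α (fun k p => η p (k : ℕ))]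
  simp only [Finset.sum_apply, Pi.smul_apply, smul_eq_mul, gmIncrement_intStep]
  rw [hA, initialPart]
  have h3 : ∀ p, ∑ m ∈ Finset.range (N + 1), α m p * ζ p m ω =
      ∑ m ∈ Finset.range (N + 1), α m p * ξ p m ω +
        ∑ m ∈ Finset.range (N + 1), α m p * η p m ω := fun p => by
    rw [← Finset.sum_add_distrib]
    exact Finset.sum_congr rfl fun m _ => by rw [hζ, mul_add]
  have h4 := fun p => sum_mul_eq_increments_sub_initial d s μ H.seasons_pos H.step_pos N α p
    (fun m => ζ p m ω)
  have hswap : ∀ F : ℕ → Fin T → ℂ, ∑ m ∈ Finset.range (N + 1), ∑ p, F m p =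
      ∑ p, ∑ m ∈ Finset.range (N + 1), F m p := fun F => Finset.sum_comm
  simp only [hswap]
  rw [Finset.sum_comm (s := Finset.Icc (-(gmDegree d s μ : ℤ)) (-1)), ← Finset.sum_add_distrib,
    ← Finset.sum_sub_distrib]
  refine Finset.sum_congr rfl fun p _ => ?_
  have h5 := h3 p
  rw [h4 p] at h5
  linear_combination -h5

/-- The optimal estimates are the versions of one random variable. -/
lemma AdmissibleDensities.isOptimalEstimate_iff (H : AdmissibleDensities d s μ f g)
    (hS : IsFactor (obsDensity d s f g) S) (hf : IsGMSpectralDensity P d s ξ f)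
    (hg : IsStationarySpectralDensity P η g) (hu : IncrementsUncorrelated P d s ξ η)
    (hζ : ∀ p m ω, ζ p m ω = ξ p m ω + η p m ω) (hV : MapsToGMIncrements P d s ζ S V) (N : ℕ)
    (α : ℕ → Fin T → ℂ) {A : Ω → ℂ}
    (hA : A = fun ω => ∑ m ∈ Finset.range (N + 1), ∑ p, α m p * ξ p m ω) (Y : Ω → ℂ) :
    IsOptimalEstimate P d s μ ζ N α A Y ↔
      (fun ω => Y ω + initialPart d s μ N α ζ ω) =ᵐ[P]
        V (toWeighted S (specChar d s μ f g N α)) := by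
  have hν := admissibleStep_intStep H.step_pos
  have hX := H.functional_add_initialPart hf hg hζ hV N α hA
  set X := target P d s μ η S V N α
  set y₀ := V (toWeighted S (specChar d s μ f g N α))
  have hy₀ : y₀ ∈ observedSpace P d s μ ζ N := H.map_specChar_mem_observedSpace hS hV
    (fun q k => (memLp_increment_observed hf hg hζ hν q k).1) N α
  have horth : ∀ z ∈ observedSpace P d s μ ζ N, inner ℂ z (X - y₀) = 0 :=
    (Submodule.mem_orthogonal _ _).1 (H.target_sub_mem_orthogonal hS hf hg hu hζ hV N α)
  have herr : ∀ (y : Lp ℂ 2 P) (Y : Ω → ℂ),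
      (Y =ᵐ[P] fun ω => y ω - initialPart d s μ N α ζ ω) →
      ∫⁻ ω, ‖A ω - Y ω‖ₑ ^ 2 ∂P = ‖X - y‖ₑ ^ 2 := by
    intro y Y hY
    refine (enorm_sq_Lp _ ?_).symm
    refine (Lp.coeFn_sub _ _).trans ?_
    filter_upwards [hX, hY] with ω h1 h2
    rw [Pi.sub_apply, ← h1, h2]
    ring
  have hle : ∀ y y' : Lp ℂ 2 P, ‖X - y‖ₑ ^ 2 ≤ ‖X - y'‖ₑ ^ 2 ↔ ‖X - y‖ ≤ ‖X - y'‖ := by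
    intro y y'
    rw [← enorm_le_iff_norm_le]
    exact ⟨fun h => le_of_not_gt fun hlt => h.not_gt (ENNReal.pow_lt_pow_left two_ne_zero hlt),
      fun h => pow_le_pow_left' h 2⟩
  constructor
  · rintro ⟨⟨y, hy, hY⟩, hopt⟩
    have h1 : y = y₀ := (nearest_iff_eq_of_orthogonal _ hy₀ horth hy).1 fun y' hy' => by
      have := hopt (fun ω => y' ω - initialPart d s μ N α ζ ω) ⟨y', hy', ae_eq_refl _⟩
      rwa [herr y Y hY, herr y' _ (ae_eq_refl _), hle] at this
    rw [← h1]
    filter_upwards [hY] with ω h2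
    rw [h2, sub_add_cancel]
  · intro hY
    have hY' : Y =ᵐ[P] fun ω => y₀ ω - initialPart d s μ N α ζ ω := by
      filter_upwards [hY] with ω h2
      rw [← h2, add_sub_cancel_right]
    refine ⟨⟨y₀, hy₀, hY'⟩, ?_⟩
    rintro Y' ⟨y', hy', h1⟩
    rw [herr y₀ Y hY', herr y' Y' h1, hle]
    exact (nearest_iff_eq_of_orthogonal _ hy₀ horth hy₀).2 rfl y' hy'

/-- The integral form of the mean square error.  The sum of the two integrands is integrable by the
pointwise identity, and each of them is nonnegative, so both are integrable. -/
lemma AdmissibleDensities.integral_error (H : AdmissibleDensities d s μ f g) {L L' : ℕ}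
    (a : Fin L × Fin T → ℂ) (c : Fin L' × Fin T → ℂ) :
    Integrable (fun t => ((‖beta d s t‖ ^ 2 / ‖chi d s (intStep μ) t‖ ^ 2 : ℝ) : ℂ) *
        hermForm ((obsDensity d s f g t)⁻¹ * f t * (obsDensity d s f g t)⁻¹)
          (conj (chi d s (intStep μ) t) • (blockPoly a t ᵥ* g t) + blockPoly c t)) freqMeasure ∧
      Integrable (fun t => ((1 / ‖chi d s (intStep μ) t‖ ^ 2 : ℝ) : ℂ) *
        hermForm ((obsDensity d s f g t)⁻¹ * g t * (obsDensity d s f g t)⁻¹)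
          (conj (chi d s (intStep μ) t) • (blockPoly a t ᵥ* f t) -
            ((‖beta d s t‖ ^ 2 : ℝ) : ℂ) • blockPoly c t)) freqMeasure ∧
      ∫ t, ((‖beta d s t‖ ^ 2 / ‖chi d s (intStep μ) t‖ ^ 2 : ℝ) : ℂ) *
        hermForm ((obsDensity d s f g t)⁻¹ * f t * (obsDensity d s f g t)⁻¹)
          (conj (chi d s (intStep μ) t) • (blockPoly a t ᵥ* g t) + blockPoly c t) ∂freqMeasure +
      ∫ t, ((1 / ‖chi d s (intStep μ) t‖ ^ 2 : ℝ) : ℂ) *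
        hermForm ((obsDensity d s f g t)⁻¹ * g t * (obsDensity d s f g t)⁻¹)
          (conj (chi d s (intStep μ) t) • (blockPoly a t ᵥ* f t) -
            ((‖beta d s t‖ ^ 2 : ℝ) : ℂ) • blockPoly c t) ∂freqMeasure =
      (fourierBlockMatrix L' (kernelP d s (intStep μ) f g) *ᵥ c) ⬝ᵥ star c +
        (fourierBlockMatrix L (kernelQ d s f g) *ᵥ a) ⬝ᵥ star a := by
  have hQ := fourierBlockMatrix_quadratic H.integrable_kernelQ a
  have hP := fourierBlockMatrix_quadratic H.integrable_kernelP c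
  set I₁ : ℝ → ℂ := fun t => ((‖beta d s t‖ ^ 2 / ‖chi d s (intStep μ) t‖ ^ 2 : ℝ) : ℂ) *
        hermForm ((obsDensity d s f g t)⁻¹ * f t * (obsDensity d s f g t)⁻¹)
          (conj (chi d s (intStep μ) t) • (blockPoly a t ᵥ* g t) + blockPoly c t) with hI₁
  set I₂ : ℝ → ℂ := fun t => ((1 / ‖chi d s (intStep μ) t‖ ^ 2 : ℝ) : ℂ) *
        hermForm ((obsDensity d s f g t)⁻¹ * g t * (obsDensity d s f g t)⁻¹)
          (conj (chi d s (intStep μ) t) • (blockPoly a t ᵥ* f t) -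
            ((‖beta d s t‖ ^ 2 : ℝ) : ℂ) • blockPoly c t) with hI₂
  have hsum : ∀ᵐ t ∂freqMeasure, I₁ t + I₂ t =
      hermForm (kernelP d s (intStep μ) f g t) (blockPoly c t) +
        hermForm (kernelQ d s f g t) (blockPoly a t) := by
    filter_upwards [H.ae_regular] with t ⟨hf, hg, _, hdet, hc, _⟩
    have := hermForm_error_decomposition hf hg hdet hc (blockPoly a t) (blockPoly c t)
    rw [add_comm (hermForm (kernelP d s (intStep μ) f g t) (blockPoly c t)), kernelP,
      hermForm_smul_matrix]
    exact this
  have hnn : ∀ᵐ t ∂freqMeasure, 0 ≤ I₁ t ∧ 0 ≤ I₂ t := by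
    filter_upwards [H.ae_regular] with t ⟨hf, hg, hpos, _, _, _⟩
    have key : ∀ {B : Matrix (Fin T) (Fin T) ℂ}, B.PosSemidef →
        ((obsDensity d s f g t)⁻¹ * B * (obsDensity d s f g t)⁻¹).PosSemidef := fun {B} hB => by
      have := hB.mul_mul_conjTranspose_same (obsDensity d s f g t)⁻¹
      rwa [hpos.isHermitian.inv.eq] at this
    have h1 : (0 : ℝ) ≤ ‖beta d s t‖ ^ 2 / ‖chi d s (intStep μ) t‖ ^ 2 := by positivity
    have h2 : (0 : ℝ) ≤ 1 / ‖chi d s (intStep μ) t‖ ^ 2 := by positivity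
    exact ⟨mul_nonneg (by exact_mod_cast h1) (hermForm_nonneg (key hf) _),
      mul_nonneg (by exact_mod_cast h2) (hermForm_nonneg (key hg) _)⟩
  have hJ := hP.1.add hQ.1
  have hpolym : ∀ {L : ℕ} (c : Fin L × Fin T → ℂ) (p : Fin T),
      AEMeasurable (fun t => blockPoly c t p) freqMeasure := fun c p =>
    (continuous_finsetSum _ fun k _ =>
      continuous_const.mul (continuous_expo _)).measurable.aemeasurable
  have hfm : ∀ p q, AEMeasurable (fun t => f t p q) freqMeasure := fun p q =>
    (H.signal.integrable p q).aestronglyMeasurable.aemeasurable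
  have hgm : ∀ p q, AEMeasurable (fun t => g t p q) freqMeasure := fun p q =>
    (H.noise.integrable p q).aestronglyMeasurable.aemeasurable
  have hVm := H.aemeasurable_inv_obs
  have hχ : Measurable fun t => conj (chi d s (intStep μ) t) :=
    (Complex.continuous_conj.comp (continuous_chi d s _)).measurable
  have hβn : Measurable fun t => ‖beta d s t‖ ^ 2 := ((continuous_beta d s).norm.pow 2).measurable
  have hχn : Measurable fun t => ‖chi d s (intStep μ) t‖ ^ 2 :=
    ((continuous_chi d s _).norm.pow 2).measurable
  have hm₁ : AEMeasurable I₁ freqMeasure := by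
    refine AEMeasurable.mul (Complex.measurable_ofReal.comp (hβn.div hχn)).aemeasurable
      (aemeasurable_hermForm (fun p => ?_) (aemeasurable_mul (aemeasurable_mul hVm hfm) hVm))
    exact AEMeasurable.add (AEMeasurable.mul hχ.aemeasurable
      (aemeasurable_vecMul (hpolym a) hgm p)) (hpolym c p)
  have hm₂ : AEMeasurable I₂ freqMeasure := by
    refine AEMeasurable.mul
      (Complex.measurable_ofReal.comp (measurable_const.div hχn)).aemeasurable
      (aemeasurable_hermForm (fun p => ?_) (aemeasurable_mul (aemeasurable_mul hVm hgm) hVm))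
    exact AEMeasurable.sub (AEMeasurable.mul hχ.aemeasurable
      (aemeasurable_vecMul (hpolym a) hfm p)) (AEMeasurable.mul
        (Complex.measurable_ofReal.comp hβn).aemeasurable (hpolym c p))
  -- both integrands are nonnegative, and their sum is integrable
  have hbound : ∀ {z w : ℂ}, 0 ≤ z → 0 ≤ w → ‖z‖ ≤ ‖z + w‖ := by
    intro z w hz hw
    rw [Complex.le_def] at hz hw
    have hz' : ‖z‖ = z.re := by
      rw [← Complex.re_add_im z, ← hz.2]
      simpa using hz.1
    rw [hz']
    refine le_trans ?_ (Complex.re_le_norm _)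
    rw [Complex.add_re]
    exact le_add_of_nonneg_right hw.1
  have hi₁ : Integrable I₁ freqMeasure := by
    refine hJ.norm.mono' hm₁.aestronglyMeasurable ?_
    filter_upwards [hsum, hnn] with t h1 h2
    rw [Pi.add_apply, ← h1]
    exact hbound h2.1 h2.2
  have hi₂ : Integrable I₂ freqMeasure := by
    refine hJ.norm.mono' hm₂.aestronglyMeasurable ?_
    filter_upwards [hsum, hnn] with t h1 h2
    rw [Pi.add_apply, ← h1, add_comm]
    exact hbound h2.2 h2.1
  refine ⟨hi₁, hi₂, ?_⟩
  rw [← integral_add hi₁ hi₂, hP.2, hQ.2, ← integral_add hP.1 hQ.1]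
  exact integral_congr_ae hsum

end Optimal

end GMInterp

open GMInterp in
theorem theorem2p2 {Ω : Type*} [MeasurableSpace Ω] (P : Measure Ω) [IsProbabilityMeasure P]
    {r T : ℕ} (hT : 0 < T)
    (d s μ : Fin r → ℕ) (hd : ∀ i, 0 < d i) (hs : ∀ i, 0 < s i) (hμ : ∀ i, 0 < μ i)
    (ϑ η : ℤ → Ω → ℂ) (f g : ℝ → Matrix (Fin T) (Fin T) ℂ)
    (hϑ : HasPeriodicallyStationaryGMIncrements P T d s ϑ)
    (hϑ_mean : ∀ ν, AdmissibleStep ν → ∀ m,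
      ∫ ω, gmIncrement d (fun i => T * s i) ν ϑ m ω ∂P = 0)
    (hf : IsGMSpectralDensity P d s (block T ϑ) f)
    (hη_mean : ∀ m, ∫ ω, η m ω ∂P = 0)
    (hg : IsStationarySpectralDensity P (block T η) g)
    (huncorrelated : ∀ ν, AdmissibleStep ν → ∀ p q m k,
      ∫ ω, gmIncrement d s ν (block T ϑ p) m ω * conj (block T η q k ω) ∂P = 0)
    (hmin : MinimalityCondition d s (intStep μ) f g)
    (M : ℕ) (a : ℕ → ℂ)
    -- the number of the last block, the block coefficients, the functional `A_M ϑ`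
    (N : ℕ) (hN : N = M / T)
    (α : ℕ → Fin T → ℂ) (hα : α = blockCoeff T M a)
    (A : Ω → ℂ) (hA : A = fun ω => ∑ k ∈ Finset.range (M + 1), a k * ϑ k ω)
    -- the observed sequence `ζ = ϑ + η`, in blocks
    (ζ : Fin T → ℤ → Ω → ℂ) (hζ : ζ = block T (fun m ω => ϑ m ω + η m ω)) :
    -- the functional in block form
    (A = fun ω => ∑ m ∈ Finset.range (N + 1), ∑ p, α m p * block T ϑ p m ω) ∧
    -- the Fourier coefficients are well defined and `P_N` is invertible
    (∀ p q, Integrable (fun t => kernelP d s (intStep μ) f g t p q) freqMeasure) ∧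
    (∀ p q, Integrable (fun t => kernelT d s (intStep μ) f g t p q) freqMeasure) ∧
    (∀ p q, Integrable (fun t => kernelQ d s f g t p q) freqMeasure) ∧
    IsUnit (matP d s μ f g N).det ∧
    -- the vector `T_N [a]₊` through the shifted coefficients `a_μ`
    ((∀ p q, Integrable (fun t => kernelT' d s (intStep μ) f g t p q) freqMeasure) →
      matT d s μ f g N *ᵥ stack N _ α =
        (-1 : ℂ) ^ (∑ i, d i) •
          (matT' d s μ f g N *ᵥ stack (N + gmDegree d s μ) _ (aShift d s μ N α))) ∧
    -- the optimal estimate exists and equals `∫ hᵀ dZ - V_N ζ`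
    (∃ Y, IsOptimalEstimate P d s μ ζ N α A Y) ∧
    (∃ Z, IsSpectralProcess P d s ζ (obsDensity d s f g) Z) ∧
    (∀ Z, IsSpectralProcess P d s ζ (obsDensity d s f g) Z → ∀ Y,
      IsOptimalEstimate P d s μ ζ N α A Y ↔
        IsStochasticIntegral P (obsDensity d s f g) Z (specChar d s μ f g N α)
          (fun ω => Y ω + initialPart d s μ N α ζ ω)) ∧
    -- the mean square error
    (∀ Y, IsOptimalEstimate P d s μ ζ N α A Y →
      MemLp (fun ω => A ω - Y ω) 2 P ∧
      ((∫ ω, ‖A ω - Y ω‖ ^ 2 ∂P : ℝ) : ℂ) =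
        rhs d s μ f g N α ⬝ᵥ star ((matP d s μ f g N)⁻¹ *ᵥ rhs d s μ f g N α) +
          (matQ d s f g N *ᵥ stack N _ α) ⬝ᵥ star (stack N _ α) ∧
      Integrable (fun t => ((‖beta d s t‖ ^ 2 / ‖chi d s (intStep μ) t‖ ^ 2 : ℝ) : ℂ) *
        hermForm ((obsDensity d s f g t)⁻¹ * f t * (obsDensity d s f g t)⁻¹)
          (conj (chi d s (intStep μ) t) • (trigPoly N α t ᵥ* g t) + cPoly d s μ f g N α t))
        freqMeasure ∧
      Integrable (fun t => ((1 / ‖chi d s (intStep μ) t‖ ^ 2 : ℝ) : ℂ) *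
        hermForm ((obsDensity d s f g t)⁻¹ * g t * (obsDensity d s f g t)⁻¹)
          (conj (chi d s (intStep μ) t) • (trigPoly N α t ᵥ* f t) -
            ((‖beta d s t‖ ^ 2 : ℝ) : ℂ) • cPoly d s μ f g N α t))
        freqMeasure ∧
      ((∫ ω, ‖A ω - Y ω‖ ^ 2 ∂P : ℝ) : ℂ) =
        ∫ t, ((‖beta d s t‖ ^ 2 / ‖chi d s (intStep μ) t‖ ^ 2 : ℝ) : ℂ) *
          hermForm ((obsDensity d s f g t)⁻¹ * f t * (obsDensity d s f g t)⁻¹)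
            (conj (chi d s (intStep μ) t) • (trigPoly N α t ᵥ* g t) + cPoly d s μ f g N α t)
          ∂freqMeasure +
        ∫ t, ((1 / ‖chi d s (intStep μ) t‖ ^ 2 : ℝ) : ℂ) *
          hermForm ((obsDensity d s f g t)⁻¹ * g t * (obsDensity d s f g t)⁻¹)
            (conj (chi d s (intStep μ) t) • (trigPoly N α t ᵥ* f t) -
              ((‖beta d s t‖ ^ 2 : ℝ) : ℂ) • cPoly d s μ f g N α t)
          ∂freqMeasure) := by
  have hζ' : ∀ p m ω, ζ p m ω = block T ϑ p m ω + block T η p m ω := fun p m ω => by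
    rw [hζ]
    rfl
  have H : AdmissibleDensities d s μ f g := ⟨hs, hμ, hf.density, hg.density, hmin⟩
  have hA' : A = fun ω => ∑ m ∈ Finset.range (N + 1), ∑ p, α m p * block T ϑ p m ω := by
    rw [hA, hα, hN]
    funext ω
    exact sum_range_eq_blocks hT M a fun k => ϑ k ω
  have hmean : ∀ ν, AdmissibleStep ν → ∀ p k, ∫ ω, gmIncrement d s ν (ζ p) k ω ∂P = 0 := by
    intro ν hν p k
    have e : ζ p = fun m ω => block T ϑ p m ω + block T η p m ω := by
      funext m ω
      exact hζ' p m ω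
    have h1 : ∫ ω, gmIncrement d s ν (block T ϑ p) k ω ∂P = 0 := by
      rw [gmIncrement_block]
      exact hϑ_mean ν hν _
    have h2 : ∫ ω, gmIncrement d s ν (block T η p) k ω ∂P = 0 := by
      simp only [gmIncrement]
      rw [integral_finsetSum _ fun l _ =>
        ((hg.memLp p _).integrable one_le_two).const_mul _]
      refine Finset.sum_eq_zero fun l _ => ?_
      rw [integral_const_mul, block, hη_mean, mul_zero]
    rw [e, gmIncrement_add]
    refine (integral_add ((hf.memLp ν hν p k).integrable one_le_two)
      ((memLp_increment_stationary hg ν p k).1.integrable one_le_two)).trans ?_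
    rw [h1, h2, add_zero]
  obtain ⟨S, hS⟩ := H.exists_isFactor
  obtain ⟨V, hV⟩ := exists_mapsToGMIncrements hs hμ hf hg huncorrelated hζ' hmin.isUnit_det hS
  have hopt := fun Y => H.isOptimalEstimate_iff hS hf hg huncorrelated hζ' hV N α hA' Y
  refine ⟨hA', H.integrable_kernelP, H.integrable_kernelT, H.integrable_kernelQ,
    H.isUnit_det_matP N, H.matT_mulVec_eq N α,
    ⟨fun ω => V (toWeighted S (specChar d s μ f g N α)) ω - initialPart d s μ N α ζ ω,
      (hopt _).2 (Filter.Eventually.of_forall fun ω => sub_add_cancel _ _)⟩,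
    exists_isSpectralProcess hs hμ hf hg hζ' hmin.isUnit_det hS hmean hV, fun Z hZ Y => ?_,
    fun Y hY => ?_⟩
  · obtain ⟨V', hV'Z, hV'⟩ :=
      exists_isometry_of_isSpectralProcess hs hf hg hζ' hmin.isUnit_det hS hZ
    rw [H.isOptimalEstimate_iff hS hf hg huncorrelated hζ' hV' N α hA' Y]
    exact (isStochasticIntegral_iff hS (integrable_obsDensity hf.density hg.density)
      hmin.isUnit_det hV'Z (H.toWeighted_specChar hS N α).1 _).symm
  · have hY' := (hopt Y).1 hY
    have herr : (target P d s μ (block T η) S V N α -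
        V (toWeighted S (specChar d s μ f g N α)) : Lp ℂ 2 P) =ᵐ[P] fun ω => A ω - Y ω := by
      refine (Lp.coeFn_sub _ _).trans ?_
      filter_upwards [H.functional_add_initialPart hf hg hζ' hV N α hA', hY'] with ω h1 h2
      rw [Pi.sub_apply, ← h1, ← h2]
      ring
    have hsq : ((∫ ω, ‖A ω - Y ω‖ ^ 2 ∂P : ℝ) : ℂ) =
        (matP d s μ f g N *ᵥ cCoeff d s μ f g N α) ⬝ᵥ star (cCoeff d s μ f g N α) +
          (matQ d s f g N *ᵥ stack N _ α) ⬝ᵥ star (stack N _ α) := by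
      rw [← H.inner_target_sub_self hS hf hg huncorrelated hζ' hV, inner_L2 _ _ herr herr]
      refine integral_complex_ofReal.symm.trans (integral_congr_ae ?_)
      exact Filter.Eventually.of_forall fun ω => norm_sq_eq_mul_conj _
    have hc : matP d s μ f g N *ᵥ cCoeff d s μ f g N α = rhs d s μ f g N α := by
      rw [cCoeff, Matrix.mulVec_mulVec, Matrix.mul_nonsing_inv _ (H.isUnit_det_matP N),
        Matrix.one_mulVec]
    have hint := H.integral_error (stack N (N + 1) α) (cCoeff d s μ f g N α)
    rw [blockPoly_stack (Nat.lt_succ_self N)] at hint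
    refine ⟨(Lp.memLp _).ae_eq herr, ?_, hint.1, hint.2.1, hsq.trans hint.2.2.symm⟩
    rw [hsq, hc]
    rfl
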